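/- Let $\mathbb K$ be a field of characteristic $0$ and let $V=\bigoplus_{i\in\mathbb Z}V^i$ be a graded vector space over $\mathbb K$. Let $S^c(V)=\bigoplus_{n\ge 0}V^{\odot n}$ be its symmetric coalgebra, where $V^{\odot n}$ is the $n$-th graded symmetric power and the coproduct $\Delta$ is the sum over unshuffles with Koszul signs. An $L_\infty[1]$-algebra structure on $V$ is a coderivation $Q$ of $S^c(V)$ of degree $+1$ with $Q(1)=0$ and $QQ=0$. Its brackets $q_k\colon V^{\odot k}\to V$, $k\ge 1$, are the components of $Q$ followed by the projection $S^c(V)\to V$; they determine $Q$, and one writes $(V,q_1,q_2,\ldots)$. The algebra is minimal if $q_1=0$; in that case $(V,0,q_2,0,0,\ldots)$ is again an $L_\infty[1]$-algebra. An $L_\infty$-morphism $(V,Q)\dashrightarrow(W,R)$ is a morphism of graded coalgebras $f\colon S^c(V)\to S^c(W)$, compatible with counits and with $f(1)=1$, such that $fQ=Rf$; it is an $L_\infty$-isomorphism if $f$ is bijective. The Chevalley–Eilenberg complex $CE(V,V)$ of $(V,Q)$ is the graded space of coderivations of $S^c(V)$, with differential $d\alpha=Q\alpha-(-1)^{\deg\alpha}\alpha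 Q$ and filtration $F^p=\{\alpha\mid \alpha(V^{\odot i})=0 \text{ for all } i<p\}$. Let $(E(V,V)^{p,q}_r,d_r)$ be the spectral sequence of this filtered complex: with \[Z^{p,q}_r=\{x\in F^pCE^{p+q}\mid dx\in F^{p+r}CE^{p+q+1}\}\] one has \[E^{p,q}_r=\frac{Z^{p,q}_r}{Z^{p+1,q-1}_{r-1}+dZ^{p-r+1,q+r-2}_{r-1}},\] and $d_r\colon E^{p,q}_r\to E^{p+r,q-r+1}_r$ is induced by $d$. It degenerates at $E_2$ if $d_r=0$ for every $r\ge 2$. For a minimal algebra the Euler class $e\in E(V,V)^{1,-1}_2$ is the class of the coderivation of $S^c(V)$ whose composition with the projection $S^c(V)\to V$ is $v\mapsto(\deg v+1)\,v$ on homogeneous $v\in V$ and zero on $V^{\odot n}$ for $n\neq 1$. Theorem. For a minimal $L_\infty[1]$-algebra $(V,0,q_2,q_3,\ldots)$ with Euler class $e\in E(V,V)^{1,-1}_2$ the following conditions are equivalent: 1. there exists an $L_\infty$-isomorphism $f\colon(V,0,q_2,0,0,\ldots)\dashrightarrow(V,0,q_2,q_3,\ldots)$; 2. the spectral sequence $E(V,V)^{p,q}_r$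 degenerates at $E_2$; 3. $d_r(e)=0\in E(V,V)^{r+1,-r}_r$ for every $r\ge 2$, where $e$ is regarded recursively as an element of $E(V,V)^{1,-1}_r$: if $d_r(e)=0$, then $e$ defines a class in $E^{1,-1}_{r+1}\cong\ker d_r/\operatorname{im}d_r$. -/

import Mathlib

namespace LInfinity

open scoped TensorProduct DirectSum

noncomputable section

/-- The sign `(-1)^n`, as an element of the ground field. -/
def sgn (K : Type*) [Field K] (n : ℤ) : K := ((n.negOnePow : ℤ) : K)

section Sign

variable {K : Type*} [Field K]

@[simp]
theorem sgn_zero : sgn K 0 = 1 := by simp [sgn]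

theorem sgn_one : sgn K 1 = -1 := by simp [sgn]

theorem sgn_add (m n : ℤ) : sgn K (m + n) = sgn K m * sgn K n := by
  simp [sgn, Int.negOnePow_add]

theorem sgn_mul_self (m : ℤ) : sgn K m * sgn K m = 1 := by
  rw [← sgn_add, ← two_mul]; simp [sgn, Int.negOnePow_two_mul]

end Sign

variable {K V : Type*} [Field K] [AddCommGroup V] [Module K V]

/-- The relations `x ⊗ y = (-1)^(deg x * deg y) y ⊗ x` of graded commutativity. -/
inductive SymRel (𝒱 : ℤ → Submodule K V) : TensorAlgebra K V → TensorAlgebra K V → Prop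
  | comm (i j : ℤ) (x y : V) (hx : x ∈ 𝒱 i) (hy : y ∈ 𝒱 j) :
      SymRel 𝒱 (TensorAlgebra.ι K x * TensorAlgebra.ι K y)
        (sgn K (i * j) • (TensorAlgebra.ι K y * TensorAlgebra.ι K x))

/-- The vector space `S(V) = ⨁ₙ V^{⊙ n}` underlying the symmetric coalgebra of a graded vector
space `V`, with its (graded commutative) product `⊙`. -/
def SymCoalg (𝒱 : ℤ → Submodule K V) : Type _ := RingQuot (SymRel 𝒱)

namespace SymCoalg

instance instRing (𝒱 : ℤ → Submodule K V) : Ring (SymCoalg 𝒱) :=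
  inferInstanceAs (Ring (RingQuot (SymRel 𝒱)))

instance instAlgebra (𝒱 : ℤ → Submodule K V) : Algebra K (SymCoalg 𝒱) :=
  inferInstanceAs (Algebra K (RingQuot (SymRel 𝒱)))

variable (𝒱 : ℤ → Submodule K V)

/-- The inclusion `V = V^{⊙ 1} → S(V)`. -/
def ι : V →ₗ[K] SymCoalg 𝒱 :=
  (RingQuot.mkAlgHom K (SymRel 𝒱)).toLinearMap ∘ₗ TensorAlgebra.ι K

theorem ι_mul_ι {i j : ℤ} {x y : V} (hx : x ∈ 𝒱 i) (hy : y ∈ 𝒱 j) :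
    ι 𝒱 x * ι 𝒱 y = sgn K (i * j) • (ι 𝒱 y * ι 𝒱 x) := by
  have h := RingQuot.mkAlgHom_rel K (SymRel.comm (𝒱 := 𝒱) i j x y hx hy)
  rw [map_smul, map_mul, map_mul] at h
  exact h

/-- The universal property of `S(V)` as a graded commutative algebra. -/
def lift {A : Type*} [Semiring A] [Algebra K A] (f : V →ₗ[K] A)
    (hf : ∀ (i j : ℤ) (x y : V), x ∈ 𝒱 i → y ∈ 𝒱 j →
      f x * f y = sgn K (i * j) • (f y * f x)) : SymCoalg 𝒱 →ₐ[K] A :=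
  RingQuot.liftAlgHom K ⟨TensorAlgebra.lift K f, by
    rintro _ _ ⟨i, j, x, y, hx, hy⟩
    simpa using hf i j x y hx hy⟩

@[simp]
theorem lift_ι {A : Type*} [Semiring A] [Algebra K A] (f : V →ₗ[K] A)
    (hf : ∀ (i j : ℤ) (x y : V), x ∈ 𝒱 i → y ∈ 𝒱 j →
      f x * f y = sgn K (i * j) • (f y * f x)) (x : V) : lift 𝒱 f hf (ι 𝒱 x) = f x := by
  unfold lift ι
  exact (RingQuot.liftAlgHom_mkAlgHom_apply K _ _ _).trans (TensorAlgebra.lift_ι_apply f x)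

theorem algHom_ext {A : Type*} [Semiring A] [Algebra K A] {f g : SymCoalg 𝒱 →ₐ[K] A}
    (h : ∀ x, f (ι 𝒱 x) = g (ι 𝒱 x)) : f = g := by
  apply RingQuot.ringQuot_ext' K
  apply TensorAlgebra.hom_ext
  ext x
  exact h x

/-- `IsMonomial 𝒱 n d y`: `y = v₁ ⊙ ⋯ ⊙ vₙ` with all `vᵢ` homogeneous and total degree `d`. -/
inductive IsMonomial : ℕ → ℤ → SymCoalg 𝒱 → Prop
  | one : IsMonomial 0 0 1
  | ι_mul {i : ℤ} {n : ℕ} {d : ℤ} {x : V} {y : SymCoalg 𝒱} (hx : x ∈ 𝒱 i) (hy : IsMonomial n d y) :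
      IsMonomial (n + 1) (i + d) (ι 𝒱 x * y)

theorem IsMonomial.ι {i : ℤ} {x : V} (hx : x ∈ 𝒱 i) : IsMonomial 𝒱 1 i (ι 𝒱 x) := by
  have := IsMonomial.ι_mul hx (IsMonomial.one (𝒱 := 𝒱))
  simpa using this

theorem IsMonomial.mul {n m : ℕ} {d e : ℤ} {x y : SymCoalg 𝒱} (hx : IsMonomial 𝒱 n d x)
    (hy : IsMonomial 𝒱 m e y) : IsMonomial 𝒱 (n + m) (d + e) (x * y) := by
  induction hx with
  | one => simpa using hy
  | ι_mul hx _ ih =>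
    rw [mul_assoc, add_assoc (_ : ℤ), Nat.add_right_comm _ 1 m]
    exact IsMonomial.ι_mul hx ih

/-- The span of the monomials `v₁ ⊙ ⋯ ⊙ vₙ` of total degree `d` for which `c (n, d) = a`. -/
def part {A : Type*} [AddCommMonoid A] (c : ℕ × ℤ →+ A) (a : A) : Submodule K (SymCoalg 𝒱) :=
  Submodule.span K {y | ∃ n d, IsMonomial 𝒱 n d y ∧ c (n, d) = a}

section Part

variable {A : Type*} [AddCommMonoid A] (c : ℕ × ℤ →+ A)

theorem IsMonomial.mem_part {n : ℕ} {d : ℤ} {y : SymCoalg 𝒱} (hy : IsMonomial 𝒱 n d y) :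
    y ∈ part 𝒱 c (c (n, d)) :=
  Submodule.subset_span ⟨n, d, hy, rfl⟩

instance part_gradedMonoid : SetLike.GradedMonoid (part 𝒱 c) where
  one_mem := Submodule.subset_span ⟨0, 0, IsMonomial.one, map_zero c⟩
  mul_mem a b x y hx hy := by
    have h := Submodule.mul_mem_mul hx hy
    unfold part at h
    rw [Submodule.span_mul_span] at h
    refine Submodule.span_le.2 ?_ h
    rintro _ ⟨x, ⟨n, d, h1, rfl⟩, y, ⟨m, e, h2, rfl⟩, rfl⟩
    have := (h1.mul 𝒱 h2).mem_part 𝒱 c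
    rw [← map_add]
    exact this

variable [DirectSum.Decomposition 𝒱] [DecidableEq A]

/-- Auxiliary: the map `V → ⨁ₐ part c a` sending `x ∈ 𝒱 i` to `x` in the summand `c (1, i)`. -/
def partι : V →ₗ[K] ⨁ a, part 𝒱 c a :=
  (DirectSum.toModule K ℤ (⨁ a, part 𝒱 c a) fun i =>
    DirectSum.lof K A (fun a => part 𝒱 c a) (c (1, i)) ∘ₗ
      ((ι 𝒱).domRestrict (𝒱 i)).codRestrict _ fun x =>
        (IsMonomial.ι 𝒱 x.2).mem_part 𝒱 c) ∘ₗ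
  (DirectSum.decomposeLinearEquiv 𝒱).toLinearMap

theorem partι_apply {i : ℤ} {x : V} (hx : x ∈ 𝒱 i) :
    partι 𝒱 c x = DirectSum.of (fun a => part 𝒱 c a) (c (1, i))
      ⟨ι 𝒱 x, (IsMonomial.ι 𝒱 hx).mem_part 𝒱 c⟩ := by
  simp only [partι, LinearMap.comp_apply, LinearEquiv.coe_coe, DirectSum.decomposeLinearEquiv_apply]
  rw [DirectSum.decompose_of_mem 𝒱 hx, ← DirectSum.lof_eq_of K, DirectSum.toModule_lof]
  rfl

/-- Auxiliary: the decomposition of `S(V)` into the subspaces `part c a`. -/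
def partHom : SymCoalg 𝒱 →ₐ[K] ⨁ a, part 𝒱 c a :=
  lift 𝒱 (partι 𝒱 c) (by
    intro i j x y hx hy
    rw [partι_apply 𝒱 c hx, partι_apply 𝒱 c hy, DirectSum.of_mul_of, DirectSum.of_mul_of,
      ← DirectSum.lof_eq_of K, ← DirectSum.lof_eq_of K, ← map_smul, DirectSum.lof_eq_of,
      DirectSum.lof_eq_of]
    refine DirectSum.of_eq_of_gradedMonoid_eq (Sigma.subtype_ext (add_comm _ _) ?_)
    exact ι_mul_ι 𝒱 hx hy)

theorem partHom_ι (x : V) : partHom 𝒱 c (ι 𝒱 x) = partι 𝒱 c x := lift_ι ..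

theorem partHom_monomial {n : ℕ} {d : ℤ} {y : SymCoalg 𝒱} (hy : IsMonomial 𝒱 n d y) :
    partHom 𝒱 c y = DirectSum.of (fun a => part 𝒱 c a) (c (n, d)) ⟨y, hy.mem_part 𝒱 c⟩ := by
  induction hy with
  | one =>
    rw [map_one, DirectSum.one_def]
    exact DirectSum.of_eq_of_gradedMonoid_eq (Sigma.subtype_ext (map_zero c).symm rfl)
  | ι_mul hx hy ih =>
    rw [map_mul, partHom_ι, ih, partι_apply 𝒱 c hx, DirectSum.of_mul_of]
    refine DirectSum.of_eq_of_gradedMonoid_eq (Sigma.subtype_ext ?_ rfl)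
    exact (map_add c _ _).symm.trans (by rw [Prod.mk_add_mk, add_comm 1]; rfl)

instance partGradedAlgebra : GradedAlgebra (part 𝒱 c) :=
  GradedAlgebra.ofAlgHom _ (partHom 𝒱 c)
    (by
      apply algHom_ext
      intro x
      induction x using DirectSum.Decomposition.inductionOn 𝒱 with
      | zero => simp
      | add x y hx hy => simp only [map_add, hx, hy]
      | @homogeneous i x =>
        rw [AlgHom.comp_apply, partHom_ι, partι_apply 𝒱 c x.2, DirectSum.coeAlgHom_of]
        rfl)
    (by
      rintro a ⟨x, hx⟩
      refine Submodule.span_induction (p := fun x hx => partHom 𝒱 c x =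
        DirectSum.of (fun a => part 𝒱 c a) a ⟨x, hx⟩) ?_ ?_ ?_ ?_ hx
      · rintro y ⟨n, d, hy, rfl⟩
        exact partHom_monomial 𝒱 c hy
      · rw [map_zero]; exact (map_zero _).symm
      · intro x y hx hy h1 h2
        rw [map_add, h1, h2, ← map_add]; rfl
      · intro r x hx h
        rw [map_smul, h, ← DirectSum.lof_eq_of K, ← map_smul]; rfl)

end Part

theorem induction_monomial [DirectSum.Decomposition 𝒱] {p : SymCoalg 𝒱 → Prop}
    (mono : ∀ n d y, IsMonomial 𝒱 n d y → p y) (zero : p 0) (add : ∀ x y, p x → p y → p (x + y))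
    (smul : ∀ (r : K) x, p x → p (r • x)) (x : SymCoalg 𝒱) : p x := by
  have : x ∈ part 𝒱 (0 : ℕ × ℤ →+ PUnit) 0 := by
    classical
    rw [← DirectSum.sum_support_decompose (part 𝒱 (0 : ℕ × ℤ →+ PUnit)) x]
    exact Submodule.sum_mem _ fun i _ => SetLike.coe_mem _
  refine Submodule.span_induction (p := fun x _ => p x) ?_ zero (fun x y _ _ => add x y)
    (fun r x _ => smul r x) this
  rintro y ⟨n, d, hy, -⟩
  exact mono n d y hy

/-- The elements of `S(V)` of (internal) degree `d`. -/
abbrev degPart (d : ℤ) : Submodule K (SymCoalg 𝒱) := part 𝒱 (AddMonoidHom.snd ℕ ℤ) d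

/-- The symmetric power `V^{⊙ n}`, as a subspace of `S(V)`. -/
abbrev symPow (n : ℕ) : Submodule K (SymCoalg 𝒱) := part 𝒱 (AddMonoidHom.fst ℕ ℤ) n

theorem IsMonomial.mem_degPart {n : ℕ} {d : ℤ} {y : SymCoalg 𝒱} (hy : IsMonomial 𝒱 n d y) :
    y ∈ degPart 𝒱 d := hy.mem_part 𝒱 (AddMonoidHom.snd ℕ ℤ)

theorem IsMonomial.mem_symPow {n : ℕ} {d : ℤ} {y : SymCoalg 𝒱} (hy : IsMonomial 𝒱 n d y) :
    y ∈ symPow 𝒱 n := hy.mem_part 𝒱 (AddMonoidHom.fst ℕ ℤ)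

theorem one_mem_degPart : (1 : SymCoalg 𝒱) ∈ degPart 𝒱 0 := IsMonomial.one.mem_degPart 𝒱

theorem ι_mem_degPart {i : ℤ} {x : V} (hx : x ∈ 𝒱 i) : ι 𝒱 x ∈ degPart 𝒱 i :=
  (IsMonomial.ι 𝒱 hx).mem_degPart 𝒱

/-- The counit `S(V) → K`, i.e. the projection onto `V^{⊙ 0} = K`. -/
def counit : SymCoalg 𝒱 →ₐ[K] K := lift 𝒱 0 (by simp)

@[simp]
theorem counit_ι (x : V) : counit 𝒱 (ι 𝒱 x) = 0 := by simp [counit]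

/-- The projection `S(V) → V^{⊙ 1} = V`. -/
def proj : SymCoalg 𝒱 →ₗ[K] V :=
  letI : Module Kᵐᵒᵖ V := Module.compHom _ ((RingHom.id K).fromOpposite mul_comm)
  haveI : IsCentralScalar K V := ⟨fun _ _ => rfl⟩
  TrivSqZeroExt.sndHom K V ∘ₗ
    (lift 𝒱 (TrivSqZeroExt.inrHom K V) (by simp)).toLinearMap

@[simp]
theorem proj_one : proj 𝒱 1 = 0 := by
  let _ : Module Kᵐᵒᵖ V := Module.compHom _ ((RingHom.id K).fromOpposite mul_comm)
  have : IsCentralScalar K V := ⟨fun _ _ => rfl⟩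
  simp [proj]

theorem proj_ι_mul (v : V) (x : SymCoalg 𝒱) : proj 𝒱 (ι 𝒱 v * x) = counit 𝒱 x • v := by
  let _ : Module Kᵐᵒᵖ V := Module.compHom _ ((RingHom.id K).fromOpposite mul_comm)
  have : IsCentralScalar K V := ⟨fun _ _ => rfl⟩
  have h : (TrivSqZeroExt.fstHom K K V).comp
      (lift 𝒱 (TrivSqZeroExt.inrHom K V) (by simp)) = counit 𝒱 := by
    apply algHom_ext
    intro x
    simp
  have h' := DFunLike.congr_fun h x
  simp only [AlgHom.comp_apply, TrivSqZeroExt.fstHom_apply] at h'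
  simp [proj, h']

@[simp]
theorem proj_ι (v : V) : proj 𝒱 (ι 𝒱 v) = v := by simpa using proj_ι_mul 𝒱 v 1

theorem proj_mem {d : ℤ} {x : SymCoalg 𝒱} (hx : x ∈ degPart 𝒱 d) : proj 𝒱 x ∈ 𝒱 d := by
  refine (Submodule.span_le (p := (𝒱 d).comap (proj 𝒱))).2 ?_ hx
  rintro y ⟨n, d, hy, rfl⟩
  cases hy with
  | one => simp
  | @ι_mul i n d v y hv hy =>
    simp only [SetLike.mem_coe, Submodule.mem_comap, proj_ι_mul]
    cases hy with
    | one => simpa using hv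
    | ι_mul hw hz => simp

theorem IsMonomial.proj_eq_zero {n : ℕ} {d : ℤ} {y : SymCoalg 𝒱} (hy : IsMonomial 𝒱 n d y)
    (hn : n ≠ 1) : proj 𝒱 y = 0 := by
  cases hy with
  | one => simp
  | ι_mul hv hy =>
    cases hy with
    | one => exact absurd rfl hn
    | ι_mul hw hz => simp [proj_ι_mul]

theorem eq_counit_smul_one {y : SymCoalg 𝒱} (hy : y ∈ symPow 𝒱 0) : y = counit 𝒱 y • 1 := by
  refine (Submodule.span_le (p := LinearMap.eqLocus LinearMap.id
    ((counit 𝒱).toLinearMap.smulRight 1))).2 ?_ hy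
  rintro y ⟨n, d, hy, hn⟩
  cases hy with
  | one => simp
  | ι_mul hv hy => simp at hn

theorem map_sub_left (α β γ : SymCoalg 𝒱 →ₗ[K] SymCoalg 𝒱) :
    TensorProduct.map (α - β) γ = TensorProduct.map α γ - TensorProduct.map β γ :=
  TensorProduct.ext' fun x y => by simp [TensorProduct.sub_tmul]

theorem map_sub_right (α β γ : SymCoalg 𝒱 →ₗ[K] SymCoalg 𝒱) :
    TensorProduct.map α (β - γ) = TensorProduct.map α β - TensorProduct.map α γ :=
  TensorProduct.ext' fun x y => by simp [TensorProduct.tmul_sub]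

/-- Homogeneity of a linear map between graded vector spaces: `f` has degree `n`. -/
def HasDegree {M N : Type*} [AddCommGroup M] [Module K M] [AddCommGroup N] [Module K N]
    (ℳ : ℤ → Submodule K M) (𝒩 : ℤ → Submodule K N) (n : ℤ) (f : M →ₗ[K] N) : Prop :=
  ∀ (d : ℤ) (x : M), x ∈ ℳ d → f x ∈ 𝒩 (d + n)

theorem HasDegree.comp {m n : ℤ} {α β : SymCoalg 𝒱 →ₗ[K] SymCoalg 𝒱}
    (hα : HasDegree (degPart 𝒱) (degPart 𝒱) m α) (hβ : HasDegree (degPart 𝒱) (degPart 𝒱) n β) :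
    HasDegree (degPart 𝒱) (degPart 𝒱) (n + m) (α ∘ₗ β) := by
  intro d x hx
  rw [← add_assoc]
  exact hα _ _ (hβ _ _ hx)

variable [DirectSum.Decomposition 𝒱]

/-- The map `x ↦ (-1)^(k * deg x) x`: the Koszul sign for moving an operator of degree `k`
past `x`. -/
def signMap (k : ℤ) : SymCoalg 𝒱 →ₗ[K] SymCoalg 𝒱 :=
  (DirectSum.toModule K ℤ (SymCoalg 𝒱) fun d => sgn K (k * d) • (degPart 𝒱 d).subtype) ∘ₗ
    (DirectSum.decomposeLinearEquiv (degPart 𝒱)).toLinearMap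

theorem signMap_apply (k : ℤ) {d : ℤ} {x : SymCoalg 𝒱} (hx : x ∈ degPart 𝒱 d) :
    signMap 𝒱 k x = sgn K (k * d) • x := by
  simp only [signMap, LinearMap.comp_apply, LinearEquiv.coe_coe,
    DirectSum.decomposeLinearEquiv_apply]
  rw [DirectSum.decompose_of_mem _ hx, ← DirectSum.lof_eq_of K, DirectSum.toModule_lof]
  rfl

theorem uzpow_smul {M : Type*} [AddCommGroup M] [Module K M] (n : ℤ) (x : M) :
    ((-1 : ℤˣ) ^ n) • x = sgn K n • x := by
  rw [sgn, Int.cast_smul_eq_zsmul, Units.smul_def]; rfl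

theorem gtmul_mul_gtmul {i j : ℤ} (a a' b b' : SymCoalg 𝒱) (hb : b ∈ degPart 𝒱 i)
    (ha : a' ∈ degPart 𝒱 j) :
    (GradedTensorProduct.of K (degPart 𝒱) (degPart 𝒱) (a ⊗ₜ b)) *
      (GradedTensorProduct.of K (degPart 𝒱) (degPart 𝒱) (a' ⊗ₜ b')) =
    sgn K (i * j) •
      GradedTensorProduct.of K (degPart 𝒱) (degPart 𝒱) ((a * a') ⊗ₜ (b * b')) := by
  have := GradedTensorProduct.tmul_coe_mul_coe_tmul (R := K) (degPart 𝒱) (degPart 𝒱) a ⟨b, hb⟩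
    ⟨a', ha⟩ b'
  rw [← uzpow_smul]
  exact this

/-- The coproduct of `S(V)`, as the morphism of algebras `S(V) → S(V) ⊗ S(V)` with
`Δ v = v ⊗ 1 + 1 ⊗ v` for `v ∈ V`; the product of `S(V) ⊗ S(V)` follows the Koszul sign rule. -/
def comulAlgHom : SymCoalg 𝒱 →ₐ[K] degPart 𝒱 ᵍ⊗[K] degPart 𝒱 :=
  lift 𝒱
    ((GradedTensorProduct.of K (degPart 𝒱) (degPart 𝒱)).toLinearMap ∘ₗ
      ((TensorProduct.mk K (SymCoalg 𝒱) (SymCoalg 𝒱)).flip 1 + TensorProduct.mk K (SymCoalg 𝒱) (SymCoalg 𝒱) 1) ∘ₗ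
      ι 𝒱)
    (by
      intro i j x y hx hy
      have hx' := ι_mem_degPart 𝒱 hx
      have hy' := ι_mem_degPart 𝒱 hy
      have h1 := one_mem_degPart 𝒱
      simp only [LinearMap.comp_apply, LinearMap.add_apply, LinearMap.flip_apply,
        TensorProduct.mk_apply, LinearEquiv.coe_coe, map_add, add_mul, mul_add]
      rw [gtmul_mul_gtmul 𝒱 _ _ _ _ h1 hy', gtmul_mul_gtmul 𝒱 _ _ _ _ hx' hy',
        gtmul_mul_gtmul 𝒱 _ _ _ _ h1 h1, gtmul_mul_gtmul 𝒱 _ _ _ _ hx' h1,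
        gtmul_mul_gtmul 𝒱 _ _ _ _ h1 hx', gtmul_mul_gtmul 𝒱 _ _ _ _ hy' hx',
        gtmul_mul_gtmul 𝒱 _ _ _ _ hy' h1, gtmul_mul_gtmul 𝒱 _ _ _ _ h1 h1]
      simp only [zero_mul, mul_zero, sgn_zero, one_smul, one_mul, mul_one, ι_mul_ι 𝒱 hx hy,
        smul_add, smul_smul, mul_comm j i, sgn_mul_self, TensorProduct.tmul_smul,
        ← TensorProduct.smul_tmul', map_smul]
      abel)

/-- The coproduct `Δ : S(V) → S(V) ⊗ S(V)`. On `v₁ ⊙ ⋯ ⊙ vₙ` it is the sum over all unshuffles,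
with Koszul signs. -/
def comul : SymCoalg 𝒱 →ₗ[K] SymCoalg 𝒱 ⊗[K] SymCoalg 𝒱 :=
  (GradedTensorProduct.of K (degPart 𝒱) (degPart 𝒱)).symm.toLinearMap ∘ₗ
    (comulAlgHom 𝒱).toLinearMap

@[simp]
theorem comul_one : comul 𝒱 1 = 1 ⊗ₜ 1 := by
  simp [comul, Algebra.TensorProduct.one_def]

theorem comul_ι_mul {i : ℤ} {v : V} (hv : v ∈ 𝒱 i) (x : SymCoalg 𝒱) :
    comul 𝒱 (ι 𝒱 v * x) =
      TensorProduct.map (LinearMap.mulLeft K (ι 𝒱 v)) LinearMap.id (comul 𝒱 x) +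
      TensorProduct.map (signMap 𝒱 i) (LinearMap.mulLeft K (ι 𝒱 v)) (comul 𝒱 x) := by
  have hv' := ι_mem_degPart 𝒱 hv
  have h1 := one_mem_degPart 𝒱
  have key : ∀ z : SymCoalg 𝒱 ⊗[K] SymCoalg 𝒱,
      (GradedTensorProduct.of K (degPart 𝒱) (degPart 𝒱)).symm
        (comulAlgHom 𝒱 (ι 𝒱 v) * GradedTensorProduct.of K (degPart 𝒱) (degPart 𝒱) z) =
      TensorProduct.map (LinearMap.mulLeft K (ι 𝒱 v)) LinearMap.id z +
      TensorProduct.map (signMap 𝒱 i) (LinearMap.mulLeft K (ι 𝒱 v)) z := by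
    intro z
    induction z using TensorProduct.induction_on with
    | zero => simp
    | add x y hx hy =>
      simp only [map_add, mul_add, hx, hy]
      abel
    | tmul a b =>
      induction a using DirectSum.Decomposition.inductionOn (degPart 𝒱) with
      | zero => simp
      | add x y hx hy =>
        simp only [TensorProduct.add_tmul, map_add, mul_add, hx, hy]
        abel
      | @homogeneous j a =>
        rw [comulAlgHom, lift_ι]
        simp only [LinearMap.comp_apply, LinearMap.add_apply, LinearMap.flip_apply,
          TensorProduct.mk_apply, LinearEquiv.coe_coe, map_add, add_mul]
        rw [gtmul_mul_gtmul 𝒱 _ _ _ _ h1 a.2, gtmul_mul_gtmul 𝒱 _ _ _ _ hv' a.2]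
        simp [signMap_apply 𝒱 i a.2, TensorProduct.smul_tmul']
  have := key (comul 𝒱 x)
  rw [← this]
  simp [comul]

/-- For `q : S(V) → V`, the operator
`v₁ ⊙ ⋯ ⊙ vₙ ↦ ∑ ± q (v_σ(1) ⊙ ⋯ ⊙ v_σ(k)) ⊙ v_σ(k+1) ⊙ ⋯ ⊙ v_σ(n)` of `S(V)`, where the sum is
over all `k` and all unshuffles `σ`: the coderivation with corestriction `q`. -/
def hat (q : SymCoalg 𝒱 →ₗ[K] V) : SymCoalg 𝒱 →ₗ[K] SymCoalg 𝒱 :=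
  LinearMap.mul' K (SymCoalg 𝒱) ∘ₗ TensorProduct.map (ι 𝒱 ∘ₗ q) LinearMap.id ∘ₗ comul 𝒱

/-- The span of the `a ⊗ b` for monomials `a`, `b` with `n` factors and of degree `d` in total. -/
def tensorPart (n : ℕ) (d : ℤ) : Submodule K (SymCoalg 𝒱 ⊗[K] SymCoalg 𝒱) :=
  Submodule.span K {z | ∃ n₁ d₁ a n₂ d₂ b, IsMonomial 𝒱 n₁ d₁ a ∧ IsMonomial 𝒱 n₂ d₂ b ∧
    n₁ + n₂ = n ∧ d₁ + d₂ = d ∧ z = a ⊗ₜ b}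

theorem comul_mem_tensorPart {n : ℕ} {d : ℤ} {y : SymCoalg 𝒱} (hy : IsMonomial 𝒱 n d y) :
    comul 𝒱 y ∈ tensorPart 𝒱 n d := by
  induction hy with
  | one =>
    rw [comul_one]
    exact Submodule.subset_span ⟨0, 0, 1, 0, 0, 1, IsMonomial.one, IsMonomial.one, rfl, rfl, rfl⟩
  | @ι_mul i n d v y hv hy ih =>
    rw [comul_ι_mul 𝒱 hv]
    refine Submodule.add_mem _ ?_ ?_
    · refine (Submodule.span_le (p := (tensorPart 𝒱 (n + 1) (i + d)).comap _)).2 ?_ ih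
      rintro _ ⟨n₁, d₁, a, n₂, d₂, b, ha, hb, rfl, rfl, rfl⟩
      exact Submodule.subset_span ⟨_, _, _, _, _, _, IsMonomial.ι_mul hv ha, hb,
        by omega, by omega, rfl⟩
    · refine (Submodule.span_le (p := (tensorPart 𝒱 (n + 1) (i + d)).comap _)).2 ?_ ih
      rintro _ ⟨n₁, d₁, a, n₂, d₂, b, ha, hb, rfl, rfl, rfl⟩
      rw [SetLike.mem_coe, Submodule.mem_comap, TensorProduct.map_tmul,
        signMap_apply 𝒱 i (ha.mem_degPart 𝒱), ← TensorProduct.smul_tmul']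
      exact Submodule.smul_mem _ _ (Submodule.subset_span
        ⟨_, _, _, _, _, _, ha, IsMonomial.ι_mul hv hb, by omega, by omega, rfl⟩)

theorem signMap_ι_mul (k : ℤ) {i : ℤ} {v : V} (hv : v ∈ 𝒱 i) (x : SymCoalg 𝒱) :
    signMap 𝒱 k (ι 𝒱 v * x) = sgn K (k * i) • (ι 𝒱 v * signMap 𝒱 k x) := by
  induction x using DirectSum.Decomposition.inductionOn (degPart 𝒱) with
  | zero => simp
  | add x y hx hy => simp only [mul_add, map_add, hx, hy, smul_add]
  | @homogeneous j a =>
    rw [signMap_apply 𝒱 k a.2, signMap_apply 𝒱 k (SetLike.mul_mem_graded (ι_mem_degPart 𝒱 hv) a.2),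
      mul_add, sgn_add, mul_smul_comm, smul_smul]

@[simp]
theorem signMap_one (k : ℤ) : signMap 𝒱 k 1 = 1 := by
  simp [signMap_apply 𝒱 k (one_mem_degPart 𝒱)]

@[simp]
theorem counit_signMap (k : ℤ) (x : SymCoalg 𝒱) : counit 𝒱 (signMap 𝒱 k x) = counit 𝒱 x := by
  induction x using induction_monomial 𝒱 with
  | mono n d y hy =>
    cases hy with
    | one => simp
    | ι_mul hv hy => simp [signMap_ι_mul 𝒱 k hv]
  | zero => simp
  | add x y hx hy => simp [hx, hy]
  | smul r x hx => simp [hx]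

theorem counit_comul_left (x : SymCoalg 𝒱) :
    TensorProduct.map (counit 𝒱).toLinearMap LinearMap.id (comul 𝒱 x) = (1 : K) ⊗ₜ x := by
  induction x using induction_monomial 𝒱 with
  | mono n d y hy =>
    induction hy with
    | one => simp
    | @ι_mul i n d v y hv hy ih =>
      rw [comul_ι_mul 𝒱 hv, map_add, TensorProduct.map_map, TensorProduct.map_map]
      have h1 : (counit 𝒱).toLinearMap ∘ₗ LinearMap.mulLeft K (ι 𝒱 v) = 0 := by
        ext; simp
      have h2 : (counit 𝒱).toLinearMap ∘ₗ signMap 𝒱 i = (counit 𝒱).toLinearMap := by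
        ext; simp
      rw [h1, h2, TensorProduct.map_zero_left, LinearMap.zero_apply, zero_add]
      have := congrArg (TensorProduct.map LinearMap.id (LinearMap.mulLeft K (ι 𝒱 v))) ih
      rw [TensorProduct.map_map] at this
      simpa using this
  | zero => simp
  | add x y hx hy => simp [hx, hy, TensorProduct.tmul_add]
  | smul r x hx => simp [hx]

theorem counit_comul_right (x : SymCoalg 𝒱) :
    TensorProduct.map LinearMap.id (counit 𝒱).toLinearMap (comul 𝒱 x) = x ⊗ₜ (1 : K) := by
  induction x using induction_monomial 𝒱 with
  | mono n d y hy =>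
    induction hy with
    | one => simp
    | @ι_mul i n d v y hv hy ih =>
      rw [comul_ι_mul 𝒱 hv, map_add, TensorProduct.map_map, TensorProduct.map_map]
      have h1 : (counit 𝒱).toLinearMap ∘ₗ LinearMap.mulLeft K (ι 𝒱 v) = 0 := by
        ext; simp
      rw [h1, TensorProduct.map_zero_right, LinearMap.zero_apply, add_zero]
      have := congrArg (TensorProduct.map (LinearMap.mulLeft K (ι 𝒱 v)) LinearMap.id) ih
      rw [TensorProduct.map_map] at this
      simpa using this
  | zero => simp
  | add x y hx hy => simp [hx, hy, TensorProduct.add_tmul]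
  | smul r x hx => simp [hx, TensorProduct.smul_tmul']

theorem proj_hat_apply (q : SymCoalg 𝒱 →ₗ[K] V) (x : SymCoalg 𝒱) : proj 𝒱 (hat 𝒱 q x) = q x := by
  have h : proj 𝒱 ∘ₗ LinearMap.mul' K (SymCoalg 𝒱) ∘ₗ TensorProduct.map (ι 𝒱 ∘ₗ q) LinearMap.id =
      q ∘ₗ (TensorProduct.rid K (SymCoalg 𝒱)).toLinearMap ∘ₗ
        TensorProduct.map LinearMap.id (counit 𝒱).toLinearMap := by
    apply TensorProduct.ext'
    intro a b
    simp [proj_ι_mul]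
  have := LinearMap.congr_fun h (comul 𝒱 x)
  simp only [LinearMap.comp_apply] at this
  rw [counit_comul_right] at this
  simpa [hat] using this

theorem hat_comp_proj_ι_mul {f : V →ₗ[K] V} (hf : HasDegree 𝒱 𝒱 0 f) {i : ℤ} {v : V}
    (hv : v ∈ 𝒱 i) (x : SymCoalg 𝒱) :
    hat 𝒱 (f ∘ₗ proj 𝒱) (ι 𝒱 v * x) = ι 𝒱 (f v) * x + ι 𝒱 v * hat 𝒱 (f ∘ₗ proj 𝒱) x := by
  simp only [hat, LinearMap.comp_apply, comul_ι_mul 𝒱 hv, map_add]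
  congr 1
  · have h : LinearMap.mul' K (SymCoalg 𝒱) ∘ₗ TensorProduct.map (ι 𝒱 ∘ₗ f ∘ₗ proj 𝒱) LinearMap.id ∘ₗ
        TensorProduct.map (LinearMap.mulLeft K (ι 𝒱 v)) LinearMap.id =
        LinearMap.mulLeft K (ι 𝒱 (f v)) ∘ₗ (TensorProduct.lid K (SymCoalg 𝒱)).toLinearMap ∘ₗ
          TensorProduct.map (counit 𝒱).toLinearMap LinearMap.id := by
      apply TensorProduct.ext'
      intro a b
      simp [proj_ι_mul]
    have := LinearMap.congr_fun h (comul 𝒱 x)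
    simp only [LinearMap.comp_apply] at this
    rw [counit_comul_left] at this
    simpa using this
  · have h : LinearMap.mul' K (SymCoalg 𝒱) ∘ₗ TensorProduct.map (ι 𝒱 ∘ₗ f ∘ₗ proj 𝒱) LinearMap.id ∘ₗ
        TensorProduct.map (signMap 𝒱 i) (LinearMap.mulLeft K (ι 𝒱 v)) =
        LinearMap.mulLeft K (ι 𝒱 v) ∘ₗ LinearMap.mul' K (SymCoalg 𝒱) ∘ₗ
          TensorProduct.map (ι 𝒱 ∘ₗ f ∘ₗ proj 𝒱) LinearMap.id := by
      apply TensorProduct.ext'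
      intro a b
      induction a using DirectSum.Decomposition.inductionOn (degPart 𝒱) with
      | zero => simp
      | add x y hx hy => simp only [TensorProduct.add_tmul, map_add, hx, hy]
      | @homogeneous j a =>
        have ha := hf _ _ (proj_mem 𝒱 a.2)
        rw [add_zero] at ha
        simp only [LinearMap.comp_apply, TensorProduct.map_tmul, signMap_apply 𝒱 i a.2,
          LinearMap.mul'_apply, LinearMap.mulLeft_apply, LinearMap.id_apply, map_smul,
          smul_mul_assoc]
        rw [← mul_assoc, ← mul_assoc, ι_mul_ι 𝒱 hv ha, smul_mul_assoc]
    exact LinearMap.congr_fun h (comul 𝒱 x)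

theorem hat_one (q : SymCoalg 𝒱 →ₗ[K] V) : hat 𝒱 q 1 = ι 𝒱 (q 1) := by simp [hat]

theorem hat_hasDegree {q : SymCoalg 𝒱 →ₗ[K] V} {n : ℤ} (hq : HasDegree (degPart 𝒱) 𝒱 n q) :
    HasDegree (degPart 𝒱) (degPart 𝒱) n (hat 𝒱 q) := by
  intro d x hx
  refine (Submodule.span_le (p := (degPart 𝒱 (d + n)).comap (hat 𝒱 q))).2 ?_ hx
  rintro y ⟨m, d, hy, rfl⟩
  refine (Submodule.span_le (p := (degPart 𝒱 (d + n)).comap (LinearMap.mul' K (SymCoalg 𝒱) ∘ₗ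
    TensorProduct.map (ι 𝒱 ∘ₗ q) LinearMap.id))).2 ?_ (comul_mem_tensorPart 𝒱 hy)
  rintro _ ⟨n₁, d₁, a, n₂, d₂, b, ha, hb, rfl, rfl, rfl⟩
  simp only [SetLike.mem_coe, Submodule.mem_comap, LinearMap.comp_apply, TensorProduct.map_tmul,
    LinearMap.mul'_apply, LinearMap.id_apply]
  have := SetLike.mul_mem_graded (ι_mem_degPart 𝒱 (hq _ _ (ha.mem_degPart 𝒱))) (hb.mem_degPart 𝒱)
  rwa [add_right_comm] at this

/-- The graded flip `a ⊗ b ↦ (-1)^(deg a * deg b) b ⊗ a`. -/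
def braid : SymCoalg 𝒱 ⊗[K] SymCoalg 𝒱 →ₗ[K] SymCoalg 𝒱 ⊗[K] SymCoalg 𝒱 :=
  (GradedTensorProduct.of K (degPart 𝒱) (degPart 𝒱)).symm.toLinearMap ∘ₗ
    (GradedTensorProduct.comm (degPart 𝒱) (degPart 𝒱)).toLinearMap ∘ₗ
    (GradedTensorProduct.of K (degPart 𝒱) (degPart 𝒱)).toLinearMap

theorem braid_tmul {i j : ℤ} {a b : SymCoalg 𝒱} (ha : a ∈ degPart 𝒱 i) (hb : b ∈ degPart 𝒱 j) :
    braid 𝒱 (a ⊗ₜ b) = sgn K (j * i) • (b ⊗ₜ a) := by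
  have := GradedTensorProduct.comm_coe_tmul_coe (R := K) (degPart 𝒱) (degPart 𝒱) ⟨a, ha⟩ ⟨b, hb⟩
  rw [uzpow_smul (K := K)] at this
  exact this

theorem braid_comul (x : SymCoalg 𝒱) : braid 𝒱 (comul 𝒱 x) = comul 𝒱 x := by
  have h : (GradedTensorProduct.comm (degPart 𝒱) (degPart 𝒱)).toAlgHom.comp (comulAlgHom 𝒱) =
      comulAlgHom 𝒱 := by
    apply algHom_ext
    intro v
    induction v using DirectSum.Decomposition.inductionOn 𝒱 with
    | zero => simp
    | add x y hx hy => simp only [map_add, hx, hy]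
    | @homogeneous j v =>
      have h1 := one_mem_degPart 𝒱
      have hv := ι_mem_degPart 𝒱 v.2
      have e1 := GradedTensorProduct.comm_coe_tmul_coe (R := K) (degPart 𝒱) (degPart 𝒱)
        ⟨_, h1⟩ ⟨_, hv⟩
      have e2 := GradedTensorProduct.comm_coe_tmul_coe (R := K) (degPart 𝒱) (degPart 𝒱)
        ⟨_, hv⟩ ⟨_, h1⟩
      rw [uzpow_smul (K := K)] at e1 e2
      simp only [mul_zero, zero_mul, sgn_zero, one_smul] at e1 e2
      rw [AlgHom.comp_apply, comulAlgHom, lift_ι]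
      simp only [LinearMap.comp_apply, LinearMap.add_apply, LinearMap.flip_apply,
        TensorProduct.mk_apply, LinearEquiv.coe_coe, map_add]
      refine (congrArg₂ (· + ·) e2 e1).trans (add_comm _ _)
  exact congrArg (GradedTensorProduct.of K (degPart 𝒱) (degPart 𝒱)).symm (DFunLike.congr_fun h x)

theorem comul_signMap (k : ℤ) (x : SymCoalg 𝒱) :
    comul 𝒱 (signMap 𝒱 k x) = TensorProduct.map (signMap 𝒱 k) (signMap 𝒱 k) (comul 𝒱 x) := by
  induction x using induction_monomial 𝒱 with
  | mono n d y hy =>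
    rw [signMap_apply 𝒱 k (hy.mem_degPart 𝒱), map_smul]
    refine (Submodule.span_le (p := LinearMap.eqLocus (sgn K (k * d) • LinearMap.id)
      (TensorProduct.map (signMap 𝒱 k) (signMap 𝒱 k)))).2 ?_ (comul_mem_tensorPart 𝒱 hy)
    rintro _ ⟨n₁, d₁, a, n₂, d₂, b, ha, hb, rfl, rfl, rfl⟩
    simp [signMap_apply 𝒱 k (ha.mem_degPart 𝒱), signMap_apply 𝒱 k (hb.mem_degPart 𝒱), mul_add,
      sgn_add, TensorProduct.smul_tmul', smul_smul, mul_comm]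
  | zero => simp
  | add x y hx hy => simp [hx, hy]
  | smul r x hx => simp [hx]

theorem comul_coassoc (x : SymCoalg 𝒱) :
    TensorProduct.assoc K _ _ _ (TensorProduct.map (comul 𝒱) LinearMap.id (comul 𝒱 x)) =
      TensorProduct.map LinearMap.id (comul 𝒱) (comul 𝒱 x) := by
  induction x using induction_monomial 𝒱 with
  | mono n d y hy =>
    induction hy with
    | one => simp
    | @ι_mul i n d v y hv hy ih =>
      set L := LinearMap.mulLeft K (ι 𝒱 v) with hL
      set s := signMap 𝒱 i with hs
      let T : SymCoalg 𝒱 ⊗[K] (SymCoalg 𝒱 ⊗[K] SymCoalg 𝒱) →ₗ[K] SymCoalg 𝒱 ⊗[K] (SymCoalg 𝒱 ⊗[K] SymCoalg 𝒱) :=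
        TensorProduct.map L LinearMap.id +
        TensorProduct.map s (TensorProduct.map L LinearMap.id) +
        TensorProduct.map s (TensorProduct.map s L)
      have hΔL : ∀ a, comul 𝒱 (L a) = TensorProduct.map L LinearMap.id (comul 𝒱 a) +
          TensorProduct.map s L (comul 𝒱 a) := fun a => comul_ι_mul 𝒱 hv a
      have hΔs : ∀ a, comul 𝒱 (s a) = TensorProduct.map s s (comul 𝒱 a) := comul_signMap 𝒱 i
      have e1 : ∀ z : SymCoalg 𝒱 ⊗[K] SymCoalg 𝒱,
          TensorProduct.assoc K _ _ _ (TensorProduct.map (comul 𝒱) LinearMap.id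
            (TensorProduct.map L LinearMap.id z + TensorProduct.map s L z)) =
          T (TensorProduct.assoc K _ _ _ (TensorProduct.map (comul 𝒱) LinearMap.id z)) := by
        intro z
        induction z using TensorProduct.induction_on with
        | zero => simp
        | add x y hx hy =>
          simp only [map_add] at hx hy ⊢
          rw [← hx, ← hy]
          abel
        | tmul a b =>
          simp only [TensorProduct.map_tmul, map_add, LinearMap.id_apply, hΔL, hΔs,
            TensorProduct.add_tmul]
          generalize comul 𝒱 a = w
          induction w using TensorProduct.induction_on with
          | zero => simp
          | add x y hx hy =>
            simp only [map_add, TensorProduct.add_tmul] at hx hy ⊢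
            rw [← hx, ← hy]
            abel
          | tmul c d => simp [T]
      have e2 : ∀ z : SymCoalg 𝒱 ⊗[K] SymCoalg 𝒱,
          TensorProduct.map LinearMap.id (comul 𝒱)
            (TensorProduct.map L LinearMap.id z + TensorProduct.map s L z) =
          T (TensorProduct.map LinearMap.id (comul 𝒱) z) := by
        intro z
        induction z using TensorProduct.induction_on with
        | zero => simp
        | add x y hx hy =>
          simp only [map_add] at hx hy ⊢
          rw [← hx, ← hy]
          abel
        | tmul a b =>
          simp only [TensorProduct.map_tmul, map_add, LinearMap.id_apply, hΔL,
            TensorProduct.tmul_add]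
          simp [T, add_assoc]
      rw [comul_ι_mul 𝒱 hv, e1, e2, ih]
  | zero => simp
  | add x y hx hy => simp only [map_add, hx, hy]
  | smul r x hx => simp only [map_smul, hx]

/-- `α : S(V) → S(V)` is a coderivation of degree `n`: it is homogeneous of degree `n` and
`Δ α = (α ⊗ id + id ⊗ α) Δ`, with the Koszul sign `(id ⊗ α)(x ⊗ y) = (-1)^(n * deg x) x ⊗ α y`. -/
structure IsCoderivation (n : ℤ) (α : SymCoalg 𝒱 →ₗ[K] SymCoalg 𝒱) : Prop where
  hasDegree : HasDegree (degPart 𝒱) (degPart 𝒱) n α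
  comul_comp : comul 𝒱 ∘ₗ α =
    (TensorProduct.map α LinearMap.id + TensorProduct.map (signMap 𝒱 n) α) ∘ₗ comul 𝒱

theorem isCoderivation_hat {q : SymCoalg 𝒱 →ₗ[K] V} {n : ℤ} (hq : HasDegree (degPart 𝒱) 𝒱 n q) :
    IsCoderivation 𝒱 n (hat 𝒱 q) where
  hasDegree := hat_hasDegree 𝒱 hq
  comul_comp := by
    set m : SymCoalg 𝒱 ⊗[K] SymCoalg 𝒱 →ₗ[K] SymCoalg 𝒱 :=
      LinearMap.mul' K (SymCoalg 𝒱) ∘ₗ TensorProduct.map (ι 𝒱 ∘ₗ q) LinearMap.id with hm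
    let A : (SymCoalg 𝒱 ⊗[K] SymCoalg 𝒱) ⊗[K] SymCoalg 𝒱 →ₗ[K] SymCoalg 𝒱 ⊗[K] (SymCoalg 𝒱 ⊗[K] SymCoalg 𝒱) :=
      (TensorProduct.assoc K _ _ _).toLinearMap
    let A' : SymCoalg 𝒱 ⊗[K] (SymCoalg 𝒱 ⊗[K] SymCoalg 𝒱) →ₗ[K] (SymCoalg 𝒱 ⊗[K] SymCoalg 𝒱) ⊗[K] SymCoalg 𝒱 :=
      (TensorProduct.assoc K _ _ _).symm.toLinearMap
    have key : ∀ z, comul 𝒱 (m z) =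
        TensorProduct.map m LinearMap.id (A' (TensorProduct.map LinearMap.id (comul 𝒱) z)) +
        TensorProduct.map (signMap 𝒱 n) m (A (TensorProduct.map (braid 𝒱) LinearMap.id
          (A' (TensorProduct.map LinearMap.id (comul 𝒱) z)))) := by
      intro z
      induction z using TensorProduct.induction_on with
      | zero => simp
      | add x y hx hy =>
        simp only [map_add, hx, hy]
        abel
      | tmul a b =>
        induction a using DirectSum.Decomposition.inductionOn (degPart 𝒱) with
        | zero => simp
        | add x y hx hy =>
          simp only [map_add, TensorProduct.add_tmul, hx, hy]
          abel
        | @homogeneous d a =>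
          have hqa := hq d a a.2
          simp only [hm, LinearMap.comp_apply, TensorProduct.map_tmul, LinearMap.mul'_apply,
            LinearMap.id_apply]
          rw [comul_ι_mul 𝒱 hqa]
          generalize comul 𝒱 b = w
          induction w using TensorProduct.induction_on with
          | zero => simp
          | add x y hx hy =>
            simp only [map_add, TensorProduct.tmul_add] at hx hy ⊢
            rw [add_add_add_comm, hx, hy]
            abel
          | tmul b c =>
            induction b using DirectSum.Decomposition.inductionOn (degPart 𝒱) with
            | zero => simp
            | add x y hx hy =>
              simp only [map_add, TensorProduct.tmul_add, TensorProduct.add_tmul] at hx hy ⊢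
              rw [add_add_add_comm, hx, hy]
              abel
            | @homogeneous e b =>
              simp only [A, A', LinearEquiv.coe_coe, TensorProduct.assoc_symm_tmul,
                TensorProduct.map_tmul, braid_tmul 𝒱 a.2 b.2, ← TensorProduct.smul_tmul', map_smul,
                TensorProduct.assoc_tmul, signMap_apply 𝒱 _ b.2, LinearMap.comp_apply,
                LinearMap.mul'_apply, LinearMap.id_apply, LinearMap.mulLeft_apply, smul_smul,
                add_mul, sgn_add, mul_comm e d]
    ext x
    have h1 : A' (TensorProduct.map LinearMap.id (comul 𝒱) (comul 𝒱 x)) =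
        TensorProduct.map (comul 𝒱) LinearMap.id (comul 𝒱 x) := by
      rw [← comul_coassoc]
      exact LinearEquiv.symm_apply_apply _ _
    have h2 : TensorProduct.map (braid 𝒱) LinearMap.id
        (TensorProduct.map (comul 𝒱) LinearMap.id (comul 𝒱 x)) =
        TensorProduct.map (comul 𝒱) LinearMap.id (comul 𝒱 x) := by
      rw [TensorProduct.map_map]
      congr 2
      ext y
      exact braid_comul 𝒱 y
    have h3 : A (TensorProduct.map (comul 𝒱) LinearMap.id (comul 𝒱 x)) =
        TensorProduct.map LinearMap.id (comul 𝒱) (comul 𝒱 x) := comul_coassoc 𝒱 x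
    have h := key (comul 𝒱 x)
    rw [h1, h2, h3, TensorProduct.map_map, TensorProduct.map_map] at h
    exact h

theorem hat_comp_proj_monomial {f : V →ₗ[K] V} {c : ℤ → K}
    (hf : ∀ i v, v ∈ 𝒱 i → f v = c i • v) {w : ℕ → ℤ → K} (hw₀ : w 0 0 = 0)
    (hw : ∀ n i d, w (n + 1) (i + d) = c i + w n d) {n : ℕ} {d : ℤ} {y : SymCoalg 𝒱}
    (hy : IsMonomial 𝒱 n d y) : hat 𝒱 (f ∘ₗ proj 𝒱) y = w n d • y := by
  have hf' : HasDegree 𝒱 𝒱 0 f := by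
    intro i v hv
    rw [hf i v hv, add_zero]
    exact Submodule.smul_mem _ _ hv
  induction hy with
  | one => simp [hat_one, hw₀]
  | ι_mul hv hy ih =>
    rw [hat_comp_proj_ι_mul 𝒱 hf' hv, ih, hf _ _ hv, hw, map_smul, smul_mul_assoc, mul_smul_comm,
      add_smul]

theorem hat_proj_symPow {n : ℕ} {y : SymCoalg 𝒱} (hy : y ∈ symPow 𝒱 n) :
    hat 𝒱 (proj 𝒱) y = (n : K) • y := by
  refine (Submodule.span_le (p := LinearMap.eqLocus (hat 𝒱 (proj 𝒱))
    ((n : K) • LinearMap.id))).2 ?_ hy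
  rintro y ⟨n, d, h, rfl⟩
  have := hat_comp_proj_monomial 𝒱 (f := LinearMap.id) (c := fun _ => 1) (w := fun n _ => (n : K))
    (by simp) (by simp) (by intro n _ _; push_cast; ring) h
  simpa using this

theorem eq_zero_of_hat_proj_eq_zero [CharZero K] {y : SymCoalg 𝒱} (h : hat 𝒱 (proj 𝒱) y = 0)
    (h' : counit 𝒱 y = 0) : y = 0 := by
  have key : ∀ z : SymCoalg 𝒱, ∀ n : ℕ, (DirectSum.decompose (symPow 𝒱) (hat 𝒱 (proj 𝒱) z) n : SymCoalg 𝒱) =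
      (n : K) • (DirectSum.decompose (symPow 𝒱) z n : SymCoalg 𝒱) := by
    intro z n
    induction z using DirectSum.Decomposition.inductionOn (symPow 𝒱) with
    | zero => simp
    | add x y hx hy => simp [hx, hy, DirectSum.decompose_add]
    | @homogeneous j a =>
      rw [hat_proj_symPow 𝒱 a.2, DirectSum.decompose_smul, DirectSum.smul_apply,
        Submodule.coe_smul]
      by_cases hj : j = n
      · subst hj; rfl
      · rw [DirectSum.decompose_of_mem_ne _ a.2 hj, smul_zero, smul_zero]
  have h0 : ∀ n : ℕ, n ≠ 0 → (DirectSum.decompose (symPow 𝒱) y n : SymCoalg 𝒱) = 0 := by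
    intro n hn
    have := key y n
    rw [h] at this
    simpa [hn] using this.symm
  have hy : y ∈ symPow 𝒱 0 := by
    classical
    rw [← DirectSum.sum_support_decompose (symPow 𝒱) y]
    refine Submodule.sum_mem _ fun n _ => ?_
    by_cases hn : n = 0
    · subst hn; exact SetLike.coe_mem _
    · rw [h0 n hn]; exact Submodule.zero_mem _
  rw [eq_counit_smul_one 𝒱 hy, h', zero_smul]

/-- A coderivation is determined on `⨁_{k < p} V^{⊙ k}` by its corestriction there. -/
theorem IsCoderivation.eq_zero [CharZero K] {n : ℤ} {α : SymCoalg 𝒱 →ₗ[K] SymCoalg 𝒱}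
    (hα : IsCoderivation 𝒱 n α) (p : ℕ)
    (h : ∀ k < p, ∀ x ∈ symPow 𝒱 k, proj 𝒱 (α x) = 0) :
    ∀ k < p, ∀ x ∈ symPow 𝒱 k, α x = 0 := by
  intro k
  induction k using Nat.strong_induction_on with
  | _ k ih =>
    intro hk x hx
    refine (Submodule.span_le (p := LinearMap.ker α)).2 ?_ hx
    rintro y ⟨k, d, hy, rfl⟩
    change k < p at hk
    rw [SetLike.mem_coe, LinearMap.mem_ker]
    have hΔ := LinearMap.congr_fun hα.comul_comp y
    simp only [LinearMap.comp_apply, LinearMap.add_apply] at hΔ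
    apply eq_zero_of_hat_proj_eq_zero 𝒱
    · simp only [hat, LinearMap.comp_apply]
      rw [hΔ, ← LinearMap.add_apply]
      refine (Submodule.span_le (p := LinearMap.ker (LinearMap.mul' K (SymCoalg 𝒱) ∘ₗ
        TensorProduct.map (ι 𝒱 ∘ₗ proj 𝒱) LinearMap.id ∘ₗ
        (TensorProduct.map α LinearMap.id + TensorProduct.map (signMap 𝒱 n) α)))).2 ?_
        (comul_mem_tensorPart 𝒱 hy)
      rintro _ ⟨n₁, d₁, a, n₂, d₂, b, ha, hb, hn, hd, rfl⟩
      have h1 : proj 𝒱 (α a) = 0 := h n₁ (by omega) a (ha.mem_symPow 𝒱)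
      simp only [SetLike.mem_coe, LinearMap.mem_ker, LinearMap.comp_apply, LinearMap.add_apply,
        map_add, TensorProduct.map_tmul, LinearMap.mul'_apply, h1, map_zero, zero_mul, zero_add,
        signMap_apply 𝒱 n (ha.mem_degPart 𝒱), map_smul, smul_mul_assoc, LinearMap.id_apply]
      by_cases h2 : n₁ = 1
      · rw [ih n₂ (by change n₂ < k; omega) (by omega) b (hb.mem_symPow 𝒱), mul_zero, smul_zero]
      · rw [ha.proj_eq_zero 𝒱 h2, map_zero, zero_mul, smul_zero]
    · have e1 : ∀ z, TensorProduct.lid K K (TensorProduct.map (counit 𝒱).toLinearMap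
          (counit 𝒱).toLinearMap (TensorProduct.map α LinearMap.id z)) =
          TensorProduct.lid K K (TensorProduct.map ((counit 𝒱).toLinearMap ∘ₗ α) LinearMap.id
            (TensorProduct.map LinearMap.id (counit 𝒱).toLinearMap z)) := by
        intro z
        rw [TensorProduct.map_map, TensorProduct.map_map]; rfl
      have hs : (counit 𝒱).toLinearMap ∘ₗ signMap 𝒱 n = (counit 𝒱).toLinearMap := by
        ext; simp
      have e2 : ∀ z, TensorProduct.lid K K (TensorProduct.map (counit 𝒱).toLinearMap
          (counit 𝒱).toLinearMap (TensorProduct.map (signMap 𝒱 n) α z)) =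
          TensorProduct.lid K K (TensorProduct.map LinearMap.id ((counit 𝒱).toLinearMap ∘ₗ α)
            (TensorProduct.map (counit 𝒱).toLinearMap LinearMap.id z)) := by
        intro z
        rw [TensorProduct.map_map, TensorProduct.map_map, hs]; rfl
      have e3 : ∀ z, TensorProduct.lid K K (TensorProduct.map (counit 𝒱).toLinearMap
          (counit 𝒱).toLinearMap (comul 𝒱 z)) = counit 𝒱 z := by
        intro z
        have : TensorProduct.map (counit 𝒱).toLinearMap (counit 𝒱).toLinearMap (comul 𝒱 z) =
          TensorProduct.map LinearMap.id (counit 𝒱).toLinearMap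
            (TensorProduct.map (counit 𝒱).toLinearMap LinearMap.id (comul 𝒱 z)) := by
          rw [TensorProduct.map_map]; rfl
        rw [this, counit_comul_left]
        simp
      have := e3 (α y)
      rw [hΔ, map_add, map_add, e1, e2, counit_comul_left, counit_comul_right] at this
      simpa using this

theorem IsCoderivation.sub {n : ℤ} {α β : SymCoalg 𝒱 →ₗ[K] SymCoalg 𝒱} (hα : IsCoderivation 𝒱 n α)
    (hβ : IsCoderivation 𝒱 n β) : IsCoderivation 𝒱 n (α - β) where
  hasDegree d x hx := Submodule.sub_mem _ (hα.hasDegree d x hx) (hβ.hasDegree d x hx)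
  comul_comp := by
    rw [LinearMap.comp_sub, hα.comul_comp, hβ.comul_comp, map_sub_left,
      map_sub_right, ← LinearMap.sub_comp]
    congr 1
    abel

theorem IsCoderivation.eq_zero_of_proj [CharZero K] {n : ℤ} {α : SymCoalg 𝒱 →ₗ[K] SymCoalg 𝒱}
    (hα : IsCoderivation 𝒱 n α) (h : ∀ x, proj 𝒱 (α x) = 0) : α = 0 := by
  ext x
  induction x using induction_monomial 𝒱 with
  | mono n d y hy =>
    exact hα.eq_zero 𝒱 (n + 1) (fun _ _ x _ => h x) n (Nat.lt_succ_self n) y (hy.mem_symPow 𝒱)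
  | zero => simp
  | add x y hx hy => rw [map_add, hx, hy]; simp
  | smul r x hx => rw [map_smul, hx]; simp

theorem IsCoderivation.ext [CharZero K] {n : ℤ} {α β : SymCoalg 𝒱 →ₗ[K] SymCoalg 𝒱}
    (hα : IsCoderivation 𝒱 n α) (hβ : IsCoderivation 𝒱 n β)
    (h : ∀ x, proj 𝒱 (α x) = proj 𝒱 (β x)) : α = β :=
  sub_eq_zero.1 ((hα.sub 𝒱 hβ).eq_zero_of_proj 𝒱 fun x => by simp [h x])

theorem IsCoderivation.eq_hat [CharZero K] {n : ℤ} {α : SymCoalg 𝒱 →ₗ[K] SymCoalg 𝒱}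
    (hα : IsCoderivation 𝒱 n α) : α = hat 𝒱 (proj 𝒱 ∘ₗ α) :=
  hα.ext 𝒱 (isCoderivation_hat 𝒱 fun d x hx => proj_mem 𝒱 (hα.hasDegree d x hx))
    fun x => (proj_hat_apply 𝒱 (proj 𝒱 ∘ₗ α) x).symm

theorem signMap_comp {n : ℤ} {α : SymCoalg 𝒱 →ₗ[K] SymCoalg 𝒱}
    (hα : HasDegree (degPart 𝒱) (degPart 𝒱) n α) (k : ℤ) :
    signMap 𝒱 k ∘ₗ α = sgn K (k * n) • (α ∘ₗ signMap 𝒱 k) := by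
  ext x
  induction x using DirectSum.Decomposition.inductionOn (degPart 𝒱) with
  | zero => simp
  | add x y hx hy => rw [map_add, hx, hy, map_add]
  | @homogeneous d x =>
    simp [signMap_apply 𝒱 k x.2, signMap_apply 𝒱 k (hα d x x.2), mul_add, sgn_add, smul_smul,
      mul_comm]

theorem signMap_comp_signMap (k l : ℤ) : signMap 𝒱 k ∘ₗ signMap 𝒱 l = signMap 𝒱 (k + l) := by
  ext x
  induction x using DirectSum.Decomposition.inductionOn (degPart 𝒱) with
  | zero => simp
  | add x y hx hy => rw [map_add, hx, hy, map_add]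
  | @homogeneous d x =>
    simp [signMap_apply 𝒱 _ x.2, add_mul, sgn_add, smul_smul, mul_comm (sgn K (k * d))]

/-- The graded commutator of a coderivation of degree one with a coderivation. -/
theorem IsCoderivation.commutator {n : ℤ} {Q α : SymCoalg 𝒱 →ₗ[K] SymCoalg 𝒱} (hQ : IsCoderivation 𝒱 1 Q)
    (hα : IsCoderivation 𝒱 n α) :
    IsCoderivation 𝒱 (n + 1) (Q ∘ₗ α - sgn K n • (α ∘ₗ Q)) where
  hasDegree d x hx := by
    refine Submodule.sub_mem _ (HasDegree.comp 𝒱 hQ.hasDegree hα.hasDegree d x hx)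
      (Submodule.smul_mem _ _ ?_)
    have := HasDegree.comp 𝒱 hα.hasDegree hQ.hasDegree d x hx
    rwa [add_comm 1 n] at this
  comul_comp := by
    have h1 : comul 𝒱 ∘ₗ Q ∘ₗ α =
        (TensorProduct.map (Q ∘ₗ α) LinearMap.id + sgn K n • TensorProduct.map (signMap 𝒱 n ∘ₗ Q) α
          + TensorProduct.map (signMap 𝒱 1 ∘ₗ α) Q +
          TensorProduct.map (signMap 𝒱 (n + 1)) (Q ∘ₗ α)) ∘ₗ comul 𝒱 := by
      rw [← LinearMap.comp_assoc, hQ.comul_comp, LinearMap.comp_assoc, hα.comul_comp,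
        ← LinearMap.comp_assoc, signMap_comp 𝒱 hQ.hasDegree, add_comm n 1, ← signMap_comp_signMap]
      congr 1
      simp only [LinearMap.add_comp, LinearMap.comp_add, ← TensorProduct.map_comp,
        LinearMap.id_comp, LinearMap.comp_id, TensorProduct.map_smul_left, smul_smul, mul_one,
        sgn_mul_self, one_smul]
      abel
    have h2 : comul 𝒱 ∘ₗ α ∘ₗ Q =
        (TensorProduct.map (α ∘ₗ Q) LinearMap.id + TensorProduct.map (signMap 𝒱 n ∘ₗ Q) α
          + sgn K n • TensorProduct.map (signMap 𝒱 1 ∘ₗ α) Q +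
          TensorProduct.map (signMap 𝒱 (n + 1)) (α ∘ₗ Q)) ∘ₗ comul 𝒱 := by
      rw [← LinearMap.comp_assoc, hα.comul_comp, LinearMap.comp_assoc, hQ.comul_comp,
        ← LinearMap.comp_assoc, signMap_comp 𝒱 hα.hasDegree, ← signMap_comp_signMap]
      congr 1
      simp only [LinearMap.add_comp, LinearMap.comp_add, ← TensorProduct.map_comp,
        LinearMap.id_comp, LinearMap.comp_id, TensorProduct.map_smul_left, smul_smul, one_mul,
        sgn_mul_self, one_smul]
      abel
    rw [LinearMap.comp_sub, LinearMap.comp_smul, h1, h2, ← LinearMap.smul_comp,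
      ← LinearMap.sub_comp]
    congr 1
    simp only [smul_add, smul_smul, sgn_mul_self, one_smul, map_sub_left,
      map_sub_right, TensorProduct.map_smul_left, TensorProduct.map_smul_right]
    abel

/-- The projection `S(V) → V^{⊙ k} ⊆ S(V)`. -/
def symProj (k : ℕ) : SymCoalg 𝒱 →ₗ[K] SymCoalg 𝒱 := GradedAlgebra.proj (symPow 𝒱) k

theorem symProj_of_mem {k : ℕ} {x : SymCoalg 𝒱} (hx : x ∈ symPow 𝒱 k) : symProj 𝒱 k x = x := by
  rw [symProj, GradedAlgebra.proj_apply]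
  exact DirectSum.decompose_of_mem_same _ hx

theorem symProj_of_mem_ne {k l : ℕ} {x : SymCoalg 𝒱} (hx : x ∈ symPow 𝒱 l) (h : l ≠ k) :
    symProj 𝒱 k x = 0 := by
  rw [symProj, GradedAlgebra.proj_apply]
  exact DirectSum.decompose_of_mem_ne _ hx h

theorem symProj_hasDegree (k : ℕ) : HasDegree (degPart 𝒱) (degPart 𝒱) 0 (symProj 𝒱 k) := by
  intro d x hx
  rw [add_zero]
  refine (Submodule.span_le (p := (degPart 𝒱 d).comap (symProj 𝒱 k))).2 ?_ hx
  rintro y ⟨n, d, hy, rfl⟩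
  rw [SetLike.mem_coe, Submodule.mem_comap]
  by_cases h : n = k
  · subst h
    rw [symProj_of_mem 𝒱 (hy.mem_symPow 𝒱)]
    exact hy.mem_degPart 𝒱
  · rw [symProj_of_mem_ne 𝒱 (hy.mem_symPow 𝒱) h]
    exact Submodule.zero_mem _

/-- If `q` vanishes on `V^{⊙ 0}`, then `hat q` does not increase the number of factors. -/
theorem comp_hat_eq_zero {M : Type*} [AddCommGroup M] [Module K M] {q : SymCoalg 𝒱 →ₗ[K] V}
    (hq : q 1 = 0) {α : SymCoalg 𝒱 →ₗ[K] M} {p : ℤ}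
    (hα : ∀ i : ℕ, (i : ℤ) < p → ∀ x ∈ symPow 𝒱 i, α x = 0) {k : ℕ} (hk : (k : ℤ) < p) {x : SymCoalg 𝒱}
    (hx : x ∈ symPow 𝒱 k) : α (hat 𝒱 q x) = 0 := by
  refine (Submodule.span_le (p := LinearMap.ker (α ∘ₗ hat 𝒱 q))).2 ?_ hx
  rintro y ⟨k, d, hy, rfl⟩
  change (k : ℤ) < p at hk
  refine (Submodule.span_le (p := LinearMap.ker (α ∘ₗ LinearMap.mul' K (SymCoalg 𝒱) ∘ₗ
    TensorProduct.map (ι 𝒱 ∘ₗ q) LinearMap.id))).2 ?_ (comul_mem_tensorPart 𝒱 hy)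
  rintro _ ⟨n₁, d₁, a, n₂, d₂, b, ha, hb, rfl, rfl, rfl⟩
  simp only [SetLike.mem_coe, LinearMap.mem_ker, LinearMap.comp_apply, TensorProduct.map_tmul,
    LinearMap.mul'_apply, LinearMap.id_apply]
  rcases Nat.eq_zero_or_pos n₁ with rfl | hn
  · cases ha with
    | one => simp [hq]
  · have h1 : ι 𝒱 (q a) ∈ symPow 𝒱 1 := by
      generalize q a = v
      induction v using DirectSum.Decomposition.inductionOn 𝒱 with
      | zero => simp
      | add x y hx hy => rw [map_add]; exact Submodule.add_mem _ hx hy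
      | @homogeneous i v => exact (IsMonomial.ι 𝒱 v.2).mem_symPow 𝒱
    exact hα (1 + n₂) (by push_cast at hk ⊢; omega) _
      (SetLike.mul_mem_graded h1 (hb.mem_symPow 𝒱))

/-- If `q` is supported on `V^{⊙ k}`, then `hat q` maps `V^{⊙ l}` to `V^{⊙ (l-k+1)}`. -/
theorem hat_mem_symPow {q : SymCoalg 𝒱 →ₗ[K] V} {k : ℕ}
    (hq : ∀ l, l ≠ k → ∀ x ∈ symPow 𝒱 l, q x = 0) {l m : ℕ} (hm : l + 1 = m + k) {x : SymCoalg 𝒱}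
    (hx : x ∈ symPow 𝒱 l) : hat 𝒱 q x ∈ symPow 𝒱 m := by
  refine (Submodule.span_le (p := (symPow 𝒱 m).comap (hat 𝒱 q))).2 ?_ hx
  rintro y ⟨l, d, hy, rfl⟩
  change l + 1 = m + k at hm
  refine (Submodule.span_le (p := (symPow 𝒱 m).comap (LinearMap.mul' K (SymCoalg 𝒱) ∘ₗ
    TensorProduct.map (ι 𝒱 ∘ₗ q) LinearMap.id))).2 ?_ (comul_mem_tensorPart 𝒱 hy)
  rintro _ ⟨n₁, d₁, a, n₂, d₂, b, ha, hb, rfl, rfl, rfl⟩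
  simp only [SetLike.mem_coe, Submodule.mem_comap, LinearMap.comp_apply, TensorProduct.map_tmul,
    LinearMap.mul'_apply, LinearMap.id_apply]
  by_cases h : n₁ = k
  · have h1 : ι 𝒱 (q a) ∈ symPow 𝒱 1 := by
      generalize q a = v
      induction v using DirectSum.Decomposition.inductionOn 𝒱 with
      | zero => simp
      | add x y hx hy => rw [map_add]; exact Submodule.add_mem _ hx hy
      | @homogeneous i v => exact (IsMonomial.ι 𝒱 v.2).mem_symPow 𝒱
    have := SetLike.mul_mem_graded h1 (hb.mem_symPow 𝒱)
    rwa [show 1 + n₂ = m by omega] at this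
  · rw [hq _ h _ (ha.mem_symPow 𝒱)]
    simp

end SymCoalg

/-- A filtered complex: subspaces `F p n = F^p M^n` and `deg n = M^n` of an ambient vector space,
and differentials `d n : M^n → M^(n+1)` (only the values of `d n` on `M^n` matter). -/
structure FilteredComplex (K A : Type*) [Field K] [AddCommGroup A] [Module K A] where
  deg : ℤ → Submodule K A
  F : ℤ → ℤ → Submodule K A
  d : ℤ → A →ₗ[K] A
  F_le_deg : ∀ p n, F p n ≤ deg n
  F_antitone : ∀ p p' n, p ≤ p' → F p' n ≤ F p n
  d_mem_deg : ∀ n x, x ∈ deg n → d n x ∈ deg (n + 1)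
  d_mem_F : ∀ p n x, x ∈ F p n → d n x ∈ F p (n + 1)
  d_d : ∀ n x, x ∈ deg n → d (n + 1) (d n x) = 0

namespace FilteredComplex

variable {A : Type*} [AddCommGroup A] [Module K A] (C : FilteredComplex K A)

/-- `Z^{p,q}_r = {x ∈ F^p M^(p+q) | d x ∈ F^(p+r) M^(p+q+1)}`. -/
def Z (p q r : ℤ) : Submodule K A :=
  C.F p (p + q) ⊓ (C.F (p + r) (p + q + 1)).comap (C.d (p + q))

/-- `Z^{p+1,q-1}_{r-1} + d Z^{p-r+1,q+r-2}_{r-1}`. -/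
def B (p q r : ℤ) : Submodule K A :=
  C.Z (p + 1) (q - 1) (r - 1) ⊔
    (C.Z (p - r + 1) (q + r - 2) (r - 1)).map (C.d (p - r + 1 + (q + r - 2)))

theorem B_le_Z (p q r : ℤ) : C.B p q r ≤ C.Z p q r := by
  refine sup_le ?_ ?_
  · rintro x ⟨h1, h2⟩
    rw [SetLike.mem_coe] at h1
    rw [SetLike.mem_coe, Submodule.mem_comap] at h2
    rw [show p + 1 + (q - 1) = p + q by ring] at h1 h2
    rw [show p + 1 + (r - 1) = p + r by ring] at h2
    exact ⟨C.F_antitone _ _ _ (by omega) h1, h2⟩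
  · rintro _ ⟨x, ⟨h1, h2⟩, rfl⟩
    have h3 := C.d_d _ _ (C.F_le_deg _ _ h1)
    rw [SetLike.mem_coe, Submodule.mem_comap] at h2
    rw [show p - r + 1 + (r - 1) = p by ring, show p - r + 1 + (q + r - 2) + 1 = p + q by ring]
      at h2
    rw [show p - r + 1 + (q + r - 2) + 1 = p + q by ring] at h3
    refine ⟨h2, ?_⟩
    rw [SetLike.mem_coe, Submodule.mem_comap, h3]
    exact Submodule.zero_mem _

theorem mem_Z_succ {p q r : ℤ} {x : A} (hx : x ∈ C.Z p q (r + 1)) : x ∈ C.Z p q r :=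
  ⟨hx.1, C.F_antitone _ _ _ (by omega) hx.2⟩

theorem d_mem_Z {p q r : ℤ} {x : A} (hx : x ∈ C.Z p q r) :
    C.d (p + q) x ∈ C.Z (p + r) (q - r + 1) r := by
  have h3 := C.d_d _ _ (C.F_le_deg _ _ hx.1)
  have h2 := hx.2
  rw [SetLike.mem_coe, Submodule.mem_comap] at h2
  rw [Z, show p + r + (q - r + 1) = p + q + 1 by ring]
  refine ⟨h2, ?_⟩
  rw [SetLike.mem_coe, Submodule.mem_comap, h3]
  exact Submodule.zero_mem _

/-- The term `E^{p,q}_r` of the spectral sequence of a filtered complex. -/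
abbrev E (p q r : ℤ) : Type _ := C.Z p q r ⧸ (C.B p q r).submoduleOf (C.Z p q r)

/-- The class in `E^{p,q}_r` of an element of `Z^{p,q}_r`. -/
def cls {p q r : ℤ} (x : A) (hx : x ∈ C.Z p q r) : C.E p q r :=
  Submodule.Quotient.mk ⟨x, hx⟩

theorem cls_eq_cls {p q r : ℤ} {x y : A} {hx : x ∈ C.Z p q r} {hy : y ∈ C.Z p q r} :
    C.cls x hx = C.cls y hy ↔ x - y ∈ C.B p q r := by
  rw [cls, cls, Submodule.Quotient.eq]
  rfl

/-- The differential `d_r : E^{p,q}_r → E^{p+r,q-r+1}_r` induced by `d`. -/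
def dr (p q r : ℤ) : C.E p q r →ₗ[K] C.E (p + r) (q - r + 1) r :=
  Submodule.mapQ _ _
    (((C.d (p + q)).domRestrict (C.Z p q r)).codRestrict (C.Z (p + r) (q - r + 1) r)
      fun x => C.d_mem_Z x.2)
    (by
      rintro ⟨x, hx⟩ hxB
      change x ∈ C.B p q r at hxB
      change C.d (p + q) x ∈ C.B (p + r) (q - r + 1) r
      obtain ⟨y, hy, _, ⟨z, hz, rfl⟩, rfl⟩ := Submodule.mem_sup.1 hxB
      have h3 := C.d_d _ _ (C.F_le_deg _ _ hz.1)
      rw [show p - r + 1 + (q + r - 2) + 1 = p + q by ring] at h3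
      rw [map_add, h3, add_zero]
      refine Submodule.mem_sup_right ⟨y, ?_, ?_⟩
      · rwa [show p + r - r + 1 = p + 1 by ring, show q - r + 1 + r - 2 = q - 1 by ring]
      · rw [show p + r - r + 1 + (q - r + 1 + r - 2) = p + q by ring])

theorem dr_cls {p q r : ℤ} (x : A) (hx : x ∈ C.Z p q r) :
    C.dr p q r (C.cls x hx) = C.cls (C.d (p + q) x) (C.d_mem_Z hx) := rfl

/-- `y ∈ E^{p,q}_{r+1}` is the class of `x ∈ E^{p,q}_r`, under the natural isomorphism
`E_{r+1} ≅ ker d_r / im d_r`. -/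
def IsNext {p q r : ℤ} (x : C.E p q r) (y : C.E p q (r + 1)) : Prop :=
  ∃ (z : A) (hz : z ∈ C.Z p q (r + 1)), C.cls z (C.mem_Z_succ hz) = x ∧ C.cls z hz = y

/-- An element of `E_r` has a class in `E_{r+1}` if and only if it is a `d_r`-cocycle. -/
theorem exists_isNext_iff {p q r : ℤ} (x : C.E p q r) :
    (∃ y, C.IsNext x y) ↔ C.dr p q r x = 0 := by
  constructor
  · rintro ⟨_, z, hz, rfl, -⟩
    rw [dr_cls, ← map_zero (Submodule.mkQ _)]
    refine (C.cls_eq_cls (hy := Submodule.zero_mem _)).2 ?_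
    rw [sub_zero]
    refine Submodule.mem_sup_left ⟨?_, ?_⟩
    · have := hz.2
      rw [SetLike.mem_coe, Submodule.mem_comap] at this
      rwa [show p + r + 1 + (q - r + 1 - 1) = p + q + 1 by ring, add_assoc]
    · have h3 := C.d_d _ _ (C.F_le_deg _ _ hz.1)
      rw [SetLike.mem_coe, Submodule.mem_comap,
        show p + r + 1 + (q - r + 1 - 1) = p + q + 1 by ring, h3]
      exact Submodule.zero_mem _
  · obtain ⟨⟨x, hx⟩, rfl⟩ := Submodule.Quotient.mk_surjective _ x
    intro h
    change C.dr p q r (C.cls x hx) = 0 at h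
    rw [dr_cls, ← map_zero (Submodule.mkQ _)] at h
    have h := (C.cls_eq_cls (hy := Submodule.zero_mem _)).1 h
    rw [sub_zero] at h
    obtain ⟨a, ha, _, ⟨b, hb, rfl⟩, hab⟩ := Submodule.mem_sup.1 h
    have ha1 := ha.1
    have hb1 := hb.1
    rw [SetLike.mem_coe] at ha1 hb1 hb
    rw [show p + r - r + 1 = p + 1 by ring, show q - r + 1 + r - 2 = q - 1 by ring] at hb hb1 hab
    rw [show p + r + 1 + (q - r + 1 - 1) = p + q + 1 by ring] at ha1
    rw [show p + 1 + (q - 1) = p + q by ring] at hb1 hab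
    have hz : x - b ∈ C.Z p q (r + 1) := by
      refine ⟨Submodule.sub_mem _ hx.1 (C.F_antitone _ _ _ (by omega) hb1), ?_⟩
      rw [SetLike.mem_coe, Submodule.mem_comap, map_sub, ← hab, add_sub_cancel_right, ← add_assoc]
      exact ha1
    refine ⟨C.cls _ hz, x - b, hz, ?_, rfl⟩
    refine C.cls_eq_cls.2 ?_
    rw [sub_sub_cancel_left]
    exact Submodule.mem_sup_left (Submodule.neg_mem _ hb)

/-- The class in `E_{r+1}` of an element of `E_r` is unique. -/
theorem IsNext.unique {p q r : ℤ} {x : C.E p q r} {y y' : C.E p q (r + 1)} (h : C.IsNext x y)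
    (h' : C.IsNext x y') : y = y' := by
  obtain ⟨z, hz, rfl, rfl⟩ := h
  obtain ⟨z', hz', h, rfl⟩ := h'
  have h := C.cls_eq_cls.1 h.symm
  obtain ⟨a, ha, c, ⟨b, hb, hbc⟩, hab⟩ := Submodule.mem_sup.1 h
  have hb' : b ∈ C.Z (p - r) (q + r - 1) r := by
    have h1 := hb.1
    have h2 := hb.2
    rw [SetLike.mem_coe] at h1
    rw [SetLike.mem_coe, Submodule.mem_comap] at h2
    rw [show p - r + 1 + (q + r - 2) = p - r + (q + r - 1) by ring] at h1 h2
    rw [show p - r + 1 + (r - 1) = p - r + r by ring] at h2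
    exact ⟨C.F_antitone _ _ _ (by omega) h1, h2⟩
  have hdc : C.d (p + q) c = 0 := by
    rw [← hbc]
    have := C.d_d _ _ (C.F_le_deg _ _ hb.1)
    rwa [show p - r + 1 + (q + r - 2) + 1 = p + q by ring] at this
  refine C.cls_eq_cls.2 ?_
  rw [← hab]
  refine Submodule.add_mem _ (Submodule.mem_sup_left ?_) (Submodule.mem_sup_right ?_)
  · refine ⟨ha.1, ?_⟩
    have hzz := (Submodule.sub_mem _ hz hz').2
    rw [SetLike.mem_coe, Submodule.mem_comap, ← hab, map_add, hdc, add_zero] at hzz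
    rw [SetLike.mem_coe, Submodule.mem_comap, show p + 1 + (q - 1) = p + q by ring,
      show p + 1 + (r + 1 - 1) = p + (r + 1) by ring]
    exact hzz
  · refine ⟨b, ?_, ?_⟩
    · rwa [show p - (r + 1) + 1 = p - r by ring, show q + (r + 1) - 2 = q + r - 1 by ring,
        add_sub_cancel_right]
    · rw [← hbc, show p - (r + 1) + 1 + (q + (r + 1) - 2) = p - r + 1 + (q + r - 2) by ring]

/-- The spectral sequence degenerates at `E_k`: `d_r = 0` for every `r ≥ k`. -/
def DegeneratesAt (k : ℤ) : Prop := ∀ r, k ≤ r → ∀ p q, C.dr p q r = 0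

/-- For `e ∈ E^{p,q}_k`: `d_r e = 0` in `E_r` for every `r ≥ k`. Here `e` is regarded as an element
`ε r` of `E_r` recursively: since `d_r (ε r) = 0`, it has a class `ε (r + 1)` in `E_{r+1}`. -/
def AllDifferentialsVanish {p q k : ℤ} (e : C.E p q k) : Prop :=
  ∃ ε : ∀ r : ℤ, C.E p q r, ε k = e ∧
    ∀ r, k ≤ r → C.dr p q r (ε r) = 0 ∧ C.IsNext (ε r) (ε (r + 1))

end FilteredComplex

open SymCoalg

/-- The space `Coder^n(S(V), S(V))` of coderivations of degree `n`. -/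
def Coder (𝒱 : ℤ → Submodule K V) [DirectSum.Decomposition 𝒱] (n : ℤ) :
    Submodule K (SymCoalg 𝒱 →ₗ[K] SymCoalg 𝒱) where
  carrier := {α | IsCoderivation 𝒱 n α}
  zero_mem' := ⟨fun _ _ _ => Submodule.zero_mem _, by simp⟩
  add_mem' := by
    intro α β hα hβ
    refine ⟨fun d x hx => Submodule.add_mem _ (hα.hasDegree d x hx) (hβ.hasDegree d x hx), ?_⟩
    rw [LinearMap.comp_add, hα.comul_comp, hβ.comul_comp, TensorProduct.map_add_left,
      TensorProduct.map_add_right, ← LinearMap.add_comp]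
    congr 1
    abel
  smul_mem' := by
    intro r α hα
    refine ⟨fun d x hx => Submodule.smul_mem _ _ (hα.hasDegree d x hx), ?_⟩
    rw [LinearMap.comp_smul, hα.comul_comp, TensorProduct.map_smul_left,
      TensorProduct.map_smul_right, ← smul_add, LinearMap.smul_comp]

/-- The linear maps `α` with `α (V^{⊙ i}) = 0` for all `i < p`. -/
def vanishingBelow (𝒱 : ℤ → Submodule K V) (p : ℤ) : Submodule K (SymCoalg 𝒱 →ₗ[K] SymCoalg 𝒱) where
  carrier := {α | ∀ i : ℕ, (i : ℤ) < p → ∀ x ∈ symPow 𝒱 i, α x = 0}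
  zero_mem' _ _ _ _ := rfl
  add_mem' := by
    intro α β hα hβ i hi x hx
    rw [LinearMap.add_apply, hα i hi x hx, hβ i hi x hx, add_zero]
  smul_mem' := by
    intro r α hα i hi x hx
    rw [LinearMap.smul_apply, hα i hi x hx, smul_zero]

/-- A morphism of symmetric coalgebras `S(V) → S(W)`: a morphism of graded augmented coalgebras. -/
structure IsCoalgHom {W : Type*} [AddCommGroup W] [Module K W] (𝒱 : ℤ → Submodule K V)
    (𝒲 : ℤ → Submodule K W) [DirectSum.Decomposition 𝒱] [DirectSum.Decomposition 𝒲]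
    (f : SymCoalg 𝒱 →ₗ[K] SymCoalg 𝒲) : Prop where
  hasDegree : HasDegree (degPart 𝒱) (degPart 𝒲) 0 f
  comul_comp : comul 𝒲 ∘ₗ f = TensorProduct.map f f ∘ₗ comul 𝒱
  counit_comp : (counit 𝒲).toLinearMap ∘ₗ f = (counit 𝒱).toLinearMap
  map_one : f 1 = 1

/-- An `L∞[1]`-algebra structure on the graded vector space `V = ⨁ 𝒱 i`: a coderivation `Q` of
`S(V)` of degree `1` with `Q 1 = 0` and `Q Q = 0`. -/
structure LInfinityOneAlgebra (𝒱 : ℤ → Submodule K V) [DirectSum.Decomposition 𝒱] where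
  Q : SymCoalg 𝒱 →ₗ[K] SymCoalg 𝒱
  isCoderivation : IsCoderivation 𝒱 1 Q
  map_one : Q 1 = 0
  sq_zero : Q ∘ₗ Q = 0

/-- An `L∞`-morphism `f : (V, Q) ⇢ (W, R)`. -/
structure IsLInfinityMorphism {W : Type*} [AddCommGroup W] [Module K W] {𝒱 : ℤ → Submodule K V}
    {𝒲 : ℤ → Submodule K W} [DirectSum.Decomposition 𝒱] [DirectSum.Decomposition 𝒲]
    (L : LInfinityOneAlgebra 𝒱) (M : LInfinityOneAlgebra 𝒲) (f : SymCoalg 𝒱 →ₗ[K] SymCoalg 𝒲) : Prop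
    extends IsCoalgHom 𝒱 𝒲 f where
  comp_Q : f ∘ₗ L.Q = M.Q ∘ₗ f

/-- An `L∞`-isomorphism: a bijective `L∞`-morphism. -/
def IsLInfinityIso {W : Type*} [AddCommGroup W] [Module K W] {𝒱 : ℤ → Submodule K V}
    {𝒲 : ℤ → Submodule K W} [DirectSum.Decomposition 𝒱] [DirectSum.Decomposition 𝒲]
    (L : LInfinityOneAlgebra 𝒱) (M : LInfinityOneAlgebra 𝒲) (f : SymCoalg 𝒱 →ₗ[K] SymCoalg 𝒲) : Prop :=
  IsLInfinityMorphism L M f ∧ Function.Bijective f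

namespace LInfinityOneAlgebra

variable {𝒱 : ℤ → Submodule K V} [DirectSum.Decomposition 𝒱] (L : LInfinityOneAlgebra 𝒱)

/-- The bracket `q_k = Q^1_k : V^{⊙ k} → V`, extended by zero to `S(V)`. -/
def bracket (k : ℕ) : SymCoalg 𝒱 →ₗ[K] V := proj 𝒱 ∘ₗ L.Q ∘ₗ symProj 𝒱 k

/-- An `L∞[1]`-algebra is minimal if `q_1 = 0`. -/
def IsMinimal : Prop := L.bracket 1 = 0

theorem bracket_apply {k : ℕ} {x : SymCoalg 𝒱} (hx : x ∈ symPow 𝒱 k) :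
    L.bracket k x = proj 𝒱 (L.Q x) := by
  simp [bracket, symProj_of_mem 𝒱 hx]

theorem bracket_apply_ne {k l : ℕ} (h : l ≠ k) {x : SymCoalg 𝒱} (hx : x ∈ symPow 𝒱 l) :
    L.bracket k x = 0 := by
  simp [bracket, symProj_of_mem_ne 𝒱 hx h]

theorem bracket_hasDegree (k : ℕ) : HasDegree (degPart 𝒱) 𝒱 1 (L.bracket k) := by
  intro d x hx
  have h := symProj_hasDegree 𝒱 k d x hx
  rw [add_zero] at h
  exact proj_mem 𝒱 (L.isCoderivation.hasDegree _ _ h)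

theorem proj_Q_zero {x : SymCoalg 𝒱} (hx : x ∈ symPow 𝒱 0) : proj 𝒱 (L.Q x) = 0 := by
  rw [eq_counit_smul_one 𝒱 hx, map_smul, L.map_one, smul_zero, map_zero]

variable [CharZero K]

theorem quadratic_sq_zero (hL : L.IsMinimal) :
    hat 𝒱 (L.bracket 2) ∘ₗ hat 𝒱 (L.bracket 2) = 0 := by
  have h2 := isCoderivation_hat 𝒱 (L.bracket_hasDegree 2)
  have h3 := isCoderivation_hat 𝒱 (L.bracket_hasDegree 3)
  have hproj1 : ∀ y ∈ symPow 𝒱 1, proj 𝒱 (L.Q y) = 0 := by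
    intro y hy
    rw [← L.bracket_apply hy, show L.bracket 1 = 0 from hL, LinearMap.zero_apply]
  have hQ : ∀ x ∈ symPow 𝒱 3, L.Q x = hat 𝒱 (L.bracket 2) x + hat 𝒱 (L.bracket 3) x := by
    intro x hx
    have h := ((L.isCoderivation.sub 𝒱 h2).sub 𝒱 h3).eq_zero 𝒱 4 ?_ 3 (by norm_num) x hx
    · rw [LinearMap.sub_apply, LinearMap.sub_apply, sub_sub] at h
      exact sub_eq_zero.1 h
    · intro k hk x hx
      rw [LinearMap.sub_apply, LinearMap.sub_apply, map_sub, map_sub, proj_hat_apply,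
        proj_hat_apply]
      interval_cases k
      · rw [L.proj_Q_zero hx, L.bracket_apply_ne (by norm_num) hx,
          L.bracket_apply_ne (by norm_num) hx, sub_zero, sub_zero]
      · rw [hproj1 x hx, L.bracket_apply_ne (by norm_num) hx,
          L.bracket_apply_ne (by norm_num) hx, sub_zero, sub_zero]
      · rw [L.bracket_apply hx, L.bracket_apply_ne (by norm_num) hx, sub_self, sub_zero]
      · rw [L.bracket_apply hx, L.bracket_apply_ne (by norm_num) hx, sub_zero, sub_self]
  have key : ∀ x, L.bracket 2 (hat 𝒱 (L.bracket 2) x) = 0 := by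
    intro x
    induction x using induction_monomial 𝒱 with
    | mono n d y hy =>
      have hy := hy.mem_symPow 𝒱
      rcases Nat.eq_zero_or_pos n with rfl | hn
      · rw [eq_counit_smul_one 𝒱 hy, map_smul, hat_one,
          L.bracket_apply_ne (k := 2) (l := 0) (by norm_num) (IsMonomial.one.mem_symPow 𝒱)]
        simp
      · have hm := hat_mem_symPow 𝒱 (k := 2) (fun l hl x hx => L.bracket_apply_ne hl hx)
          (l := n) (m := n - 1) (by omega) hy
        by_cases hn3 : n = 3
        · subst hn3
          have hm3 := hat_mem_symPow 𝒱 (k := 3) (fun l hl x hx => L.bracket_apply_ne hl hx)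
            (l := 3) (m := 1) (by omega) hy
          have h := congrArg (proj 𝒱) (LinearMap.congr_fun L.sq_zero y)
          rw [LinearMap.comp_apply, hQ y hy, map_add, map_add, hproj1 _ hm3, add_zero,
            ← L.bracket_apply hm] at h
          simpa using h
        · exact L.bracket_apply_ne (by omega) hm
    | zero => simp
    | add x y hx hy => simp [hx, hy]
    | smul r x hx => simp [hx]
  have h := (h2.commutator 𝒱 h2).eq_zero_of_proj 𝒱 (by
    intro x
    simp [proj_hat_apply, key])
  have h1 := neg_smul (1 : K) (hat 𝒱 (L.bracket 2) ∘ₗ hat 𝒱 (L.bracket 2))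
  rw [sgn_one, h1, one_smul, sub_neg_eq_add, ← two_smul K] at h
  exact (smul_eq_zero.1 h).resolve_left two_ne_zero

/-- The `L∞[1]`-algebra `(V, 0, q_2, 0, 0, …)` attached to a minimal `L∞[1]`-algebra
`(V, 0, q_2, q_3, …)`. -/
def quadraticPart (hL : L.IsMinimal) : LInfinityOneAlgebra 𝒱 where
  Q := hat 𝒱 (L.bracket 2)
  isCoderivation := isCoderivation_hat 𝒱 (L.bracket_hasDegree 2)
  map_one := by
    rw [hat_one, L.bracket_apply_ne (k := 2) (l := 0) (by norm_num) (IsMonomial.one.mem_symPow 𝒱),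
      map_zero]
  sq_zero := L.quadratic_sq_zero hL

/-- The Chevalley–Eilenberg complex `CE(V, V)`: coderivations of `S(V)`, with the differential
`d α = Q α - (-1)^(deg α) α Q` and the filtration `F^p = {α | α (V^{⊙ i}) = 0 for all i < p}`. -/
def CE : FilteredComplex K (SymCoalg 𝒱 →ₗ[K] SymCoalg 𝒱) where
  deg n := Coder 𝒱 n
  F p n := Coder 𝒱 n ⊓ vanishingBelow 𝒱 p
  d n := LinearMap.mulLeft K L.Q - sgn K n • LinearMap.mulRight K L.Q
  F_le_deg _ _ _ h := h.1
  F_antitone p p' n hp α h := ⟨h.1, fun i hi => h.2 i (hi.trans_le hp)⟩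
  d_mem_deg n α hα := L.isCoderivation.commutator 𝒱 hα
  d_mem_F p n α hα := by
    refine ⟨L.isCoderivation.commutator 𝒱 hα.1, fun i hi x hx => ?_⟩
    have h := comp_hat_eq_zero 𝒱 (q := proj 𝒱 ∘ₗ L.Q) (by simp [L.map_one]) hα.2 hi hx
    rw [← L.isCoderivation.eq_hat 𝒱] at h
    change L.Q (α x) - sgn K n • α (L.Q x) = 0
    rw [h, hα.2 i hi x hx, map_zero, smul_zero, sub_zero]
  d_d n α _ := by
    have hQ : L.Q * L.Q = 0 := L.sq_zero
    change L.Q * (L.Q * α - sgn K n • (α * L.Q)) -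
      sgn K (n + 1) • ((L.Q * α - sgn K n • (α * L.Q)) * L.Q) = 0
    rw [sgn_add, sgn_one]
    simp only [mul_sub, sub_mul, mul_smul_comm, smul_mul_assoc, ← mul_assoc, hQ, zero_mul]
    simp only [mul_assoc, hQ, mul_zero, smul_zero, sub_zero, zero_sub, mul_neg,
      mul_one]
    have h := neg_smul (sgn K n) (L.Q * (α * L.Q))
    rw [h, sub_self]

end LInfinityOneAlgebra

/-- The linear map `e : V → V`, `e v = (deg v + 1) v`. -/
def eulerMap (𝒱 : ℤ → Submodule K V) [DirectSum.Decomposition 𝒱] : V →ₗ[K] V :=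
  (DirectSum.toModule K ℤ V fun i => ((i : K) + 1) • (𝒱 i).subtype) ∘ₗ
    (DirectSum.decomposeLinearEquiv 𝒱).toLinearMap

theorem eulerMap_apply (𝒱 : ℤ → Submodule K V) [DirectSum.Decomposition 𝒱] {i : ℤ} {v : V}
    (hv : v ∈ 𝒱 i) : eulerMap 𝒱 v = ((i : K) + 1) • v := by
  simp only [eulerMap, LinearMap.comp_apply, LinearEquiv.coe_coe,
    DirectSum.decomposeLinearEquiv_apply]
  rw [DirectSum.decompose_of_mem _ hv, ← DirectSum.lof_eq_of K, DirectSum.toModule_lof]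
  rfl

/-- The Euler derivation, as the coderivation of `S(V)` with corestriction `e : V → V`. -/
def eulerDerivation (𝒱 : ℤ → Submodule K V) [DirectSum.Decomposition 𝒱] : SymCoalg 𝒱 →ₗ[K] SymCoalg 𝒱 :=
  hat 𝒱 (eulerMap 𝒱 ∘ₗ proj 𝒱)

namespace LInfinityOneAlgebra

variable {𝒱 : ℤ → Submodule K V} [DirectSum.Decomposition 𝒱] (L : LInfinityOneAlgebra 𝒱)
variable [CharZero K]

theorem eulerDerivation_mem_Z (hL : L.IsMinimal) : eulerDerivation 𝒱 ∈ L.CE.Z 1 (-1) 2 := by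
  have hdeg : HasDegree (degPart 𝒱) 𝒱 0 (eulerMap 𝒱 ∘ₗ proj 𝒱) := by
    intro d x hx
    rw [LinearMap.comp_apply, eulerMap_apply 𝒱 (proj_mem 𝒱 hx), add_zero]
    exact Submodule.smul_mem _ _ (proj_mem 𝒱 hx)
  have hcod : IsCoderivation 𝒱 0 (eulerDerivation 𝒱) := isCoderivation_hat 𝒱 hdeg
  have hcom := L.isCoderivation.commutator 𝒱 hcod
  refine ⟨⟨hcod, fun i hi x hx => ?_⟩, hcom, fun i hi x hx => ?_⟩
  · obtain rfl : i = 0 := by omega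
    rw [eq_counit_smul_one 𝒱 hx, map_smul, eulerDerivation, hat_one]
    simp
  · refine hcom.eq_zero 𝒱 3 ?_ i (by omega) x hx
    intro k hk x hx
    refine (Submodule.span_le (p := LinearMap.ker (proj 𝒱 ∘ₗ _))).2 ?_ hx
    rintro y ⟨k, d, hy, rfl⟩
    change k < 3 at hk
    have he : eulerDerivation 𝒱 y = ((k : K) + d) • y :=
      hat_comp_proj_monomial 𝒱 (c := fun i => (i : K) + 1) (w := fun n d => (n : K) + d)
        (fun i v hv => eulerMap_apply 𝒱 hv) (by simp) (by intro n i d; push_cast; ring) hy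
    have hpe : proj 𝒱 (eulerDerivation 𝒱 (L.Q y)) = ((d : K) + 2) • proj 𝒱 (L.Q y) := by
      rw [eulerDerivation, proj_hat_apply, LinearMap.comp_apply,
        eulerMap_apply 𝒱 (proj_mem 𝒱 (L.isCoderivation.hasDegree _ _ (hy.mem_degPart 𝒱)))]
      push_cast
      ring_nf
    have hzero : k ≠ 2 → proj 𝒱 (L.Q y) = 0 := by
      intro h2
      have hy' := hy.mem_symPow 𝒱
      have : k = 0 ∨ k = 1 := by omega
      rcases this with rfl | rfl
      · exact L.proj_Q_zero hy'
      · rw [← L.bracket_apply hy', show L.bracket 1 = 0 from hL, LinearMap.zero_apply]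
    simp only [SetLike.mem_coe, LinearMap.mem_ker, LinearMap.comp_apply, LinearMap.sub_apply,
      sgn_zero, one_smul, map_sub, he, hpe, map_smul]
    by_cases h2 : k = 2
    · subst h2
      rw [← sub_smul]
      push_cast
      ring_nf
      simp
    · simp [hzero h2]

/-- The Euler class `e ∈ E(V, V)^{1,-1}_2` of a minimal `L∞[1]`-algebra: the class of the Euler
derivation. -/
def eulerClass (hL : L.IsMinimal) : L.CE.E 1 (-1) 2 :=
  L.CE.cls (eulerDerivation 𝒱) (L.eulerDerivation_mem_Z hL)

end LInfinityOneAlgebra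

end

end LInfinity

namespace LInfinity

open scoped TensorProduct DirectSum

noncomputable section

variable {K V : Type*} [Field K] [AddCommGroup V] [Module K V]

/-! ### Classes that survive in the spectral sequence of a filtered complex. -/

namespace FilteredComplex

variable {A : Type*} [AddCommGroup A] [Module K A] (C : FilteredComplex K A)

/-! All three conditions are linked by a further one: there is a coderivation `z` of degree 0 that
agrees with the Euler derivation modulo `F^2` and commutes with `Q`. The Euler derivation is the sum
of the operator counting factors and the degree operator, so on coderivations of degree `n` its
commutator acts on `F^s / F^(s+1)` as the scalar `n + 1 - s`. The same holds for every `z` congruent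
to it modulo `F^2` (`commutator_sub_smul_mem_vanishingBelow`). All the divisions below are by
differences of such scalars, or of eigenvalues of the counting operator, and characteristic 0 makes
them legitimate.

From `z` to degeneration (`degeneratesAt_two_of_cocycle`): bracketing with `z` commutes with `d`. On
the leading part of `x ∈ F^p` and on that of `d x ∈ F^(p+r)` it acts by scalars differing by `1 -
r`, which is nonzero for `r ≥ 2`. Hence `d x` is, to leading order, the differential of an element
of `F^(p+1)`, which is zero in `E_r`.

From surviving Euler class to `z`: survival to `E_r` gives a completion of the Euler derivation that
is a cocycle modulo `F^(r+1)`. Completions for different `r` need not be close. The commutator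
trick, applied to approximate cocycles, moves each correction into high filtration without changing
its differential to leading order (`exists_d_sub_mem`). The corrected sequence converges, because
each `V^{⊙ n}` sees only finitely many corrections (`exists_coderivation_limit`).

From `z` to an isomorphism: removing the degree operator from `z` leaves a coderivation `ν` that
acts as `n` on the `n`-th graded piece of `S(V)` and satisfies `[ν, Q] = -Q`. The map `straighten ν`
projects `V^{⊙ n}` to the `n`-eigenspace of `ν`. It is unipotent, hence bijective. It respects
coproducts and carries the quadratic part of `Q` to `Q`, each time because two eigenvectors with the
same eigenvalue and the same leading term coincide (`eq_zero_of_eigenvector`).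

From an isomorphism to `z`: the Euler derivation commutes with the quadratic part of `Q`, so its
conjugate by the isomorphism commutes with `Q`. -/

theorem cls_surjective {p q r : ℤ} (x : C.E p q r) :
    ∃ (z : A) (hz : z ∈ C.Z p q r), C.cls z hz = x := by
  obtain ⟨⟨z, hz⟩, rfl⟩ := Submodule.Quotient.mk_surjective _ x
  exact ⟨z, hz, rfl⟩

/-- If the spectral sequence degenerates at `E_k`, then every class of `E_k` survives forever. -/
theorem DegeneratesAt.allDifferentialsVanish {k : ℤ} (h : C.DegeneratesAt k) {p q : ℤ}
    (e : C.E p q k) : C.AllDifferentialsVanish e := by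
  classical
  -- Membership of `z` is placed after the existential so that `choose` returns a total function,
  -- fit for recursion on representatives; the value 0 elsewhere is a dummy.
  have step : ∀ (n : ℕ) (z : A), ∃ z' : A, z ∈ C.Z p q (k + n) →
      ∃ hz' : z' ∈ C.Z p q (k + n + 1), z' - z ∈ C.B p q (k + n) := by
    intro n z
    by_cases hz : z ∈ C.Z p q (k + n)
    · obtain ⟨y, z', hz', h1, -⟩ := (C.exists_isNext_iff (C.cls z hz)).2
        (by rw [h _ (by omega)]; rfl)
      exact ⟨z', fun _ => ⟨hz', C.cls_eq_cls.1 h1⟩⟩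
    · exact ⟨0, fun h => absurd h hz⟩
  choose g hg using step
  obtain ⟨z₀, hz₀, rfl⟩ := C.cls_surjective e
  let z : ℕ → A := fun n => Nat.rec z₀ g n
  have hz : ∀ n : ℕ, z n ∈ C.Z p q (k + n) := by
    intro n
    induction n with
    | zero => simpa using (show z 0 ∈ C.Z p q k from hz₀)
    | succ n ih =>
      obtain ⟨h1, -⟩ := hg n (z n) ih
      rw [Nat.cast_succ, ← add_assoc]
      exact h1
  have hz' : ∀ r, k ≤ r → z (r - k).toNat ∈ C.Z p q r := by
    intro r hr
    have := hz (r - k).toNat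
    rwa [show k + ((r - k).toNat : ℤ) = r by omega] at this
  -- The family is indexed by all integers; its values below `k` are irrelevant.
  refine ⟨fun r => if hr : k ≤ r then C.cls _ (hz' r hr) else 0, ?_, ?_⟩
  · beta_reduce
    rw [dif_pos le_rfl]
    refine C.cls_eq_cls.2 ?_
    simp [z]
  · intro r hr
    refine ⟨by rw [h r hr]; rfl, ?_⟩
    beta_reduce
    rw [dif_pos hr, dif_pos (by omega : k ≤ r + 1)]
    refine ⟨_, hz' (r + 1) (by omega), C.cls_eq_cls.2 ?_, rfl⟩
    obtain ⟨n, rfl⟩ : ∃ n : ℕ, r = k + n := ⟨(r - k).toNat, by omega⟩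
    rw [show (k + (n : ℤ) + 1 - k).toNat = n + 1 by omega,
      show (k + (n : ℤ) - k).toNat = n by omega]
    exact (hg n (z n) (hz n)).2

/-- A class surviving to `E_r` has a representative `u`, differing from a given one only in
higher filtration, with `d u ∈ F^(p+r)`. -/
theorem AllDifferentialsVanish.exists_representative {p q k : ℤ} {z : A} {hz : z ∈ C.Z p q k}
    (h : C.AllDifferentialsVanish (C.cls z hz)) (r : ℤ) (hr : k ≤ r) :
    ∃ u, u - z ∈ C.F (p + 1) (p + q) ∧ C.d (p + q) u ∈ C.F (p + r) (p + q + 1) := by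
  obtain ⟨ε, h0, h⟩ := h
  -- On any page, an element representing zero is a boundary up to `F^(p+1)`.
  have hB : ∀ r, ∀ x ∈ C.B p q r, ∃ c ∈ C.deg (p + q - 1),
      x - C.d (p + q - 1) c ∈ C.F (p + 1) (p + q) := by
    intro r x hx
    obtain ⟨a, ha, _, ⟨c, hc, rfl⟩, rfl⟩ := Submodule.mem_sup.1 hx
    have hc' := C.F_le_deg _ _ hc.1
    rw [show p - r + 1 + (q + r - 2) = p + q - 1 by ring] at hc' ⊢
    refine ⟨c, hc', ?_⟩
    rw [add_sub_cancel_right]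
    have := ha.1
    rwa [show p + 1 + (q - 1) = p + q by ring] at this
  -- Each change of page or of representative adds such a boundary; `c` collects them all.
  have key : ∀ r, k ≤ r → ∀ w (hw : w ∈ C.Z p q r), C.cls w hw = ε r →
      ∃ c ∈ C.deg (p + q - 1), w - z - C.d (p + q - 1) c ∈ C.F (p + 1) (p + q) := by
    intro r hr
    induction r, hr using Int.leInduction with
    | base =>
      intro w hw hw'
      rw [h0] at hw'
      exact hB _ _ (C.cls_eq_cls.1 hw')
    | succ r hr ih =>
      intro w hw hw'
      obtain ⟨-, w', hw'Z, h1, h2⟩ := h r hr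
      obtain ⟨c, hc, hc'⟩ := ih w' _ h1
      rw [← h2] at hw'
      obtain ⟨b, hb, hb'⟩ := hB _ _ (C.cls_eq_cls.1 hw')
      refine ⟨b + c, add_mem hb hc, ?_⟩
      have := add_mem hb' hc'
      rw [map_add]
      convert this using 1
      abel
  obtain ⟨w, hw, hw'⟩ := C.cls_surjective (ε r)
  obtain ⟨c, hc, hc'⟩ := key r hr w hw hw'
  have hdd := C.d_d _ _ hc
  rw [sub_add_cancel] at hdd
  -- Removing the collected boundary leaves the differential of `w` unchanged.
  refine ⟨w - C.d (p + q - 1) c, by rwa [sub_right_comm], ?_⟩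
  rw [map_sub, hdd, sub_zero]
  exact hw.2

end FilteredComplex

/-! ### Filtrations by the number of factors, and how coderivations move them. -/

namespace SymCoalg

variable (𝒱 : ℤ → Submodule K V)

/-- The subspace `⨁_{n < m} V^{⊙ n}` of `S(V)`. -/
def symBelow (m : ℤ) : Submodule K (SymCoalg 𝒱) :=
  Submodule.span K {y | ∃ (n : ℕ) (d : ℤ), IsMonomial 𝒱 n d y ∧ (n : ℤ) < m}

theorem IsMonomial.mem_symBelow {n : ℕ} {d : ℤ} {y : SymCoalg 𝒱} (hy : IsMonomial 𝒱 n d y) {m : ℤ}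
    (h : (n : ℤ) < m) : y ∈ symBelow 𝒱 m :=
  Submodule.subset_span ⟨n, d, hy, h⟩

theorem symBelow_mono {m m' : ℤ} (h : m ≤ m') : symBelow 𝒱 m ≤ symBelow 𝒱 m' :=
  Submodule.span_mono fun _ ⟨n, d, hy, hn⟩ => ⟨n, d, hy, hn.trans_le h⟩

theorem symPow_le_symBelow {n : ℕ} {m : ℤ} (h : (n : ℤ) < m) : symPow 𝒱 n ≤ symBelow 𝒱 m := by
  refine Submodule.span_le.2 ?_
  rintro y ⟨n, d, hy, rfl⟩
  exact hy.mem_symBelow 𝒱 h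

theorem symBelow_eq_bot {m : ℤ} (h : m ≤ 0) : symBelow 𝒱 m = ⊥ := by
  rw [symBelow, Submodule.span_eq_bot]
  rintro y ⟨n, d, -, hn⟩
  omega

theorem symBelow_le_iff {m : ℤ} {p : Submodule K (SymCoalg 𝒱)} :
    symBelow 𝒱 m ≤ p ↔ ∀ n : ℕ, (n : ℤ) < m → symPow 𝒱 n ≤ p := by
  refine ⟨fun h n hn => (symPow_le_symBelow 𝒱 hn).trans h, fun h => Submodule.span_le.2 ?_⟩
  rintro y ⟨n, d, hy, hn⟩
  exact h n hn (hy.mem_symPow 𝒱)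

theorem mem_vanishingBelow_iff {m : ℤ} {α : SymCoalg 𝒱 →ₗ[K] SymCoalg 𝒱} :
    α ∈ vanishingBelow 𝒱 m ↔ ∀ x ∈ symBelow 𝒱 m, α x = 0 := by
  change _ ↔ symBelow 𝒱 m ≤ LinearMap.ker α
  rw [symBelow_le_iff]
  rfl

theorem vanishingBelow_mono {m m' : ℤ} (h : m ≤ m') :
    vanishingBelow 𝒱 m' ≤ vanishingBelow 𝒱 m :=
  fun _ hα i hi => hα i (hi.trans_le h)

/-- The bounds are strict: at most `m - 1` and `n - 1` factors give at most `m + n - 2`, which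
accounts for the index `m + n - 1`. -/
theorem mul_mem_symBelow {m n : ℤ} {a b : SymCoalg 𝒱} (ha : a ∈ symBelow 𝒱 m)
    (hb : b ∈ symBelow 𝒱 n) :
    a * b ∈ symBelow 𝒱 (m + n - 1) := by
  have h := Submodule.mul_mem_mul ha hb
  unfold symBelow at h
  rw [Submodule.span_mul_span] at h
  refine Submodule.span_le.2 ?_ h
  rintro _ ⟨x, ⟨n, d, h1, hn⟩, y, ⟨m, e, h2, hm⟩, rfl⟩
  exact (h1.mul 𝒱 h2).mem_symBelow 𝒱 (by push_cast; omega)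

/-- The subspace `⨁_{i + j < m} V^{⊙ i} ⊗ V^{⊙ j}` of `S(V) ⊗ S(V)`. -/
def tensorBelow (m : ℤ) : Submodule K (SymCoalg 𝒱 ⊗[K] SymCoalg 𝒱) :=
  Submodule.span K {z | ∃ n₁ d₁ a n₂ d₂ b, IsMonomial 𝒱 n₁ d₁ a ∧ IsMonomial 𝒱 n₂ d₂ b ∧
    (n₁ + n₂ : ℤ) < m ∧ z = a ⊗ₜ b}

theorem tensorBelow_eq_bot {m : ℤ} (h : m ≤ 0) : tensorBelow 𝒱 m = ⊥ := by
  rw [tensorBelow, Submodule.span_eq_bot]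
  rintro y ⟨n₁, d₁, a, n₂, d₂, b, ha, hb, hn, hz⟩
  omega

theorem tmul_mem_tensorBelow {m n k : ℤ} {a b : SymCoalg 𝒱} (ha : a ∈ symBelow 𝒱 m)
    (hb : b ∈ symBelow 𝒱 n) (hk : m + n ≤ k + 1) : a ⊗ₜ b ∈ tensorBelow 𝒱 k := by
  have h := Submodule.apply_mem_map₂ (TensorProduct.mk K (SymCoalg 𝒱) (SymCoalg 𝒱)) ha hb
  unfold symBelow at h
  rw [Submodule.map₂_span_span] at h
  refine Submodule.span_le.2 ?_ h
  rintro _ ⟨x, ⟨n, d, h1, hn⟩, y, ⟨m, e, h2, hm⟩, rfl⟩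
  exact Submodule.subset_span ⟨_, _, _, _, _, _, h1, h2, by omega, rfl⟩

variable [DirectSum.Decomposition 𝒱]

theorem exists_mem_symBelow (x : SymCoalg 𝒱) : ∃ n : ℕ, x ∈ symBelow 𝒱 n := by
  induction x using induction_monomial 𝒱 with
  | mono n d y hy => exact ⟨n + 1, hy.mem_symBelow 𝒱 (by push_cast; omega)⟩
  | zero => exact ⟨0, zero_mem _⟩
  | add x y hx hy =>
    obtain ⟨m, hm⟩ := hx
    obtain ⟨n, hn⟩ := hy
    exact ⟨m + n, add_mem (symBelow_mono 𝒱 (by push_cast; omega) hm)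
      (symBelow_mono 𝒱 (by push_cast; omega) hn)⟩
  | smul r x hx =>
    obtain ⟨m, hm⟩ := hx
    exact ⟨m, Submodule.smul_mem _ _ hm⟩

theorem ι_mem_symPow (v : V) : ι 𝒱 v ∈ symPow 𝒱 1 := by
  induction v using DirectSum.Decomposition.inductionOn 𝒱 with
  | zero => simp
  | add x y hx hy => rw [map_add]; exact Submodule.add_mem _ hx hy
  | @homogeneous i v => exact (IsMonomial.ι 𝒱 v.2).mem_symPow 𝒱

theorem linearMap_ext_symPow {M : Type*} [AddCommGroup M] [Module K M]
    {α β : SymCoalg 𝒱 →ₗ[K] M} (h : ∀ n, ∀ x ∈ symPow 𝒱 n, α x = β x) : α = β := by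
  ext x
  induction x using DirectSum.Decomposition.inductionOn (symPow 𝒱) with
  | zero => simp
  | add x y hx hy => rw [map_add, hx, hy, map_add]
  | @homogeneous n x => exact h n x x.2

theorem comul_mem_tensorBelow {m : ℤ} {x : SymCoalg 𝒱} (hx : x ∈ symBelow 𝒱 m) :
    comul 𝒱 x ∈ tensorBelow 𝒱 m := by
  refine (Submodule.span_le (p := (tensorBelow 𝒱 m).comap (comul 𝒱))).2 ?_ hx
  rintro y ⟨n, d, hy, hn⟩
  refine (Submodule.span_le (p := tensorBelow 𝒱 m)).2 ?_ (comul_mem_tensorPart 𝒱 hy)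
  rintro _ ⟨n₁, d₁, a, n₂, d₂, b, ha, hb, rfl, rfl, rfl⟩
  exact Submodule.subset_span ⟨_, _, _, _, _, _, ha, hb, by push_cast at hn; exact hn, rfl⟩

/-- If `q` vanishes on `V^{⊙ i}` for `i < s`, then `hat q` lowers the number of factors by at
least `s - 1`. -/
theorem hat_mem_symBelow {q : SymCoalg 𝒱 →ₗ[K] V} {s : ℤ} (hq : ∀ x ∈ symBelow 𝒱 s, q x = 0)
    {m k : ℤ} {x : SymCoalg 𝒱} (hx : x ∈ symBelow 𝒱 m) (hk : m + 1 ≤ k + s) :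
    hat 𝒱 q x ∈ symBelow 𝒱 k := by
  refine (Submodule.span_le (p := (symBelow 𝒱 k).comap (LinearMap.mul' K (SymCoalg 𝒱) ∘ₗ
    TensorProduct.map (ι 𝒱 ∘ₗ q) LinearMap.id))).2 ?_ (comul_mem_tensorBelow 𝒱 hx)
  rintro _ ⟨n₁, d₁, a, n₂, d₂, b, ha, hb, hn, rfl⟩
  simp only [SetLike.mem_coe, Submodule.mem_comap, LinearMap.comp_apply, TensorProduct.map_tmul,
    LinearMap.mul'_apply, LinearMap.id_apply]
  -- If `n₁ < s` the term vanishes; otherwise at least `s` factors are replaced by the single factor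
  -- `q a`.
  by_cases h : (n₁ : ℤ) < s
  · rw [hq a (ha.mem_symBelow 𝒱 h)]
    simp
  · exact symPow_le_symBelow 𝒱 (by push_cast; omega)
      (SetLike.mul_mem_graded (ι_mem_symPow 𝒱 (q a)) (hb.mem_symPow 𝒱))

/-- If `q` vanishes on `V^{⊙ i}` for `i < s`, then `hat q` restricts to `q` on `V^{⊙ s}`. -/
theorem hat_apply_symPow {q : SymCoalg 𝒱 →ₗ[K] V} {s : ℕ} (hq : ∀ x ∈ symBelow 𝒱 s, q x = 0)
    {x : SymCoalg 𝒱} (hx : x ∈ symPow 𝒱 s) : hat 𝒱 q x = ι 𝒱 (q x) := by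
  refine (Submodule.span_le (p := LinearMap.eqLocus (hat 𝒱 q) (ι 𝒱 ∘ₗ q))).2 ?_ hx
  rintro y ⟨n, d, hy, rfl⟩
  -- Only the term `y ⊗ 1` of the coproduct contributes: if `b` has a factor, then `a` has fewer
  -- than `s` and `q a = 0`. The right-hand map isolates that term by the counit.
  have h := (Submodule.span_le (p := LinearMap.eqLocus (LinearMap.mul' K (SymCoalg 𝒱) ∘ₗ
      TensorProduct.map (ι 𝒱 ∘ₗ q) LinearMap.id) (ι 𝒱 ∘ₗ q ∘ₗ
        (TensorProduct.rid K (SymCoalg 𝒱)).toLinearMap ∘ₗ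
        TensorProduct.map LinearMap.id (counit 𝒱).toLinearMap))).2 ?_ (comul_mem_tensorPart 𝒱 hy)
  · rw [LinearMap.mem_eqLocus] at h
    simp only [LinearMap.comp_apply, counit_comul_right] at h
    simpa [hat] using h
  · rintro _ ⟨n₁, d₁, a, n₂, d₂, b, ha, hb, rfl, rfl, rfl⟩
    cases hb with
    | one => simp
    | ι_mul hv hb =>
      have : q a = 0 := hq a (ha.mem_symBelow 𝒱 (by simp))
      simp [this]

variable {𝒱}

theorem IsCoderivation.add {n : ℤ} {α β : SymCoalg 𝒱 →ₗ[K] SymCoalg 𝒱}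
    (hα : IsCoderivation 𝒱 n α) (hβ : IsCoderivation 𝒱 n β) : IsCoderivation 𝒱 n (α + β) :=
  (Coder 𝒱 n).add_mem hα hβ

theorem IsCoderivation.smul {n : ℤ} {α : SymCoalg 𝒱 →ₗ[K] SymCoalg 𝒱} (c : K)
    (hα : IsCoderivation 𝒱 n α) : IsCoderivation 𝒱 n (c • α) :=
  (Coder 𝒱 n).smul_mem c hα

theorem signMap_zero : signMap 𝒱 0 = LinearMap.id := by
  ext x
  induction x using DirectSum.Decomposition.inductionOn (degPart 𝒱) with
  | zero => simp
  | add x y hx hy => rw [map_add, hx, hy, map_add]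
  | @homogeneous n x => simp [signMap_apply 𝒱 0 x.2]

/-- The commutator of a coderivation of degree zero with a coderivation. -/
theorem IsCoderivation.commutator_zero {n : ℤ} {z α : SymCoalg 𝒱 →ₗ[K] SymCoalg 𝒱}
    (hz : IsCoderivation 𝒱 0 z) (hα : IsCoderivation 𝒱 n α) :
    IsCoderivation 𝒱 n (z * α - α * z) where
  hasDegree d x hx := by
    refine Submodule.sub_mem _ ?_ ?_
    · simpa using HasDegree.comp 𝒱 hz.hasDegree hα.hasDegree d x hx
    · simpa using HasDegree.comp 𝒱 hα.hasDegree hz.hasDegree d x hx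
  comul_comp := by
    -- Since `z` has degree 0 it commutes with the Koszul sign operator, so the mixed terms of the
    -- two expansions below coincide and cancel.
    have hc := signMap_comp 𝒱 hz.hasDegree n
    rw [mul_zero, sgn_zero, one_smul] at hc
    have h1 : comul 𝒱 ∘ₗ z ∘ₗ α =
        (TensorProduct.map (z ∘ₗ α) LinearMap.id + TensorProduct.map (signMap 𝒱 n ∘ₗ z) α
          + TensorProduct.map α z +
          TensorProduct.map (signMap 𝒱 n) (z ∘ₗ α)) ∘ₗ comul 𝒱 := by
      rw [← LinearMap.comp_assoc, hz.comul_comp, LinearMap.comp_assoc, hα.comul_comp,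
        ← LinearMap.comp_assoc, signMap_zero, hc]
      congr 1
      simp only [LinearMap.add_comp, LinearMap.comp_add, ← TensorProduct.map_comp,
        LinearMap.id_comp, LinearMap.comp_id]
      abel
    have h2 : comul 𝒱 ∘ₗ α ∘ₗ z =
        (TensorProduct.map (α ∘ₗ z) LinearMap.id + TensorProduct.map (signMap 𝒱 n ∘ₗ z) α
          + TensorProduct.map α z +
          TensorProduct.map (signMap 𝒱 n) (α ∘ₗ z)) ∘ₗ comul 𝒱 := by
      rw [← LinearMap.comp_assoc, hα.comul_comp, LinearMap.comp_assoc, hz.comul_comp,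
        ← LinearMap.comp_assoc, signMap_zero]
      congr 1
      simp only [LinearMap.add_comp, LinearMap.comp_add, ← TensorProduct.map_comp,
        LinearMap.id_comp, LinearMap.comp_id]
      abel
    change comul 𝒱 ∘ₗ (z ∘ₗ α - α ∘ₗ z) =
      (TensorProduct.map (z ∘ₗ α - α ∘ₗ z) _ + TensorProduct.map _ (z ∘ₗ α - α ∘ₗ z)) ∘ₗ _
    rw [LinearMap.comp_sub, h1, h2, ← LinearMap.sub_comp, map_sub_left, map_sub_right]
    congr 1
    abel

variable [CharZero K]

/-- In characteristic 0 a coderivation is `hat` of its corestriction, and the corestriction vanishes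
wherever `α` does. So coderivations in `F^s` lower the number of factors by at least `s - 1`. -/
theorem IsCoderivation.apply_mem_symBelow {n : ℤ} {α : SymCoalg 𝒱 →ₗ[K] SymCoalg 𝒱}
    (hα : IsCoderivation 𝒱 n α) {s : ℤ} (hs : α ∈ vanishingBelow 𝒱 s) {m k : ℤ} {x : SymCoalg 𝒱}
    (hx : x ∈ symBelow 𝒱 m) (hk : m + 1 ≤ k + s) : α x ∈ symBelow 𝒱 k := by
  rw [hα.eq_hat 𝒱]
  refine hat_mem_symBelow 𝒱 (s := s) (fun y hy => ?_) hx hk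
  rw [LinearMap.comp_apply, (mem_vanishingBelow_iff 𝒱).1 hs y hy, map_zero]

theorem IsCoderivation.apply_eq_ι {n : ℤ} {α : SymCoalg 𝒱 →ₗ[K] SymCoalg 𝒱}
    (hα : IsCoderivation 𝒱 n α) {s : ℕ} (hs : α ∈ vanishingBelow 𝒱 s) {x : SymCoalg 𝒱}
    (hx : x ∈ symPow 𝒱 s) : α x = ι 𝒱 (proj 𝒱 (α x)) := by
  conv_lhs => rw [hα.eq_hat 𝒱]
  refine hat_apply_symPow 𝒱 (fun y hy => ?_) hx
  rw [LinearMap.comp_apply, (mem_vanishingBelow_iff 𝒱).1 hs y hy, map_zero]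

/-- Since `β` removes at least `j - 1` factors, products obey `F^i F^j ⊆ F^(i+j-1)`. This bounds the
error terms when `z` is only an approximate cocycle. -/
theorem mul_mem_vanishingBelow {n : ℤ} {α β : SymCoalg 𝒱 →ₗ[K] SymCoalg 𝒱} {i j k : ℤ}
    (hα : α ∈ vanishingBelow 𝒱 i) (hβ : IsCoderivation 𝒱 n β) (hβ' : β ∈ vanishingBelow 𝒱 j)
    (hk : k + 1 ≤ i + j) : α * β ∈ vanishingBelow 𝒱 k :=
  (mem_vanishingBelow_iff 𝒱).2 fun _ hx =>
    (mem_vanishingBelow_iff 𝒱).1 hα _ (hβ.apply_mem_symBelow hβ' hx (by omega))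

/-- Every term of `hat q` carries a factor from `V`, which the counit kills. -/
theorem IsCoderivation.counit_apply {n : ℤ} {α : SymCoalg 𝒱 →ₗ[K] SymCoalg 𝒱}
    (hα : IsCoderivation 𝒱 n α) (x : SymCoalg 𝒱) : counit 𝒱 (α x) = 0 := by
  rw [hα.eq_hat 𝒱, hat, LinearMap.comp_apply, LinearMap.comp_apply]
  generalize comul 𝒱 x = w
  induction w using TensorProduct.induction_on with
  | zero => simp
  | add x y hx hy => simp [hx, hy]
  | tmul a b => simp

end SymCoalg

open SymCoalg

/-! ### The Euler derivation and the scalars by which it acts. -/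

section Euler

variable (𝒱 : ℤ → Submodule K V) [DirectSum.Decomposition 𝒱]

/-- The summand 1 in `deg v + 1` is counted once per factor, so the Euler derivation is the counting
operator plus the degree operator. -/
theorem eulerDerivation_monomial {n : ℕ} {d : ℤ} {y : SymCoalg 𝒱} (hy : IsMonomial 𝒱 n d y) :
    eulerDerivation 𝒱 y = ((n : K) + d) • y :=
  hat_comp_proj_monomial 𝒱 (c := fun i => (i : K) + 1) (w := fun n d => (n : K) + d)
    (fun i v hv => eulerMap_apply 𝒱 hv) (by simp) (by intro n i d; push_cast; ring) hy

theorem isCoderivation_eulerDerivation : IsCoderivation 𝒱 0 (eulerDerivation 𝒱) := by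
  refine isCoderivation_hat 𝒱 fun d x hx => ?_
  rw [LinearMap.comp_apply, eulerMap_apply 𝒱 (proj_mem 𝒱 hx), add_zero]
  exact Submodule.smul_mem _ _ (proj_mem 𝒱 hx)

theorem eulerDerivation_mem_vanishingBelow : eulerDerivation 𝒱 ∈ vanishingBelow 𝒱 1 := by
  intro i hi x hx
  obtain rfl : i = 0 := by omega
  rw [eq_counit_smul_one 𝒱 hx, map_smul, eulerDerivation, hat_one]
  simp

variable {𝒱}

theorem mem_vanishingBelow_one_of_sub_euler {z : SymCoalg 𝒱 →ₗ[K] SymCoalg 𝒱}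
    (hze : z - eulerDerivation 𝒱 ∈ vanishingBelow 𝒱 2) : z ∈ vanishingBelow 𝒱 1 := by
  have := add_mem (vanishingBelow_mono 𝒱 (by norm_num : (1 : ℤ) ≤ 2) hze)
    (eulerDerivation_mem_vanishingBelow 𝒱)
  rwa [sub_add_cancel] at this

variable [CharZero K]

/-- On `F^s / F^(s+1)`, the commutator with a coderivation which agrees with the Euler derivation
up to `F^2` is multiplication by `deg + 1 - s`. -/
theorem commutator_sub_smul_mem_vanishingBelow {z : SymCoalg 𝒱 →ₗ[K] SymCoalg 𝒱}
    (hz : IsCoderivation 𝒱 0 z) (hze : z - eulerDerivation 𝒱 ∈ vanishingBelow 𝒱 2) {n : ℤ}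
    {α : SymCoalg 𝒱 →ₗ[K] SymCoalg 𝒱} (hα : IsCoderivation 𝒱 n α) {s : ℤ}
    (hs : α ∈ vanishingBelow 𝒱 s) :
    z * α - α * z - ((n : K) + 1 - s) • α ∈ vanishingBelow 𝒱 (s + 1) := by
  intro i hi x hx
  refine (Submodule.span_le (p := LinearMap.ker _)).2 ?_ hx
  rintro y ⟨k, d, hy, rfl⟩
  change (k : ℤ) < s + 1 at hi
  rw [SetLike.mem_coe, LinearMap.mem_ker, LinearMap.sub_apply, LinearMap.sub_apply,
    Module.End.mul_apply, Module.End.mul_apply, LinearMap.smul_apply]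
  -- With fewer than `s` factors every term vanishes, as `z` preserves the filtration. With exactly
  -- `s`, `α y` lies in `V` in degree `d + n`, so `z` multiplies it by `1 + d + n`, while `z y` is
  -- `(s + d) y` up to terms killed by `α`; the difference of the scalars is `n + 1 - s`.
  rcases (Int.lt_add_one_iff.1 hi).lt_or_eq with h | rfl
  · have h1 : z y ∈ symBelow 𝒱 s := hz.apply_mem_symBelow
      (mem_vanishingBelow_one_of_sub_euler hze) (hy.mem_symBelow 𝒱 h) le_rfl
    rw [hs k h y (hy.mem_symPow 𝒱), (mem_vanishingBelow_iff 𝒱).1 hs _ h1]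
    simp
  · have hv : α y = ι 𝒱 (proj 𝒱 (α y)) := hα.apply_eq_ι hs (hy.mem_symPow 𝒱)
    have hd := proj_mem 𝒱 (hα.hasDegree _ _ (hy.mem_degPart 𝒱))
    have h1 : z (α y) = eulerDerivation 𝒱 (α y) := by
      rw [hv]
      exact sub_eq_zero.1 (hze 1 (by norm_num) _ (ι_mem_symPow 𝒱 _))
    have h2 : eulerDerivation 𝒱 (α y) = ((1 : ℕ) + ((d + n : ℤ) : K)) • α y := by
      rw [hv]
      exact eulerDerivation_monomial 𝒱 (IsMonomial.ι 𝒱 hd)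
    have h3 : (z - eulerDerivation 𝒱) y ∈ symBelow 𝒱 k :=
      (hz.sub 𝒱 (isCoderivation_eulerDerivation 𝒱)).apply_mem_symBelow hze
        (hy.mem_symBelow 𝒱 (lt_add_one _)) (by omega)
    have h4 : α (z y) = ((k : K) + d) • α y := by
      have := (mem_vanishingBelow_iff 𝒱).1 hs _ h3
      rw [LinearMap.sub_apply, map_sub, eulerDerivation_monomial 𝒱 hy, map_smul] at this
      exact sub_eq_zero.1 this
    rw [h1, h2, h4, ← sub_smul, ← sub_smul]
    push_cast
    ring_nf
    simp

end Euler

/-! ### Degeneration from a cocycle completing the Euler derivation. -/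

namespace LInfinityOneAlgebra

variable {𝒱 : ℤ → Submodule K V} [DirectSum.Decomposition 𝒱] (L : LInfinityOneAlgebra 𝒱)
  [CharZero K]

theorem CE_d_apply (n : ℤ) (α : SymCoalg 𝒱 →ₗ[K] SymCoalg 𝒱) :
    L.CE.d n α = L.Q * α - sgn K n • (α * L.Q) := rfl

theorem CE_d_zero_apply (α : SymCoalg 𝒱 →ₗ[K] SymCoalg 𝒱) :
    L.CE.d 0 α = L.Q * α - α * L.Q := by
  rw [CE_d_apply, sgn_zero, one_smul]

/-- The spectral sequence degenerates at `E_2` as soon as the Euler derivation can be completed to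
a cocycle. -/
theorem degeneratesAt_two_of_cocycle {z : SymCoalg 𝒱 →ₗ[K] SymCoalg 𝒱} (hz : IsCoderivation 𝒱 0 z)
    (hze : z - eulerDerivation 𝒱 ∈ vanishingBelow 𝒱 2) (hQ : L.Q * z = z * L.Q) :
    L.CE.DegeneratesAt 2 := by
  intro r hr p q
  refine LinearMap.ext fun e => ?_
  obtain ⟨x, hx, rfl⟩ := L.CE.cls_surjective e
  rw [LinearMap.zero_apply, FilteredComplex.dr_cls, ← map_zero (Submodule.mkQ _)]
  refine (L.CE.cls_eq_cls (hy := Submodule.zero_mem _)).2 ?_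
  rw [sub_zero]
  have hxd : L.CE.d (p + q) x ∈ L.CE.F (p + r) (p + q + 1) := hx.2
  obtain ⟨hx1, hx2⟩ := hx.1
  obtain ⟨hd1, hd2⟩ := hxd
  set n := p + q with hn
  -- This is where `r ≥ 2` enters: on the first page the scalar would be zero.
  have hr' : (1 : K) - r ≠ 0 := by
    rw [sub_ne_zero]
    exact_mod_cast (by omega : (1 : ℤ) ≠ r)
  -- Subtracting the eigenvalue of the bracket with `z` on `F^p / F^(p+1)` pushes `y` into
  -- `F^(p+1)`.
  set y := z * x - x * z - ((n : K) + 1 - p) • x with hy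
  have hyF : y ∈ L.CE.F (p + 1) n :=
    ⟨(hz.commutator_zero hx1).sub 𝒱 (hx1.smul _),
      commutator_sub_smul_mem_vanishingBelow hz hze hx1 hx2⟩
  -- The bracket with `z` commutes with `d` and acts on the leading part of `d x` by `(n + 1) + 1 -
  -- (p + r)`; subtracting `n + 1 - p` leaves `1 - r`.
  have hdy : L.CE.d n y - (1 - r : K) • L.CE.d n x ∈ L.CE.F (p + r + 1) (n + 1) := by
    have h := commutator_sub_smul_mem_vanishingBelow hz hze hd1 hd2
    have heq : L.CE.d n y - (1 - r : K) • L.CE.d n x =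
        z * L.CE.d n x - L.CE.d n x * z - (((n + 1 : ℤ) : K) + 1 - (p + r : ℤ)) • L.CE.d n x := by
      have hcomm : L.CE.d n (z * x - x * z) = z * L.CE.d n x - L.CE.d n x * z := by
        have hQ' : L.Q * (z * x) = z * (L.Q * x) := by rw [← mul_assoc, hQ, mul_assoc]
        simp only [CE_d_apply, mul_sub, sub_mul, mul_smul_comm, smul_mul_assoc, smul_sub,
          mul_assoc, hQ', hQ]
        abel
      rw [hy, map_sub, map_smul, hcomm, sub_sub, ← add_smul]
      push_cast
      ring_nf
    rw [heq]
    exact ⟨(hz.commutator_zero hd1).sub 𝒱 (hd1.smul _), h⟩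
  have hdyF : L.CE.d n y ∈ L.CE.F (p + r) (n + 1) := by
    have := add_mem (L.CE.F_antitone _ _ _ (by omega) hdy)
      (Submodule.smul_mem _ (1 - r : K) (show L.CE.d n x ∈ L.CE.F (p + r) (n + 1) from ⟨hd1, hd2⟩))
    rwa [sub_add_cancel] at this
  -- The two summands match the two parts of the denominator of `E_r`: higher filtration, and the
  -- differential of an element of `F^(p+1)`.
  have hdec : L.CE.d n x = -(1 - r : K)⁻¹ • (L.CE.d n y - (1 - r : K) • L.CE.d n x) +
      L.CE.d n ((1 - r : K)⁻¹ • y) := by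
    rw [map_smul, smul_sub, smul_smul, neg_mul, inv_mul_cancel₀ hr']
    module
  rw [hdec]
  refine Submodule.add_mem_sup ?_ ⟨(1 - r : K)⁻¹ • y, Submodule.smul_mem _ _ ⟨?_, ?_⟩, ?_⟩
  · refine Submodule.smul_mem _ _ ⟨?_, ?_⟩
    · rw [show p + r + 1 + (q - r + 1 - 1) = n + 1 by omega]
      exact hdy
    · rw [SetLike.mem_coe, Submodule.mem_comap, show p + r + 1 + (q - r + 1 - 1) = n + 1 by omega,
        map_sub, map_smul, L.CE.d_d _ _ hx1, L.CE.d_d _ _ hyF.1]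
      simp
  · rw [show p + r - r + 1 + (q - r + 1 + r - 2) = n by omega, show p + r - r + 1 = p + 1 by ring]
    exact hyF
  · rw [SetLike.mem_coe, Submodule.mem_comap,
      show p + r - r + 1 + (q - r + 1 + r - 2) = n by omega,
      show p + r - r + 1 + (r - 1) = p + r by ring]
    exact hdyF
  · rw [show p + r - r + 1 + (q - r + 1 + r - 2) = n by omega]

end LInfinityOneAlgebra

/-! ### Limits of coderivations in the filtration topology. -/

namespace SymCoalg

variable {𝒱 : ℤ → Submodule K V}

theorem eqOn_symBelow_of_sub_mem {z z' : SymCoalg 𝒱 →ₗ[K] SymCoalg 𝒱} {m : ℤ}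
    (h : z' - z ∈ vanishingBelow 𝒱 m) {x : SymCoalg 𝒱} (hx : x ∈ symBelow 𝒱 m) : z' x = z x :=
  sub_eq_zero.1 ((mem_vanishingBelow_iff 𝒱).1 h x hx)

variable [DirectSum.Decomposition 𝒱]

/-- A sequence of coderivations whose consecutive differences lie in `F^0, F^1, F^2, …` has a
limit. -/
theorem exists_coderivation_limit {n : ℤ} {z : ℕ → SymCoalg 𝒱 →ₗ[K] SymCoalg 𝒱}
    (hz : ∀ i, IsCoderivation 𝒱 n (z i)) (h : ∀ i : ℕ, z (i + 1) - z i ∈ vanishingBelow 𝒱 i) :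
    ∃ w, IsCoderivation 𝒱 n w ∧ ∀ i : ℕ, w - z i ∈ vanishingBelow 𝒱 i := by
  have hij : ∀ i j : ℕ, z (i + j) - z i ∈ vanishingBelow 𝒱 i := by
    intro i j
    induction j with
    | zero => simp
    | succ j ih =>
      have := add_mem (vanishingBelow_mono 𝒱 (by omega : (i : ℤ) ≤ (i + j : ℕ)) (h (i + j))) ih
      rwa [sub_add_sub_cancel] at this
  -- On `V^{⊙ i}` the sequence is constant from index `i + 1` on.
  let w : SymCoalg 𝒱 →ₗ[K] SymCoalg 𝒱 :=
    (DirectSum.toModule K ℕ (SymCoalg 𝒱) fun i => z (i + 1) ∘ₗ (symPow 𝒱 i).subtype) ∘ₗ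
      (DirectSum.decomposeLinearEquiv (symPow 𝒱)).toLinearMap
  have hw : ∀ (i : ℕ), ∀ x ∈ symPow 𝒱 i, w x = z (i + 1) x := by
    intro i x hx
    simp only [w, LinearMap.comp_apply, LinearEquiv.coe_coe,
      DirectSum.decomposeLinearEquiv_apply]
    rw [DirectSum.decompose_of_mem _ hx, ← DirectSum.lof_eq_of K, DirectSum.toModule_lof]
    rfl
  have hwz : ∀ i : ℕ, w - z i ∈ vanishingBelow 𝒱 i := by
    intro i j hj x hx
    obtain ⟨k, rfl⟩ : ∃ k, i = j + 1 + k := ⟨i - (j + 1), by omega⟩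
    rw [LinearMap.sub_apply, hw j x hx, eqOn_symBelow_of_sub_mem (hij (j + 1) k)
      (symPow_le_symBelow 𝒱 (by push_cast; omega) hx), sub_self]
  have hw' : ∀ (i : ℕ), ∀ x ∈ symBelow 𝒱 i, w x = z i x :=
    fun i x hx => eqOn_symBelow_of_sub_mem (hwz i) hx
  refine ⟨w, ⟨?_, ?_⟩, hwz⟩
  · intro d x hx
    refine (Submodule.span_le (p := (degPart 𝒱 (d + n)).comap w)).2 ?_ hx
    rintro y ⟨m, d, hy, rfl⟩
    rw [SetLike.mem_coe, Submodule.mem_comap, hw m y (hy.mem_symPow 𝒱)]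
    exact (hz _).hasDegree _ _ (hy.mem_degPart 𝒱)
  · ext x
    induction x using induction_monomial 𝒱 with
    | mono m d y hy =>
      rw [LinearMap.comp_apply, hw m y (hy.mem_symPow 𝒱)]
      refine (LinearMap.congr_fun (hz (m + 1)).comul_comp y).trans ?_
      rw [LinearMap.comp_apply, LinearMap.comp_apply]
      refine (Submodule.span_le (p := LinearMap.eqLocus _ _)).2 ?_ (comul_mem_tensorPart 𝒱 hy)
      rintro _ ⟨n₁, d₁, a, n₂, d₂, b, ha, hb, rfl, rfl, rfl⟩
      rw [SetLike.mem_coe, LinearMap.mem_eqLocus]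
      simp only [LinearMap.add_apply, TensorProduct.map_tmul]
      -- Neither tensor factor is longer than the monomial itself, so one member of the sequence
      -- computes `w` on both.
      rw [hw' (n₁ + n₂ + 1) a (ha.mem_symBelow 𝒱 (by push_cast; omega)),
        hw' (n₁ + n₂ + 1) b (hb.mem_symBelow 𝒱 (by push_cast; omega))]
    | zero => simp
    | add x y hx hy => rw [map_add, hx, hy, map_add]
    | smul r x hx => rw [map_smul, hx, map_smul]

end SymCoalg

/-! ### Completing the Euler derivation to a cocycle by successive approximation. -/

namespace LInfinityOneAlgebra

variable {𝒱 : ℤ → Submodule K V} [DirectSum.Decomposition 𝒱] (L : LInfinityOneAlgebra 𝒱)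
  [CharZero K]

/-- `z` is a cocycle modulo `F^r` completing the Euler derivation. -/
structure IsEulerCocycleMod (r : ℤ) (z : SymCoalg 𝒱 →ₗ[K] SymCoalg 𝒱) : Prop where
  isCoderivation : IsCoderivation 𝒱 0 z
  sub_euler_mem : z - eulerDerivation 𝒱 ∈ vanishingBelow 𝒱 2
  d_mem : L.CE.d 0 z ∈ vanishingBelow 𝒱 r

variable {L}

/-- If `d u ∈ F^(r+1)` for some `u ∈ F^2`, then up to `F^(r+2)` the coderivation `d u` is the
differential of an element of `F^r`. -/
theorem IsEulerCocycleMod.exists_d_sub_mem {r : ℤ} {z : SymCoalg 𝒱 →ₗ[K] SymCoalg 𝒱}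
    (hz : L.IsEulerCocycleMod (r + 1) z) {u : SymCoalg 𝒱 →ₗ[K] SymCoalg 𝒱}
    (hu : IsCoderivation 𝒱 0 u) (hu2 : u ∈ vanishingBelow 𝒱 2)
    (hdu : L.CE.d 0 u ∈ vanishingBelow 𝒱 (r + 1)) (s : ℤ) (hs : 2 ≤ s) (hsr : s ≤ r) :
    ∃ y, IsCoderivation 𝒱 0 y ∧ y ∈ vanishingBelow 𝒱 s ∧
      L.CE.d 0 y - L.CE.d 0 u ∈ vanishingBelow 𝒱 (r + 2) := by
  induction s, hs using Int.leInduction with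
  | base => exact ⟨u, hu, hu2, by simp⟩
  | succ s hs ih =>
    obtain ⟨y, hy, hys, hdy⟩ := ih (by omega)
    -- The inductive step ends at `s + 1 ≤ r`, so `s < r`.
    have hne : (s : K) - r ≠ 0 := by
      rw [sub_ne_zero]
      exact_mod_cast (by omega : s ≠ r)
    have hdy1 : L.CE.d 0 y ∈ vanishingBelow 𝒱 (r + 1) := by
      have := add_mem (vanishingBelow_mono 𝒱 (by omega) hdy) hdu
      rwa [sub_add_cancel] at this
    have hcd : IsCoderivation 𝒱 1 (L.CE.d 0 y) := L.CE.d_mem_deg 0 y hy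
    have hcz : IsCoderivation 𝒱 1 (L.CE.d 0 z) := L.CE.d_mem_deg 0 z hz.isCoderivation
    have h1 := commutator_sub_smul_mem_vanishingBelow hz.isCoderivation hz.sub_euler_mem hy hys
    have h2 := commutator_sub_smul_mem_vanishingBelow hz.isCoderivation hz.sub_euler_mem hcd hdy1
    -- The defect `d z ∈ F^(r+1)` is harmless: its products with `y ∈ F^s` lie in `F^(r+s)`, and `s
    -- ≥ 2`.
    have h3 : L.CE.d 0 z * y ∈ vanishingBelow 𝒱 (r + 2) :=
      mul_mem_vanishingBelow hz.d_mem hy hys (by omega)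
    have h4 : y * L.CE.d 0 z ∈ vanishingBelow 𝒱 (r + 2) :=
      mul_mem_vanishingBelow hys hcz hz.d_mem (by omega)
    -- This combination gains one filtration step. On `d y`, of degree 1 in `F^(r+1)`, the bracket
    -- with `z` has eigenvalue `1 - r`, so `d y'` is `(1 - r) - (1 - s) = s - r` times `d y` modulo
    -- `F^(r+2)`.
    set y' := z * y - y * z - (((0 : ℤ) : K) + 1 - s) • y with hy'
    have hdy' : L.CE.d 0 y' - (s - r : K) • L.CE.d 0 y ∈ vanishingBelow 𝒱 (r + 2) := by
      have heq : L.CE.d 0 y' - (s - r : K) • L.CE.d 0 y =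
          (z * L.CE.d 0 y - L.CE.d 0 y * z - (((1 : ℤ) : K) + 1 - (r + 1 : ℤ)) • L.CE.d 0 y) +
          (L.CE.d 0 z * y - y * L.CE.d 0 z) := by
        have hcomm : L.CE.d 0 (z * y - y * z) = (z * L.CE.d 0 y - L.CE.d 0 y * z) +
            (L.CE.d 0 z * y - y * L.CE.d 0 z) := by
          simp only [CE_d_zero_apply]
          simp only [mul_sub, sub_mul, mul_assoc]
          abel
        rw [hy', map_sub, map_smul, hcomm]
        push_cast
        module
      rw [heq]
      exact add_mem (by simpa [add_assoc] using h2) (sub_mem h3 h4)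
    refine ⟨(s - r : K)⁻¹ • y', ((hz.isCoderivation.commutator_zero hy).sub 𝒱 (hy.smul _)).smul _,
      Submodule.smul_mem _ _ h1, ?_⟩
    have := add_mem (Submodule.smul_mem _ (s - r : K)⁻¹ hdy') hdy
    rw [smul_sub, smul_smul, inv_mul_cancel₀ hne, one_smul, sub_add_sub_cancel] at this
    rwa [map_smul]

/-- A better approximation `u` is known to be close to `z` only modulo `F^2`. Replacing `u - z` by
an element of `F^r` with the same differential modulo `F^(r+2)` keeps the improvement and makes the
sequence converge. -/
theorem IsEulerCocycleMod.exists_succ {r : ℤ} (hr : 2 ≤ r) {z u : SymCoalg 𝒱 →ₗ[K] SymCoalg 𝒱}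
    (hz : L.IsEulerCocycleMod (r + 1) z) (hu : L.IsEulerCocycleMod (r + 2) u) :
    ∃ z', L.IsEulerCocycleMod (r + 2) z' ∧ z' - z ∈ vanishingBelow 𝒱 r := by
  have hd : L.CE.d 0 (u - z) ∈ vanishingBelow 𝒱 (r + 1) := by
    rw [map_sub]
    exact sub_mem (vanishingBelow_mono 𝒱 (by omega) hu.d_mem) hz.d_mem
  have hsub : u - z ∈ vanishingBelow 𝒱 2 := by
    have := sub_mem hu.sub_euler_mem hz.sub_euler_mem
    rwa [sub_sub_sub_cancel_right] at this
  obtain ⟨y, hy, hyr, hdy⟩ := hz.exists_d_sub_mem (hu.isCoderivation.sub 𝒱 hz.isCoderivation)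
    hsub hd r hr le_rfl
  refine ⟨z + y, ⟨hz.isCoderivation.add hy, ?_, ?_⟩, by rwa [add_sub_cancel_left]⟩
  · rw [add_sub_right_comm]
    exact add_mem hz.sub_euler_mem (vanishingBelow_mono 𝒱 hr hyr)
  · have := add_mem hdy hu.d_mem
    rw [map_sub] at this
    rw [map_add]
    convert this using 1
    abel

theorem Q_mem_vanishingBelow (hL : L.IsMinimal) : L.Q ∈ vanishingBelow 𝒱 2 := by
  intro i hi x hx
  refine L.isCoderivation.eq_zero 𝒱 2 (fun k hk x hx => ?_) i (by omega) x hx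
  interval_cases k
  · exact L.proj_Q_zero hx
  · rw [← L.bracket_apply hx, show L.bracket 1 = 0 from hL, LinearMap.zero_apply]

/-- If the Euler derivation can be completed to a cocycle modulo `F^r` for every `r`, then it can
be completed to a cocycle. -/
theorem exists_eulerCocycle (hL : L.IsMinimal)
    (h : ∀ r, 2 ≤ r → ∃ u, L.IsEulerCocycleMod (r + 1) u) :
    ∃ z, IsCoderivation 𝒱 0 z ∧ z - eulerDerivation 𝒱 ∈ vanishingBelow 𝒱 2 ∧
      L.Q * z = z * L.Q := by
  have step : ∀ (n : ℕ) (z : SymCoalg 𝒱 →ₗ[K] SymCoalg 𝒱), ∃ z',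
      L.IsEulerCocycleMod (n + 3) z → L.IsEulerCocycleMod (n + 4) z' ∧
        z' - z ∈ vanishingBelow 𝒱 (n + 2) := by
    intro n z
    by_cases hz : L.IsEulerCocycleMod (n + 3) z
    · obtain ⟨u, hu⟩ := h (n + 3) (by omega)
      obtain ⟨z', h1, h2⟩ := IsEulerCocycleMod.exists_succ (r := n + 2) (by omega)
        (by rwa [add_assoc]) (by rwa [add_assoc] at hu ⊢)
      exact ⟨z', fun _ => ⟨by rwa [add_assoc] at h1, h2⟩⟩
    · exact ⟨0, fun h => absurd h hz⟩
  choose g hg using step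
  let z : ℕ → SymCoalg 𝒱 →ₗ[K] SymCoalg 𝒱 := fun n => Nat.rec (eulerDerivation 𝒱) g n
  have hz : ∀ n : ℕ, L.IsEulerCocycleMod (n + 3) (z n) := by
    intro n
    induction n with
    | zero =>
      refine ⟨isCoderivation_eulerDerivation 𝒱, by simp [z], ?_⟩
      -- The Euler derivation is already a cocycle modulo `F^3`, since it represents a class of
      -- `E_2` in filtration 1; hence the offset 3.
      exact (L.eulerDerivation_mem_Z hL).2.2
    | succ n ih =>
      have := (hg n (z n) ih).1
      rwa [show (n : ℤ) + 4 = (n + 1 : ℕ) + 3 by push_cast; ring] at this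
  have hzz : ∀ n : ℕ, z (n + 1) - z n ∈ vanishingBelow 𝒱 (n + 2) := fun n => (hg n (z n) (hz n)).2
  obtain ⟨w, hw, hwz⟩ := exists_coderivation_limit (fun i => (hz i).isCoderivation)
    fun i => vanishingBelow_mono 𝒱 (by omega) (hzz i)
  refine ⟨w, hw, ?_, linearMap_ext_symPow 𝒱 fun n x hx => ?_⟩
  · have := add_mem (hwz 2) (hz 2).sub_euler_mem
    rwa [sub_add_sub_cancel] at this
  -- Both `x` and `L.Q x` lie where `w` equals its approximation of index `n + 1`, and that one is a
  -- cocycle on `V^{⊙ n}`.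
  · have hx' := symPow_le_symBelow 𝒱 (m := (n + 1 : ℕ)) (by push_cast; omega) hx
    have h1 := (hz (n + 1)).d_mem n (by push_cast; omega) x hx
    rw [CE_d_zero_apply, LinearMap.sub_apply, sub_eq_zero] at h1
    simp only [Module.End.mul_apply] at h1 ⊢
    rw [eqOn_symBelow_of_sub_mem (hwz (n + 1)) hx', h1, eqOn_symBelow_of_sub_mem (hwz (n + 1))
      (L.isCoderivation.apply_mem_symBelow (Q_mem_vanishingBelow hL) hx' (by omega))]

theorem exists_eulerCocycle_of_allDifferentialsVanish (hL : L.IsMinimal)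
    (h : L.CE.AllDifferentialsVanish (L.eulerClass hL)) :
    ∃ z, IsCoderivation 𝒱 0 z ∧ z - eulerDerivation 𝒱 ∈ vanishingBelow 𝒱 2 ∧
      L.Q * z = z * L.Q := by
  refine exists_eulerCocycle hL fun r hr => ?_
  obtain ⟨u, hu, hdu⟩ := FilteredComplex.AllDifferentialsVanish.exists_representative L.CE h r hr
  have hc := (isCoderivation_eulerDerivation 𝒱).add hu.1
  rw [add_sub_cancel] at hc
  refine ⟨u, hc, hu.2, ?_⟩
  have := hdu.2
  rwa [add_comm (1 : ℤ) r] at this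

end LInfinityOneAlgebra

/-! ### Spectral projections of number-like coderivations. -/

/-- An operator acting on the `n`-th graded piece of a filtration as multiplication by `n` has no
eigenvector of eigenvalue `n` in the `n`-th step. -/
theorem eq_zero_of_eigenvector [CharZero K] {W : Type*} [AddCommGroup W] [Module K W]
    {M : ℕ → Submodule K W} (h0 : M 0 = ⊥) {μ : W →ₗ[K] W}
    (hμ : ∀ n : ℕ, ∀ w ∈ M (n + 1), μ w - (n : K) • w ∈ M n) {n : ℕ} {w : W} (hw : w ∈ M n)
    (h : μ w = (n : K) • w) : w = 0 := by
  have key : ∀ m ≤ n, w ∈ M m → w = 0 := by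
    intro m
    induction m with
    | zero =>
      intro _ hw
      rwa [h0, Submodule.mem_bot] at hw
    | succ m ih =>
      intro hm hw
      -- For `m < n`, the element `μ w - m w = (n - m) w` lies in `M m`, and `n - m` is invertible.
      refine ih (by omega) ?_
      have h1 := hμ m w hw
      rw [h, ← sub_smul] at h1
      refine (Submodule.smul_mem_iff _ ?_).1 h1
      rw [sub_ne_zero]
      exact_mod_cast (by omega : n ≠ m)
  exact key n le_rfl hw

namespace SymCoalg

section OperatorCalculus

variable {𝒱 : ℤ → Submodule K V}

/-- The operator `ν (ν - 1) ⋯ (ν - n + 1)`. -/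
def fallingPower (ν : SymCoalg 𝒱 →ₗ[K] SymCoalg 𝒱) (n : ℕ) : SymCoalg 𝒱 →ₗ[K] SymCoalg 𝒱 :=
  Polynomial.aeval (R := K) (A := Module.End K (SymCoalg 𝒱)) ν (descPochhammer K n)

@[simp]
theorem fallingPower_zero (ν : SymCoalg 𝒱 →ₗ[K] SymCoalg 𝒱) (x : SymCoalg 𝒱) :
    fallingPower ν 0 x = x := by
  simp [fallingPower]

theorem fallingPower_succ (ν : SymCoalg 𝒱 →ₗ[K] SymCoalg 𝒱) (n : ℕ) (x : SymCoalg 𝒱) :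
    fallingPower ν (n + 1) x = fallingPower ν n (ν x - (n : K) • x) := by
  simp [fallingPower, descPochhammer_succ_right, Nat.cast_smul_eq_nsmul]

/-- Here the factor `ν - n` is applied last, which suits invariance and eigenvector arguments;
`fallingPower_succ` applies it first, which suits descent along the filtration. -/
theorem fallingPower_succ' (ν : SymCoalg 𝒱 →ₗ[K] SymCoalg 𝒱) (n : ℕ) (x : SymCoalg 𝒱) :
    fallingPower ν (n + 1) x = ν (fallingPower ν n x) - (n : K) • fallingPower ν n x := by
  rw [fallingPower, descPochhammer_succ_right, mul_comm]
  simp [fallingPower, Nat.cast_smul_eq_nsmul]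

/-- The operator `α ⊗ id + id ⊗ α` of `S(V) ⊗ S(V)`. -/
def leibniz (α : SymCoalg 𝒱 →ₗ[K] SymCoalg 𝒱) :
    SymCoalg 𝒱 ⊗[K] SymCoalg 𝒱 →ₗ[K] SymCoalg 𝒱 ⊗[K] SymCoalg 𝒱 :=
  TensorProduct.map α LinearMap.id + TensorProduct.map LinearMap.id α

theorem leibniz_tmul (α : SymCoalg 𝒱 →ₗ[K] SymCoalg 𝒱) (a b : SymCoalg 𝒱) :
    leibniz α (a ⊗ₜ b) = α a ⊗ₜ b + a ⊗ₜ α b := rfl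

theorem IsCoderivation.comul_apply_eq_leibniz [DirectSum.Decomposition 𝒱]
    {α : SymCoalg 𝒱 →ₗ[K] SymCoalg 𝒱} (hα : IsCoderivation 𝒱 0 α) (x : SymCoalg 𝒱) :
    comul 𝒱 (α x) = leibniz α (comul 𝒱 x) := by
  have := LinearMap.congr_fun hα.comul_comp x
  rwa [signMap_zero] at this

end OperatorCalculus

variable (𝒱 : ℤ → Submodule K V) [DirectSum.Decomposition 𝒱]

theorem isCoderivation_hat_proj : IsCoderivation 𝒱 0 (hat 𝒱 (proj 𝒱)) :=
  isCoderivation_hat 𝒱 fun d x hx => by rw [add_zero]; exact proj_mem 𝒱 hx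

/-- The eigenvalues on a monomial are `n + d` and `n`. Isolating the degree operator makes its
commutation with homogeneous maps immediate. -/
theorem eulerDerivation_sub_hat_proj {d : ℤ} {x : SymCoalg 𝒱} (hx : x ∈ degPart 𝒱 d) :
    eulerDerivation 𝒱 x - hat 𝒱 (proj 𝒱) x = (d : K) • x := by
  refine (Submodule.span_le (p := LinearMap.eqLocus (eulerDerivation 𝒱 - hat 𝒱 (proj 𝒱))
    ((d : K) • LinearMap.id))).2 ?_ hx
  rintro y ⟨n, d, hy, rfl⟩
  change eulerDerivation 𝒱 y - hat 𝒱 (proj 𝒱) y = (d : K) • y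
  rw [eulerDerivation_monomial 𝒱 hy, hat_proj_symPow 𝒱 (hy.mem_symPow 𝒱)]
  module

variable {𝒱}

/-- A coderivation acting as the number of factors on the associated graded of the filtration of
`S(V)` by the number of factors. -/
structure IsNumberLike (ν : SymCoalg 𝒱 →ₗ[K] SymCoalg 𝒱) : Prop where
  isCoderivation : IsCoderivation 𝒱 0 ν
  sub_mem_symBelow : ∀ n : ℕ, ∀ x ∈ symPow 𝒱 n, ν x - (n : K) • x ∈ symBelow 𝒱 n

/-- The operator acting on `V^{⊙ n}` as the binomial coefficient `ν (ν - 1) ⋯ (ν - n + 1) / n!`.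
For number-like `ν` it is the projection onto the eigenspace of `ν` of eigenvalue `n`. -/
def straighten (ν : SymCoalg 𝒱 →ₗ[K] SymCoalg 𝒱) : SymCoalg 𝒱 →ₗ[K] SymCoalg 𝒱 :=
  (DirectSum.toModule K ℕ (SymCoalg 𝒱) fun n =>
    ((n.factorial : K)⁻¹ • fallingPower ν n) ∘ₗ (symPow 𝒱 n).subtype) ∘ₗ
    (DirectSum.decomposeLinearEquiv (symPow 𝒱)).toLinearMap

theorem straighten_apply (ν : SymCoalg 𝒱 →ₗ[K] SymCoalg 𝒱) {n : ℕ} {x : SymCoalg 𝒱}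
    (hx : x ∈ symPow 𝒱 n) : straighten ν x = (n.factorial : K)⁻¹ • fallingPower ν n x := by
  simp only [straighten, LinearMap.comp_apply, LinearEquiv.coe_coe,
    DirectSum.decomposeLinearEquiv_apply]
  rw [DirectSum.decompose_of_mem _ hx, ← DirectSum.lof_eq_of K, DirectSum.toModule_lof]
  rfl

namespace IsNumberLike

variable {ν : SymCoalg 𝒱 →ₗ[K] SymCoalg 𝒱}

theorem apply_mem_symBelow (hν : IsNumberLike ν) {m : ℤ} {x : SymCoalg 𝒱}
    (hx : x ∈ symBelow 𝒱 m) : ν x ∈ symBelow 𝒱 m := by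
  refine (symBelow_le_iff 𝒱 (p := (symBelow 𝒱 m).comap ν)).2 (fun n hn x hx => ?_) hx
  have := add_mem (symBelow_mono 𝒱 hn.le (hν.sub_mem_symBelow n x hx))
    (Submodule.smul_mem _ (n : K) (symPow_le_symBelow 𝒱 hn hx))
  rwa [sub_add_cancel] at this

theorem sub_mem_of_mem_symBelow (hν : IsNumberLike ν) {n : ℕ} {y : SymCoalg 𝒱}
    (hy : y ∈ symBelow 𝒱 (n + 1 : ℕ)) : ν y - (n : K) • y ∈ symBelow 𝒱 n := by
  refine (symBelow_le_iff 𝒱 (p := (symBelow 𝒱 n).comap (ν - (n : K) • LinearMap.id))).2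
    (fun k hk x hx => ?_) hy
  change ν x - (n : K) • x ∈ symBelow 𝒱 n
  have hk : k ≤ n := by push_cast at hk; omega
  rcases hk.lt_or_eq with h | rfl
  · have h' : (k : ℤ) < n := by exact_mod_cast h
    have hx' := symPow_le_symBelow 𝒱 h' hx
    exact sub_mem (hν.apply_mem_symBelow hx') (Submodule.smul_mem _ _ hx')
  · exact hν.sub_mem_symBelow k x hx

theorem fallingPower_mem_symBelow (hν : IsNumberLike ν) (k : ℕ) {m : ℤ} {x : SymCoalg 𝒱}
    (hx : x ∈ symBelow 𝒱 m) : fallingPower ν k x ∈ symBelow 𝒱 m := by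
  induction k with
  | zero => simpa using hx
  | succ k ih =>
    rw [fallingPower_succ']
    exact sub_mem (hν.apply_mem_symBelow ih) (Submodule.smul_mem _ _ ih)

/-- Each factor `ν - k` takes the part with at most `k` factors into the part with fewer than `k`;
after `k = n - 1, …, 0` nothing is left. -/
theorem fallingPower_eq_zero (hν : IsNumberLike ν) {n : ℕ} {x : SymCoalg 𝒱}
    (hx : x ∈ symBelow 𝒱 n) : fallingPower ν n x = 0 := by
  induction n generalizing x with
  | zero =>
    rw [symBelow_eq_bot 𝒱 (by simp), Submodule.mem_bot] at hx
    simp [hx]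
  | succ n ih =>
    rw [fallingPower_succ]
    exact ih (hν.sub_mem_of_mem_symBelow hx)

/-- On the graded piece `ν` is the scalar `n`, so the falling power is the scalar `n (n - 1) ⋯ (n -
k + 1)`. -/
theorem fallingPower_sub_mem (hν : IsNumberLike ν) {n k : ℕ} (hk : k ≤ n) {x : SymCoalg 𝒱}
    (hx : x ∈ symPow 𝒱 n) :
    fallingPower ν k x - (n.descFactorial k : K) • x ∈ symBelow 𝒱 n := by
  induction k with
  | zero => simp
  | succ k ih =>
    have h1 := hν.fallingPower_mem_symBelow k (hν.sub_mem_symBelow n x hx)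
    have h2 := Submodule.smul_mem _ ((n : K) - k) (ih (by omega))
    have := add_mem h1 h2
    rw [fallingPower_succ, Nat.descFactorial_succ, Nat.cast_mul, Nat.cast_sub (by omega)]
    convert this using 1
    rw [map_sub, map_sub, map_smul, map_smul]
    module

/-- Applying `ν - n` to the `n`-th falling power gives the next one, which kills everything with at
most `n` factors. -/
theorem map_straighten (hν : IsNumberLike ν) {n : ℕ} {x : SymCoalg 𝒱} (hx : x ∈ symPow 𝒱 n) :
    ν (straighten ν x) = (n : K) • straighten ν x := by
  have h := hν.fallingPower_eq_zero (n := n + 1)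
    (symPow_le_symBelow 𝒱 (by push_cast; omega) hx)
  rw [fallingPower_succ', sub_eq_zero] at h
  rw [straighten_apply ν hx, map_smul, h, smul_comm]

theorem hasDegree_straighten (hν : IsNumberLike ν) :
    HasDegree (degPart 𝒱) (degPart 𝒱) 0 (straighten ν) := by
  have hF : ∀ (k : ℕ) (d : ℤ), ∀ x ∈ degPart 𝒱 d, fallingPower ν k x ∈ degPart 𝒱 d := by
    intro k d x hx
    induction k with
    | zero => simpa using hx
    | succ k ih =>
      rw [fallingPower_succ']
      have := hν.isCoderivation.hasDegree _ _ ih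
      rw [add_zero] at this
      exact sub_mem this (Submodule.smul_mem _ _ ih)
  intro d x hx
  rw [add_zero]
  refine (Submodule.span_le (p := (degPart 𝒱 d).comap (straighten ν))).2 ?_ hx
  rintro y ⟨n, d, hy, rfl⟩
  rw [SetLike.mem_coe, Submodule.mem_comap, straighten_apply ν (hy.mem_symPow 𝒱)]
  exact Submodule.smul_mem _ _ (hF _ _ _ (hy.mem_degPart 𝒱))

variable [CharZero K]

/-- The leading coefficient is `n! / n! = 1`, so `straighten ν` is unipotent for the filtration. -/
theorem straighten_sub_mem (hν : IsNumberLike ν) {m : ℤ} {x : SymCoalg 𝒱}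
    (hx : x ∈ symBelow 𝒱 m) : straighten ν x - x ∈ symBelow 𝒱 (m - 1) := by
  refine (symBelow_le_iff 𝒱 (p := (symBelow 𝒱 (m - 1)).comap (straighten ν - LinearMap.id))).2
    (fun n hn x hx => ?_) hx
  change straighten ν x - x ∈ symBelow 𝒱 (m - 1)
  have h := hν.fallingPower_sub_mem le_rfl hx
  rw [Nat.descFactorial_self] at h
  have h' := Submodule.smul_mem _ (n.factorial : K)⁻¹ h
  rw [smul_sub, smul_smul, inv_mul_cancel₀ (by exact_mod_cast n.factorial_ne_zero), one_smul,
    ← straighten_apply ν hx] at h'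
  exact symBelow_mono 𝒱 (by omega) h'

theorem straighten_mem_symBelow (hν : IsNumberLike ν) {m : ℤ} {x : SymCoalg 𝒱}
    (hx : x ∈ symBelow 𝒱 m) : straighten ν x ∈ symBelow 𝒱 m := by
  have := add_mem (symBelow_mono 𝒱 (by omega) (hν.straighten_sub_mem hx)) hx
  rwa [sub_add_cancel] at this

/-- A unipotent map is invertible because the filtration is exhaustive and starts at zero; both
halves descend along it. -/
theorem bijective_straighten (hν : IsNumberLike ν) : Function.Bijective (straighten ν) := by
  constructor
  · rw [← LinearMap.ker_eq_bot, LinearMap.ker_eq_bot']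
    intro x hx
    obtain ⟨n, hn⟩ := exists_mem_symBelow 𝒱 x
    induction n with
    | zero => rwa [symBelow_eq_bot 𝒱 (by simp), Submodule.mem_bot] at hn
    | succ n ih =>
      have := hν.straighten_sub_mem hn
      rw [hx, zero_sub, Submodule.neg_mem_iff] at this
      exact ih (by simpa using this)
  · intro x
    obtain ⟨n, hn⟩ := exists_mem_symBelow 𝒱 x
    induction n generalizing x with
    | zero =>
      rw [symBelow_eq_bot 𝒱 (by simp), Submodule.mem_bot] at hn
      exact ⟨0, by rw [hn, map_zero]⟩
    | succ n ih =>
      obtain ⟨y, hy⟩ := ih (straighten ν x - x) (by simpa using hν.straighten_sub_mem hn)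
      exact ⟨x - y, by rw [map_sub, hy, sub_sub_cancel]⟩

/-- On the associated graded of `S(V) ⊗ S(V)`, `leibniz ν` counts the factors on both sides, so
`eq_zero_of_eigenvector` applies there too. -/
theorem tensor_sub_mem (hν : IsNumberLike ν) (n : ℕ) {w : SymCoalg 𝒱 ⊗[K] SymCoalg 𝒱}
    (hw : w ∈ tensorBelow 𝒱 (n + 1 : ℕ)) :
    leibniz ν w - (n : K) • w ∈
      tensorBelow 𝒱 n := by
  refine (Submodule.span_le (p := (tensorBelow 𝒱 n).comap
    (leibniz ν - (n : K) • LinearMap.id))).2 ?_ hw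
  rintro _ ⟨n₁, d₁, a, n₂, d₂, b, ha, hb, hn, rfl⟩
  have ha' := symPow_le_symBelow 𝒱 (lt_add_one (n₁ : ℤ)) (ha.mem_symPow 𝒱)
  have hb' := symPow_le_symBelow 𝒱 (lt_add_one (n₂ : ℤ)) (hb.mem_symPow 𝒱)
  have hn : (n₁ + n₂ : ℤ) ≤ n := by push_cast at hn; omega
  have h1 : (ν a - (n₁ : K) • a) ⊗ₜ[K] b ∈ tensorBelow 𝒱 n :=
    tmul_mem_tensorBelow 𝒱 (hν.sub_mem_symBelow _ a (ha.mem_symPow 𝒱)) hb' (by omega)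
  have h2 : a ⊗ₜ[K] (ν b - (n₂ : K) • b) ∈ tensorBelow 𝒱 n :=
    tmul_mem_tensorBelow 𝒱 ha' (hν.sub_mem_symBelow _ b (hb.mem_symPow 𝒱)) (by omega)
  have h3 : ((n₁ : K) + n₂ - n) • a ⊗ₜ[K] b ∈ tensorBelow 𝒱 n := by
    rcases hn.lt_or_eq with h | h
    · exact Submodule.smul_mem _ _ (tmul_mem_tensorBelow 𝒱 ha' hb' (by omega))
    · have : (n₁ : K) + n₂ = n := by exact_mod_cast h
      rw [this, sub_self, zero_smul]
      exact zero_mem _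
  have := add_mem (add_mem h1 h2) h3
  rw [SetLike.mem_coe, Submodule.mem_comap]
  convert this using 1
  simp only [LinearMap.sub_apply, leibniz_tmul, LinearMap.id_apply,
    LinearMap.smul_apply, TensorProduct.sub_tmul, TensorProduct.tmul_sub, TensorProduct.tmul_smul,
    ← TensorProduct.smul_tmul']
  module

/-- For a monomial with `n` factors both sides are eigenvectors of `leibniz ν` of eigenvalue `n`,
and both equal the coproduct of the monomial up to fewer factors. Their difference is therefore
zero. -/
theorem comul_straighten (hν : IsNumberLike ν) (x : SymCoalg 𝒱) :
    comul 𝒱 (straighten ν x) =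
      TensorProduct.map (straighten ν) (straighten ν) (comul 𝒱 x) := by
  induction x using induction_monomial 𝒱 with
  | mono n d y hy =>
    have hyn := hy.mem_symPow 𝒱
    refine sub_eq_zero.1 (eq_zero_of_eigenvector (M := fun n => tensorBelow 𝒱 n)
      (tensorBelow_eq_bot 𝒱 (by simp)) (fun n w hw => hν.tensor_sub_mem n hw) (n := n) ?_ ?_)
    · have h1 := comul_mem_tensorBelow 𝒱 (hν.straighten_sub_mem (hy.mem_symBelow 𝒱 (lt_add_one _)))
      rw [add_sub_cancel_right] at h1
      have h2 : TensorProduct.map (straighten ν) (straighten ν) (comul 𝒱 y) - comul 𝒱 y ∈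
          tensorBelow 𝒱 n := by
        refine (Submodule.span_le (p := (tensorBelow 𝒱 n).comap
          (TensorProduct.map (straighten ν) (straighten ν) - LinearMap.id))).2 ?_
          (comul_mem_tensorPart 𝒱 hy)
        rintro _ ⟨n₁, d₁, a, n₂, d₂, b, ha, hb, rfl, rfl, rfl⟩
        have ha' := symPow_le_symBelow 𝒱 (lt_add_one (n₁ : ℤ)) (ha.mem_symPow 𝒱)
        have hb' := symPow_le_symBelow 𝒱 (lt_add_one (n₂ : ℤ)) (hb.mem_symPow 𝒱)
        have := add_mem (tmul_mem_tensorBelow 𝒱 (k := (n₁ + n₂ : ℕ)) (hν.straighten_sub_mem ha')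
          (hν.straighten_mem_symBelow hb') (by push_cast; omega))
          (tmul_mem_tensorBelow 𝒱 (k := (n₁ + n₂ : ℕ)) ha' (hν.straighten_sub_mem hb')
            (by push_cast; omega))
        rw [TensorProduct.sub_tmul, TensorProduct.tmul_sub, sub_add_sub_cancel] at this
        exact this
      have := sub_mem h1 h2
      rw [map_sub, sub_sub_sub_cancel_right] at this
      simpa using this
    · have h1 : leibniz ν
          (comul 𝒱 (straighten ν y)) = (n : K) • comul 𝒱 (straighten ν y) := by
        rw [← hν.isCoderivation.comul_apply_eq_leibniz, hν.map_straighten hyn,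
          map_smul]
      have h2 : leibniz ν
          (TensorProduct.map (straighten ν) (straighten ν) (comul 𝒱 y)) =
          (n : K) • TensorProduct.map (straighten ν) (straighten ν) (comul 𝒱 y) := by
        refine (Submodule.span_le (p := LinearMap.eqLocus
          (leibniz ν ∘ₗ
            TensorProduct.map (straighten ν) (straighten ν))
          ((n : K) • TensorProduct.map (straighten ν) (straighten ν)))).2 ?_
          (comul_mem_tensorPart 𝒱 hy)
        rintro _ ⟨n₁, d₁, a, n₂, d₂, b, ha, hb, rfl, rfl, rfl⟩
        simp only [SetLike.mem_coe, LinearMap.mem_eqLocus, LinearMap.comp_apply,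
          leibniz_tmul, TensorProduct.map_tmul, LinearMap.smul_apply,
          hν.map_straighten (ha.mem_symPow 𝒱), hν.map_straighten (hb.mem_symPow 𝒱),
          TensorProduct.tmul_smul, ← TensorProduct.smul_tmul']
        push_cast
        module
      rw [map_sub, h1, h2, smul_sub]
  | zero => simp
  | add x y hx hy => simp only [map_add, hx, hy]
  | smul r x hx => simp only [map_smul, hx]

theorem isCoalgHom_straighten (hν : IsNumberLike ν) : IsCoalgHom 𝒱 𝒱 (straighten ν) where
  hasDegree := hν.hasDegree_straighten
  comul_comp := LinearMap.ext hν.comul_straighten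
  counit_comp := by
    refine linearMap_ext_symPow 𝒱 fun n x hx => ?_
    rcases Nat.eq_zero_or_pos n with rfl | hn
    · simp [straighten_apply ν hx]
    -- For `n > 0`, `straighten ν x` is an eigenvector of nonzero eigenvalue, hence in the image of
    -- the coderivation `ν`, on which the counit vanishes.
    · have h1 := congrArg (counit 𝒱) (hν.map_straighten hx)
      have h2 : counit 𝒱 x = 0 := by
        have := isCoderivation_hat_proj 𝒱 |>.counit_apply x
        rw [hat_proj_symPow 𝒱 hx, map_smul, smul_eq_mul] at this
        exact (mul_eq_zero.1 this).resolve_left (by exact_mod_cast hn.ne')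
      rw [hν.isCoderivation.counit_apply, map_smul, smul_eq_mul] at h1
      exact ((mul_eq_zero.1 h1.symm).resolve_left (by exact_mod_cast hn.ne')).trans h2.symm
  map_one := by simp [straighten_apply ν (IsMonomial.one.mem_symPow 𝒱)]

end IsNumberLike

end SymCoalg

/-! ### From a cocycle to an isomorphism with the quadratic part. -/

namespace LInfinityOneAlgebra

variable {𝒱 : ℤ → Submodule K V} [DirectSum.Decomposition 𝒱] {L : LInfinityOneAlgebra 𝒱}
  [CharZero K]

theorem Q_sub_quadraticPart_mem (hL : L.IsMinimal) :
    L.Q - (L.quadraticPart hL).Q ∈ vanishingBelow 𝒱 3 := by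
  intro i hi x hx
  refine (L.isCoderivation.sub 𝒱 (L.quadraticPart hL).isCoderivation).eq_zero 𝒱 3
    (fun k hk x hx => ?_) i (by omega) x hx
  change proj 𝒱 (L.Q x - hat 𝒱 (L.bracket 2) x) = 0
  rw [map_sub, proj_hat_apply]
  by_cases h : k = 2
  · subst h
    rw [L.bracket_apply hx, sub_self]
  · rw [L.bracket_apply_ne h hx, sub_zero,
      Q_mem_vanishingBelow hL k (by omega) x hx, map_zero]

/-- A cocycle completing the Euler derivation yields an isomorphism with the quadratic part. -/
theorem exists_isLInfinityIso_of_cocycle (hL : L.IsMinimal) {z : SymCoalg 𝒱 →ₗ[K] SymCoalg 𝒱}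
    (hz : IsCoderivation 𝒱 0 z) (hze : z - eulerDerivation 𝒱 ∈ vanishingBelow 𝒱 2)
    (hQ : L.Q * z = z * L.Q) : ∃ f, IsLInfinityIso (L.quadraticPart hL) L f := by
  -- This is `z` minus the degree operator, written as a counting operator plus a coderivation in
  -- `F^2`.
  set ν := z - eulerDerivation 𝒱 + hat 𝒱 (proj 𝒱) with hνdef
  have hν : IsNumberLike ν := by
    refine ⟨(hz.sub 𝒱 (isCoderivation_eulerDerivation 𝒱)).add (isCoderivation_hat_proj 𝒱),
      fun n x hx => ?_⟩
    rw [hνdef, LinearMap.add_apply, hat_proj_symPow 𝒱 hx, add_sub_cancel_right]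
    exact (hz.sub 𝒱 (isCoderivation_eulerDerivation 𝒱)).apply_mem_symBelow hze
      (symPow_le_symBelow 𝒱 (lt_add_one _) hx) (by omega)
  -- `z` commutes with `Q`, and the degree operator has commutator `Q` with it because `Q` has
  -- degree 1.
  have hνQ : ∀ x, ν (L.Q x) = L.Q (ν x) - L.Q x := by
    intro x
    induction x using DirectSum.Decomposition.inductionOn (degPart 𝒱) with
    | zero => simp
    | add x y hx hy =>
      simp only [map_add, hx, hy]
      abel
    | @homogeneous d x =>
      have h1 := eulerDerivation_sub_hat_proj 𝒱 x.2
      have h2 := eulerDerivation_sub_hat_proj 𝒱 (L.isCoderivation.hasDegree _ _ x.2)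
      have h3 : L.Q (z x) = z (L.Q x) := LinearMap.congr_fun hQ x
      have e : ∀ y, ν y = z y - (eulerDerivation 𝒱 y - hat 𝒱 (proj 𝒱) y) := by
        intro y
        simp only [hνdef, LinearMap.add_apply, LinearMap.sub_apply]
        abel
      rw [e, e, h1, h2, map_sub, map_smul, h3]
      push_cast
      module
  refine ⟨straighten ν, ⟨hν.isCoalgHom_straighten, ?_⟩, hν.bijective_straighten⟩
  refine linearMap_ext_symPow 𝒱 fun n x hx => ?_
  rw [LinearMap.comp_apply, LinearMap.comp_apply]
  rcases Nat.eq_zero_or_pos n with rfl | hn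
  · rw [eq_counit_smul_one 𝒱 hx, map_smul, map_smul, map_smul, map_smul,
      hν.isCoalgHom_straighten.map_one, (L.quadraticPart hL).map_one, L.map_one, map_zero]
  obtain ⟨n, rfl⟩ := Nat.exists_eq_succ_of_ne_zero hn.ne'
  have hq : (L.quadraticPart hL).Q x ∈ symPow 𝒱 n :=
    hat_mem_symPow 𝒱 (k := 2) (fun l hl x hx => L.bracket_apply_ne hl hx) (by omega) hx
  have hx' := symPow_le_symBelow 𝒱 (m := n + 2) (by push_cast; omega) hx
  -- Here `x` has `n + 1` factors. Both terms are eigenvectors of `ν` of eigenvalue `n`, as `Q`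
  -- lowers eigenvalues by 1, and their common leading term is the quadratic part of `Q` applied to
  -- `x`.
  refine (sub_eq_zero.1 (eq_zero_of_eigenvector (M := fun n => symBelow 𝒱 n)
    (symBelow_eq_bot 𝒱 (by simp)) (fun n w hw => hν.sub_mem_of_mem_symBelow hw) (n := n)
    (w := L.Q (straighten ν x) - straighten ν ((L.quadraticPart hL).Q x)) ?_ ?_)).symm
  · have h1 : L.Q (straighten ν x - x) ∈ symBelow 𝒱 n :=
      L.isCoderivation.apply_mem_symBelow (Q_mem_vanishingBelow hL) (hν.straighten_sub_mem hx')
        (by omega)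
    have h2 : (L.Q - (L.quadraticPart hL).Q) x ∈ symBelow 𝒱 n :=
      (L.isCoderivation.sub 𝒱 (L.quadraticPart hL).isCoderivation).apply_mem_symBelow
        (Q_sub_quadraticPart_mem hL) hx' (by omega)
    have h3 := hν.straighten_sub_mem (symPow_le_symBelow 𝒱 (lt_add_one _) hq)
    rw [add_sub_cancel_right] at h3
    have := sub_mem (add_mem h1 h2) h3
    convert this using 1
    rw [map_sub, LinearMap.sub_apply]
    abel
  · rw [map_sub, hνQ, hν.map_straighten hx, hν.map_straighten hq, map_smul]
    push_cast
    module

end LInfinityOneAlgebra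

/-! ### Coalgebra morphisms: filtration, inverses and conjugation. -/

section CoalgHom

variable {𝒱 : ℤ → Submodule K V} [DirectSum.Decomposition 𝒱]

theorem isNumberLike_hat_proj : IsNumberLike (hat 𝒱 (proj 𝒱)) :=
  ⟨isCoderivation_hat_proj 𝒱, fun n x hx => by simp [hat_proj_symPow 𝒱 hx]⟩

/-- The counting operator is invertible on `V^{⊙ k}` for `k ≥ 1`. It loses only constants, which
belong to the subspace because `m > 0`. -/
theorem mem_symBelow_of_hat_proj_mem [CharZero K] {m : ℕ} (hm : 0 < m) {x : SymCoalg 𝒱}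
    (hx : hat 𝒱 (proj 𝒱) x ∈ symBelow 𝒱 m) : x ∈ symBelow 𝒱 m := by
  obtain ⟨k, hk⟩ := exists_mem_symBelow 𝒱 x
  induction k with
  | zero => exact symBelow_mono 𝒱 (by simp) hk
  | succ k ih =>
    rcases Nat.lt_or_ge k m with h | h
    · exact symBelow_mono 𝒱 (by exact_mod_cast h) hk
    · refine ih ?_
      have := sub_mem (symBelow_mono 𝒱 (by exact_mod_cast h) hx)
        (isNumberLike_hat_proj.sub_mem_of_mem_symBelow hk)
      rw [sub_sub_cancel] at this
      exact (Submodule.smul_mem_iff _ (by exact_mod_cast (by omega : k ≠ 0))).1 this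

/-- Morphisms of coalgebras respect the filtration by the number of factors. -/
theorem IsCoalgHom.apply_mem_symBelow [CharZero K] {f : SymCoalg 𝒱 →ₗ[K] SymCoalg 𝒱}
    (hf : IsCoalgHom 𝒱 𝒱 f) {m : ℤ} {x : SymCoalg 𝒱} (hx : x ∈ symBelow 𝒱 m) :
    f x ∈ symBelow 𝒱 m := by
  have key : ∀ n : ℕ, ∀ x ∈ symPow 𝒱 n, f x ∈ symBelow 𝒱 (n + 1 : ℕ) := by
    intro n
    induction n using Nat.strong_induction_on with
    | _ n ih =>
      intro x hx
      rcases Nat.eq_zero_or_pos n with rfl | hn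
      · rw [eq_counit_smul_one 𝒱 hx, map_smul, hf.map_one]
        exact Submodule.smul_mem _ _ (IsMonomial.one.mem_symBelow 𝒱 (by simp))
      · refine (Submodule.span_le (p := (symBelow 𝒱 (n + 1 : ℕ)).comap f)).2 ?_ hx
        rintro y ⟨n, d, hy, rfl⟩
        change 0 < n at hn
        change ∀ m < n, _ at ih
        -- After applying the counting operator, `f y` expands through the coproduct of `y` into
        -- products of `proj (f a)` and `f b`. The term with `a = 1` vanishes; in the others `b` is
        -- shorter and the induction hypothesis applies.
        refine mem_symBelow_of_hat_proj_mem (Nat.succ_pos _) ?_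
        rw [hat, LinearMap.comp_apply, LinearMap.comp_apply]
        have hΔ : comul 𝒱 (f y) = TensorProduct.map f f (comul 𝒱 y) :=
          LinearMap.congr_fun hf.comul_comp y
        rw [hΔ]
        refine (Submodule.span_le (p := (symBelow 𝒱 (n + 1 : ℕ)).comap
          (LinearMap.mul' K (SymCoalg 𝒱) ∘ₗ TensorProduct.map (ι 𝒱 ∘ₗ proj 𝒱) LinearMap.id ∘ₗ
            TensorProduct.map f f))).2 ?_ (comul_mem_tensorPart 𝒱 hy)
        rintro _ ⟨n₁, d₁, a, n₂, d₂, b, ha, hb, rfl, rfl, rfl⟩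
        simp only [SetLike.mem_coe, Submodule.mem_comap, LinearMap.comp_apply,
          TensorProduct.map_tmul, LinearMap.mul'_apply, LinearMap.id_apply]
        cases ha with
        | one => simp [hf.map_one]
        | @ι_mul i n₁ d₁ v a hv ha =>
          have h1 := symPow_le_symBelow 𝒱 (m := 2) (by norm_num)
            (ι_mem_symPow 𝒱 (proj 𝒱 (f (ι 𝒱 v * a))))
          refine symBelow_mono 𝒱 ?_ (mul_mem_symBelow 𝒱 h1 (ih n₂ (by omega) b (hb.mem_symPow 𝒱)))
          push_cast
          omega
  refine (symBelow_le_iff 𝒱 (p := (symBelow 𝒱 m).comap f)).2 (fun n hn x hx => ?_) hx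
  exact symBelow_mono 𝒱 (by push_cast; omega) (key n x hx)

/-- A map of degree 0 commutes with the projections to homogeneous components, so by injectivity the
components of `y` outside degree `d` vanish. -/
theorem mem_degPart_of_apply_mem {f : SymCoalg 𝒱 →ₗ[K] SymCoalg 𝒱}
    (hf : HasDegree (degPart 𝒱) (degPart 𝒱) 0 f) (hinj : Function.Injective f) {d : ℤ}
    {y : SymCoalg 𝒱} (hy : f y ∈ degPart 𝒱 d) : y ∈ degPart 𝒱 d := by
  classical
  have key : ∀ (y : SymCoalg 𝒱) (i : ℤ), (DirectSum.decompose (degPart 𝒱) (f y) i : SymCoalg 𝒱) =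
      f (DirectSum.decompose (degPart 𝒱) y i : SymCoalg 𝒱) := by
    intro y i
    induction y using DirectSum.Decomposition.inductionOn (degPart 𝒱) with
    | zero => simp
    | add x y hx hy => simp [hx, hy, DirectSum.decompose_add]
    | @homogeneous j a =>
      have ha := hf _ _ a.2
      rw [add_zero] at ha
      by_cases hj : j = i
      · subst hj
        rw [DirectSum.decompose_of_mem_same _ ha, DirectSum.decompose_of_mem_same _ a.2]
      · rw [DirectSum.decompose_of_mem_ne _ ha hj, DirectSum.decompose_of_mem_ne _ a.2 hj, map_zero]
  rw [← DirectSum.sum_support_decompose (degPart 𝒱) y]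
  refine Submodule.sum_mem _ fun i _ => ?_
  by_cases hi : d = i
  · subst hi
    exact SetLike.coe_mem _
  · have h := key y i
    rw [DirectSum.decompose_of_mem_ne _ hy hi] at h
    rw [(map_eq_zero_iff f hinj).1 h.symm]
    exact zero_mem _

/-- The inverse of a bijective morphism of coalgebras. -/
theorem IsCoalgHom.symm (e : SymCoalg 𝒱 ≃ₗ[K] SymCoalg 𝒱) (he : IsCoalgHom 𝒱 𝒱 e.toLinearMap) :
    IsCoalgHom 𝒱 𝒱 e.symm.toLinearMap where
  hasDegree d x hx := by
    rw [add_zero]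
    refine mem_degPart_of_apply_mem he.hasDegree e.injective ?_
    simpa using hx
  comul_comp := by
    have h : TensorProduct.map e.symm.toLinearMap e.symm.toLinearMap ∘ₗ
        TensorProduct.map e.toLinearMap e.toLinearMap = LinearMap.id := by
      rw [← TensorProduct.map_comp, LinearEquiv.symm_comp, TensorProduct.map_id]
    calc comul 𝒱 ∘ₗ e.symm.toLinearMap
        = TensorProduct.map e.symm.toLinearMap e.symm.toLinearMap ∘ₗ
          (TensorProduct.map e.toLinearMap e.toLinearMap ∘ₗ comul 𝒱) ∘ₗ e.symm.toLinearMap := by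
            rw [LinearMap.comp_assoc, ← LinearMap.comp_assoc, h, LinearMap.id_comp]
      _ = _ := by
            rw [← he.comul_comp, LinearMap.comp_assoc, LinearEquiv.comp_symm, LinearMap.comp_id]
  counit_comp := by
    conv_lhs => rw [← he.counit_comp, LinearMap.comp_assoc, LinearEquiv.comp_symm,
      LinearMap.comp_id]
  map_one := by
    have h : e 1 = 1 := he.map_one
    change e.symm 1 = 1
    rw [LinearEquiv.symm_apply_eq, h]

theorem SymCoalg.IsCoderivation.conj {e : SymCoalg 𝒱 ≃ₗ[K] SymCoalg 𝒱}
    (he : IsCoalgHom 𝒱 𝒱 e.toLinearMap) {α : SymCoalg 𝒱 →ₗ[K] SymCoalg 𝒱}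
    (hα : IsCoderivation 𝒱 0 α) :
    IsCoderivation 𝒱 0 (e.toLinearMap ∘ₗ α ∘ₗ e.symm.toLinearMap) where
  hasDegree d x hx := by
    have := he.hasDegree _ _ (hα.hasDegree _ _ ((he.symm e).hasDegree _ _ hx))
    simpa using this
  comul_comp := by
    have hα' := hα.comul_comp
    rw [signMap_zero] at hα' ⊢
    rw [← LinearMap.comp_assoc, he.comul_comp, LinearMap.comp_assoc, ← LinearMap.comp_assoc _ α,
      hα', LinearMap.comp_assoc, (he.symm e).comul_comp, ← LinearMap.comp_assoc,
      ← LinearMap.comp_assoc]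
    congr 1
    simp only [LinearMap.add_comp, LinearMap.comp_add, ← TensorProduct.map_comp,
      LinearMap.comp_id, LinearEquiv.comp_symm, LinearMap.comp_assoc]

end CoalgHom

/-! ### From an isomorphism to a cocycle. -/

namespace LInfinityOneAlgebra

variable {𝒱 : ℤ → Submodule K V} [DirectSum.Decomposition 𝒱] {L : LInfinityOneAlgebra 𝒱}
  [CharZero K]

/-- The quadratic part removes one factor and raises the degree by one, so the eigenvalue `n + d` is
unchanged. -/
theorem eulerDerivation_quadraticPart (hL : L.IsMinimal) :
    eulerDerivation 𝒱 ∘ₗ (L.quadraticPart hL).Q = (L.quadraticPart hL).Q ∘ₗ eulerDerivation 𝒱 := by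
  ext x
  induction x using induction_monomial 𝒱 with
  | mono n d y hy =>
    rw [LinearMap.comp_apply, LinearMap.comp_apply, eulerDerivation_monomial 𝒱 hy, map_smul]
    have h1 := eulerDerivation_sub_hat_proj 𝒱
      ((L.quadraticPart hL).isCoderivation.hasDegree _ _ (hy.mem_degPart 𝒱))
    rcases Nat.eq_zero_or_pos n with rfl | hn
    · cases hy
      simp [(L.quadraticPart hL).map_one]
    · obtain ⟨n, rfl⟩ := Nat.exists_eq_succ_of_ne_zero hn.ne'
      have hq : (L.quadraticPart hL).Q y ∈ symPow 𝒱 n :=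
        hat_mem_symPow 𝒱 (k := 2) (fun l hl x hx => L.bracket_apply_ne hl hx) (by omega)
          (hy.mem_symPow 𝒱)
      rw [sub_eq_iff_eq_add.1 h1, hat_proj_symPow 𝒱 hq]
      push_cast
      module
  | zero => simp
  | add x y hx hy => rw [map_add, hx, hy, map_add]
  | smul r x hx => rw [map_smul, hx, map_smul]

/-- An isomorphism with the quadratic part transports the Euler derivation to a cocycle. -/
theorem exists_eulerCocycle_of_isLInfinityIso (hL : L.IsMinimal)
    {f : SymCoalg 𝒱 →ₗ[K] SymCoalg 𝒱} (hf : IsLInfinityIso (L.quadraticPart hL) L f) :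
    ∃ z, IsCoderivation 𝒱 0 z ∧ z - eulerDerivation 𝒱 ∈ vanishingBelow 𝒱 2 ∧
      L.Q * z = z * L.Q := by
  obtain ⟨⟨hf, hfQ⟩, hbij⟩ := hf
  obtain ⟨e, rfl⟩ : ∃ e : SymCoalg 𝒱 ≃ₗ[K] SymCoalg 𝒱, e.toLinearMap = f :=
    ⟨LinearEquiv.ofBijective f hbij, rfl⟩
  have hc := (isCoderivation_eulerDerivation 𝒱).conj hf
  refine ⟨_, hc, ?_, ?_⟩
  · intro i hi x hx
    refine (hc.sub 𝒱 (isCoderivation_eulerDerivation 𝒱)).eq_zero 𝒱 2 (fun k hk x hx => ?_) i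
      (by omega) x hx
    -- A coderivation is in `F^2` once its corestriction vanishes there, so constants may be
    -- ignored.
    have hproj : ∀ y ∈ symBelow 𝒱 1, proj 𝒱 y = 0 := fun y hy => by
      refine (symBelow_le_iff 𝒱 (p := LinearMap.ker (proj 𝒱))).2 (fun n hn x hx => ?_) hy
      obtain rfl : n = 0 := by omega
      rw [LinearMap.mem_ker, eq_counit_smul_one 𝒱 hx, map_smul, proj_one, smul_zero]
    refine hproj _ ?_
    -- Since `e` preserves degrees, only the counting operator matters. It acts on `e y` as `n` up
    -- to fewer than `n ≤ 1` factors, hence up to a constant.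
    have hcomm : ∀ y ∈ symBelow 𝒱 2, e (eulerDerivation 𝒱 y) - eulerDerivation 𝒱 (e y) ∈
        symBelow 𝒱 1 := fun y hy => by
      refine (Submodule.span_le (p := (symBelow 𝒱 1).comap
        (e.toLinearMap ∘ₗ eulerDerivation 𝒱 - eulerDerivation 𝒱 ∘ₗ e.toLinearMap))).2 ?_ hy
      rintro y ⟨n, d, hy, hn⟩
      have hd := hf.hasDegree _ _ (hy.mem_degPart 𝒱)
      rw [add_zero, LinearEquiv.coe_coe] at hd
      have h1 := isNumberLike_hat_proj.sub_mem_of_mem_symBelow (n := n)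
        (hf.apply_mem_symBelow (hy.mem_symBelow 𝒱 (m := (n + 1 : ℕ)) (by push_cast; omega)))
      rw [LinearEquiv.coe_coe] at h1
      change e (eulerDerivation 𝒱 y) - eulerDerivation 𝒱 (e y) ∈ symBelow 𝒱 1
      rw [eulerDerivation_monomial 𝒱 hy, map_smul,
        sub_eq_iff_eq_add.1 (eulerDerivation_sub_hat_proj 𝒱 hd)]
      have h2 := symBelow_mono 𝒱 (by omega : (n : ℤ) ≤ 1) (neg_mem h1)
      convert h2 using 1
      module
    have := hcomm (e.symm x) ((hf.symm e).apply_mem_symBelow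
      (symPow_le_symBelow 𝒱 (by exact_mod_cast hk) hx))
    rw [LinearEquiv.apply_symm_apply] at this
    exact this
  · have h1 : (L.quadraticPart hL).Q ∘ₗ e.symm.toLinearMap = e.symm.toLinearMap ∘ₗ L.Q := by
      ext x
      have h := LinearMap.congr_fun hfQ (e.symm x)
      simp only [LinearMap.comp_apply, LinearEquiv.coe_coe, LinearEquiv.apply_symm_apply] at h ⊢
      rw [← h, LinearEquiv.symm_apply_apply]
    change L.Q ∘ₗ e.toLinearMap ∘ₗ eulerDerivation 𝒱 ∘ₗ e.symm.toLinearMap =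
      (e.toLinearMap ∘ₗ eulerDerivation 𝒱 ∘ₗ e.symm.toLinearMap) ∘ₗ L.Q
    rw [← LinearMap.comp_assoc, ← hfQ, LinearMap.comp_assoc, LinearMap.comp_assoc,
      LinearMap.comp_assoc, ← h1, ← LinearMap.comp_assoc _ _ (eulerDerivation 𝒱),
      eulerDerivation_quadraticPart hL, LinearMap.comp_assoc]

end LInfinityOneAlgebra

end

end LInfinity

/-! ### The equivalence. -/

theorem theorem6p3 {K V : Type*} [Field K] [CharZero K] [AddCommGroup V] [Module K V]
    (𝒱 : ℤ → Submodule K V) [DirectSum.Decomposition 𝒱]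
    (L : LInfinity.LInfinityOneAlgebra 𝒱) (hL : L.IsMinimal) :
    List.TFAE [
      ∃ f : LInfinity.SymCoalg 𝒱 →ₗ[K] LInfinity.SymCoalg 𝒱,
        LInfinity.IsLInfinityIso (L.quadraticPart hL) L f,
      L.CE.DegeneratesAt 2,
      L.CE.AllDifferentialsVanish (L.eulerClass hL)] := by
  tfae_have 1 → 2
  | ⟨_, hf⟩ => by
    obtain ⟨z, hz, hze, hQ⟩ :=
      LInfinity.LInfinityOneAlgebra.exists_eulerCocycle_of_isLInfinityIso hL hf
    exact L.degeneratesAt_two_of_cocycle hz hze hQ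
  tfae_have 2 → 3 := fun h => h.allDifferentialsVanish L.CE _
  tfae_have 3 → 1 := fun h => by
    obtain ⟨z, hz, hze, hQ⟩ :=
      LInfinity.LInfinityOneAlgebra.exists_eulerCocycle_of_allDifferentialsVanish hL h
    exact LInfinity.LInfinityOneAlgebra.exists_isLInfinityIso_of_cocycle hL hz hze hQ
  tfae_finish
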